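/- **Theorem 5.2.** *Root data.* Let $A=(a_{ij})$ be an $r\times r$ symmetrizable generalized Cartan matrix of rank $l$, with a fixed decomposition $A=\mathrm{diag}(\epsilon_1,\dots,\epsilon_r)B$, where the $\epsilon_i$ are positive rationals and $B=(b_{ij})$ is symmetric with $b_i:=b_{ii}\in\mathbb Z$, $b_{ij}\in\frac12\mathbb Z$. Let $\mathfrak h$ be a complex vector space with a basis $h_1,\dots,h_r,d_1,\dots,d_{r-l}$ and a basis $\alpha_1,\dots,\alpha_r,\delta_1,\dots,\delta_{r-l}$ of $\mathfrak h^*$ such that $\alpha_j(h_i)=a_{ij}$, $\alpha_j(d_k),\delta_k(h_j)\in\{0,1\}$, $\delta_k(d_{k'})=0$. Let $\mathfrak g(A)$ be the Kac–Moody algebra of this realization, $\Phi_+$ its set of positive roots, $\mathrm{mult}(\alpha)$ the root multiplicities, $W$ its Weyl group with simple reflections $\sigma_i$, $Q=\bigoplus\mathbb Z\alpha_i$, $Q_+=\bigoplus\mathbb Z_{\ge0}\alpha_i$, $(\alpha_i,\alpha_j)=b_{ij}$, and $d(\sum k_i\alpha_i)=\sum k_i$. Let $\omega_i\in\mathfrak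 h^*$ be given by $\omega_i(h_j)=\delta_{ij}$, $\omega_i(d_k)=0$, and put $\rho=\sum\omega_i$. For $n\ge1$ put $m(\alpha)=n/\gcd(n,(\alpha,\alpha))$ for a real root $\alpha$ and $m(\alpha)=n$ for an imaginary root $\alpha$. *Deformed character.* Let $q\ge2$ be an integer, let $\gamma:\mathbb Z/n\to\mathbb C$ satisfy $\gamma(0)=-1$ and $\gamma(i)\gamma(-i)=1/q$ for $i\ne0$, and let $\lambda=\sum l_i\omega_i$ with $l_i\in\mathbb Z_{\ge0}$. For $\beta\in Q$ let $\mu_i(\beta)=(\lambda+\rho-\beta)(h_i)$ and $\sigma_i\cdot\beta=\beta+\mu_i(\beta)\alpha_i$; let $[k]_m$ be the largest multiple of $m$ that is at most $k$. With $m=m(\alpha_i)$ define $$\mathbf x^\beta|_\lambda\sigma_i=\Big((q\mathbf x^{\alpha_i})^{[\mu_i(\beta)]_m}(1-\tfrac1q)\,\mathbf x^\beta+\gamma(b_i\mu_i(\beta))q^{\mu_i(\beta)}\big(1-(q\mathbf x^{\alpha_i})^{-m}\big)\mathbf x^{\sigma_i\cdot\beta}\Big)\sum_{k\ge0}(q^{m-1}\mathbf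 x^{m\alpha_i})^k,$$ extended linearly to formal distributions $\sum_{\beta\in Q}c(\beta)\mathbf x^\beta$ whenever the coefficients converge absolutely, and $f|_\lambda w=f|_\lambda\sigma_{i_1}|_\lambda\cdots|_\lambda\sigma_{i_k}$ for a reduced expression $w=\sigma_{i_1}\cdots\sigma_{i_k}$. Put $(w\mathbf x)^\beta=q^{d(w^{-1}\beta-\beta)}\mathbf x^{w^{-1}\beta}$ and $$\Delta(\mathbf x)=\prod_{\alpha\in\Phi_+}(1-q^{m(\alpha)d(\alpha)}\mathbf x^{m(\alpha)\alpha})^{\mathrm{mult}(\alpha)},\qquad D(\mathbf x)=\prod_{\alpha\in\Phi_+}(1-q^{m(\alpha)d(\alpha)-1}\mathbf x^{m(\alpha)\alpha})^{\mathrm{mult}(\alpha)},$$ $$j(w,\mathbf x)=\frac{\Delta(\mathbf x)}{\Delta(w\mathbf x)},\qquad N(\mathbf x;\lambda)=\frac{D(\mathbf x)}{\Delta(\mathbf x)}\sum_{w\in W}j(w,\mathbf x)\,(1|_\lambda w)(\mathbf x)\in\mathbb C[[x_1,\dots,x_r]],$$ where $x_i=\mathbf x^{\alpha_i}$ and quotients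 are taken in $\mathbb C[[x_1,\dots,x_r]][x_1^{-1},\dots,x_r^{-1}]$. *Arithmetic data.* Let $F$ be a number field containing the $2n$-th roots of unity, and $S$ a finite set of places of $F$ containing the archimedean places and the places ramified over $\mathbb Q$, such that the ring $\mathfrak o_S$ of $S$-integers is a principal ideal domain. Let $F_S=\prod_{v\in S}F_v$, and let $\psi$ be a nontrivial additive character of $F_S$ with $\psi(x\mathfrak o_S)=1$ if and only if $x\in\mathfrak o_S$. Let $(\cdot,\cdot)_S=\prod_{v\in S}(\cdot,\cdot)_v$ be the $S$-Hilbert symbol of order $n$ (the inverse of the product of the usual norm residue symbols), $\left(\frac cd\right)$ the $n$-th power residue symbol, both viewed in $\mathbb C$ through a fixed isomorphism of the groups of $n$-th roots of unity of $F$ and of $\mathbb C$, and $g(a,c;t)=\sum_{d\bmod c}\left(\frac dc\right)^t\psi(ad/c)$. Write $|c|=\#(\mathfrak o_S/c\mathfrak o_S)$ for $0\ne c\in\mathfrak o_S$. Fix a generator $\varpi$ of each nonzero prime ideal of $\mathfrak o_S$. *Coefficients.* For tuples $\mathbf c,\mathbf m$ of $r$ nonzero elements of $\mathfrak o_S$ the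 number $H(\mathbf c;\mathbf m)$ is determined by the following rules. (i) $H\big((\varpi^{k_i})_i;(\varpi^{l_i})_i\big)$ is the coefficient of $\mathbf x^{\sum k_i\alpha_i}$ in $N(\mathbf x;\sum l_i\omega_i)$, formed with $q=|\varpi|$, $\gamma(i)=g(1,\varpi;i)/q$ for $n\nmid i$ and $\gamma(i)=-1$ for $n\mid i$. (ii) $H(\mathbf u;\mathbf m)=1$ for $\mathbf u\in(\mathfrak o_S^\times)^r$. (iii) If $\prod c_i$ and $\prod c_i'$ are coprime, then $$H(\mathbf c\mathbf c';\mathbf m)=H(\mathbf c;\mathbf m)H(\mathbf c';\mathbf m)\prod_i\left(\tfrac{c_i}{c_i'}\right)^{b_i}\left(\tfrac{c_i'}{c_i}\right)^{b_i}\prod_{i<j}\left(\tfrac{c_i}{c_j'}\right)^{2b_{ij}}\left(\tfrac{c_i'}{c_j}\right)^{2b_{ij}}.$$ (iv) If $\prod c_i$ and $\prod m_i'$ are coprime, then $H(\mathbf c;\mathbf m\mathbf m')=H(\mathbf c;\mathbf m)\prod_i\left(\frac{m_i'}{c_i}\right)^{-b_i}$. *The space $\mathfrak M_B(\Omega)$.*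 Let $\Omega=\mathfrak o_S^\times F_S^{\times,n}$, where $F_S^{\times,n}$ is the group of $n$-th powers in $F_S^\times$, and let $\mathcal M_B(\Omega)$ be the space of functions $\Phi:(F_S^\times)^r\to\mathbb C$ with $$\Phi(\mathbf e\mathbf c)=\prod_i(e_i,c_i)_S^{b_i}\prod_{i<j}(e_i,c_j)_S^{2b_{ij}}\;\Phi(\mathbf c)\qquad(\mathbf e\in\Omega^r,\ \mathbf c\in(F_S^\times)^r).$$ For $\mathbf s\in\mathfrak h$ put $s_i=\alpha_i(\mathbf s)$. Let $\mathfrak M_B(\Omega)=\mathfrak A\otimes\mathcal M_B(\Omega)$, where $\mathfrak A$ is the ring of Laurent polynomials in the functions $|\varpi_v|^{s_i}$ ($v\in S$ nonarchimedean, $\varpi_v$ a uniformizer of $F_v$, $1\le i\le r$); its elements are regarded as functions $\Psi(\mathbf s;\mathbf c)$ on $\mathfrak h\times(F_S^\times)^r$. *Statement.* Let $\mathbf m$ be a tuple of $r$ nonzero elements of $\mathfrak o_S$ and let $\Psi\in\mathfrak M_B(\Omega)$. The series $$Z(\mathbf s;\mathbf m,\Psi)=\sum_{\mathbf c}H(\mathbf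 c;\mathbf m)\,\Psi(\mathbf s;\mathbf c)\,|\mathbf c|_Q^{-\mathbf s}\,|\mathbf m|_P^{\mathbf s},\qquad|\mathbf c|_Q^{\mathbf s}=\prod_i|c_i|^{\alpha_i(\mathbf s)},\quad|\mathbf m|_P^{\mathbf s}=\prod_i|m_i|^{\omega_i(\mathbf s)},$$ over $\mathbf c=(c_1,\dots,c_r)$ with $0\ne c_i\in\mathfrak o_S/\mathfrak o_S^\times$ (for any choice of representatives) converges absolutely for every $\mathbf s\in\mathfrak h$ such that $$\mathrm{Re}(\alpha_i(\mathbf s))=\mathrm{Re}(s_i)>\max\{1+\log_2r,\,2\}\qquad\text{for each }i=1,\dots,r.$$ -/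

import Mathlib

open scoped BigOperators

noncomputable section

namespace KMDirichlet

/-! ## Symmetrizable generalized Cartan matrices and Kac-Moody algebras -/

/-- A symmetrizable generalized Cartan matrix `A` of size `r`, with a fixed decomposition
`A = diag(ε) B`, where the `ε i` are positive rationals and `B` is symmetric and half-integral
(integral diagonal, off-diagonal entries in `½ℤ`). -/
structure CartanDatum (r : ℕ) where
  A : Matrix (Fin r) (Fin r) ℤ
  diag : ∀ i, A i i = 2
  off_diag : ∀ i j, i ≠ j → A i j ≤ 0
  zero_iff : ∀ i j, A i j = 0 ↔ A j i = 0
  ε : Fin r → ℚ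
  ε_pos : ∀ i, 0 < ε i
  B : Matrix (Fin r) (Fin r) ℚ
  decomp : A.map (Int.cast : ℤ → ℚ) = Matrix.diagonal ε * B
  symm : B.IsSymm
  diag_int : ∀ i, ∃ k : ℤ, B i i = k
  half_int : ∀ i j, ∃ k : ℤ, 2 * B i j = k

variable {r : ℕ}

/-- The integer `b_i = B i i = (α_i, α_i)`. -/
def CartanDatum.b (C : CartanDatum r) (i : Fin r) : ℤ := (C.B i i).num

/-- The integer `2 b_{ij} = 2 (α_i, α_j)`. -/
def CartanDatum.twoB (C : CartanDatum r) (i j : Fin r) : ℤ := (2 * C.B i j).num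

/-- The rank `l` of the matrix `A`. -/
def CartanDatum.rank (C : CartanDatum r) : ℕ := (C.A.map (Int.cast : ℤ → ℚ)).rank

/-- A realization of `A`: a complex vector space `𝔥` with a basis `h_1, …, h_r, d_1, …, d_{r-l}`
and a basis `α_1, …, α_r, δ_1, …, δ_{r-l}` of its dual, such that `α_j(h_i) = a_{ij}`,
`α_j(d_k) ∈ {0,1}`, `δ_k(h_j) ∈ {0,1}` and `δ_k(d_{k'}) = 0`. -/
structure Realization (C : CartanDatum r) (𝔥 : Type*) [AddCommGroup 𝔥] [Module ℂ 𝔥] where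
  corootBasis : Module.Basis (Fin r ⊕ Fin (r - C.rank)) ℂ 𝔥
  rootBasis : Module.Basis (Fin r ⊕ Fin (r - C.rank)) ℂ (Module.Dual ℂ 𝔥)
  root_coroot : ∀ i j, rootBasis (.inl j) (corootBasis (.inl i)) = (C.A i j : ℂ)
  root_d : ∀ j k, rootBasis (.inl j) (corootBasis (.inr k)) = 0 ∨
    rootBasis (.inl j) (corootBasis (.inr k)) = 1
  delta_coroot : ∀ k j, rootBasis (.inr k) (corootBasis (.inl j)) = 0 ∨
    rootBasis (.inr k) (corootBasis (.inl j)) = 1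
  delta_d : ∀ k k', rootBasis (.inr k) (corootBasis (.inr k')) = 0

section KacMoody

variable {C : CartanDatum r} {𝔥 : Type*} [AddCommGroup 𝔥] [Module ℂ 𝔥]

/-- The simple root `α_i`. -/
def Realization.α (R : Realization C 𝔥) (i : Fin r) : Module.Dual ℂ 𝔥 := R.rootBasis (.inl i)

/-- The simple coroot `h_i`. -/
def Realization.coroot (R : Realization C 𝔥) (i : Fin r) : 𝔥 := R.corootBasis (.inl i)

/-- The fundamental weight `ω_i`: `ω_i(h_j) = δ_{ij}` and `ω_i(d_k) = 0`. -/
def Realization.ω (R : Realization C 𝔥) (i : Fin r) : Module.Dual ℂ 𝔥 :=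
  R.corootBasis.coord (.inl i)

/-- Generators of the Kac-Moody algebra: the elements of `𝔥` and the Chevalley generators. -/
inductive Gen (r : ℕ) (𝔥 : Type*)
  | h : 𝔥 → Gen r 𝔥
  | e : Fin r → Gen r 𝔥
  | f : Fin r → Gen r 𝔥

/-- The generator `x ∈ 𝔥` in the free Lie algebra. -/
abbrev freeH (x : 𝔥) : FreeLieAlgebra ℂ (Gen r 𝔥) := FreeLieAlgebra.of ℂ (Gen.h x)

/-- The generator `e_i` in the free Lie algebra. -/
abbrev freeE (𝔥 : Type*) (i : Fin r) : FreeLieAlgebra ℂ (Gen r 𝔥) := FreeLieAlgebra.of ℂ (Gen.e i)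

/-- The generator `f_i` in the free Lie algebra. -/
abbrev freeF (𝔥 : Type*) (i : Fin r) : FreeLieAlgebra ℂ (Gen r 𝔥) := FreeLieAlgebra.of ℂ (Gen.f i)

/-- The defining relations of the auxiliary Lie algebra `g̃(A)`: `𝔥` is a commutative subalgebra,
`[e_i, f_j] = δ_{ij} h_i`, `[x, e_i] = α_i(x) e_i`, `[x, f_i] = -α_i(x) f_i` for `x ∈ 𝔥`. -/
def relations (R : Realization C 𝔥) : Set (FreeLieAlgebra ℂ (Gen r 𝔥)) :=
  {z | ∃ (a : ℂ) (x y : 𝔥), z = freeH (a • x + y) - (a • freeH x + freeH y)} ∪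
  {z | ∃ x y : 𝔥, z = ⁅(freeH x : FreeLieAlgebra ℂ (Gen r 𝔥)), freeH y⁆} ∪
  {z | ∃ i j, z = ⁅freeE 𝔥 i, freeF 𝔥 j⁆ - if i = j then freeH (R.coroot i) else 0} ∪
  {z | ∃ (x : 𝔥) (i : Fin r), z =
    ⁅(freeH x : FreeLieAlgebra ℂ (Gen r 𝔥)), freeE 𝔥 i⁆ - R.α i x • freeE 𝔥 i} ∪
  {z | ∃ (x : 𝔥) (i : Fin r), z =
    ⁅(freeH x : FreeLieAlgebra ℂ (Gen r 𝔥)), freeF 𝔥 i⁆ + R.α i x • freeF 𝔥 i}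

/-- The ideal generated by the defining relations. -/
def relIdeal (R : Realization C 𝔥) : LieIdeal ℂ (FreeLieAlgebra ℂ (Gen r 𝔥)) :=
  LieSubmodule.lieSpan ℂ _ (relations R)

/-- The auxiliary Lie algebra `g̃(A)`. -/
abbrev AuxAlgebra (R : Realization C 𝔥) := FreeLieAlgebra ℂ (Gen r 𝔥) ⧸ relIdeal R

/-- The image of `x ∈ 𝔥` in `g̃(A)`. -/
def auxH (R : Realization C 𝔥) (x : 𝔥) : AuxAlgebra R :=
  LieSubmodule.Quotient.mk (N := relIdeal R) (freeH x)

/-- The maximal ideal of `g̃(A)` intersecting `𝔥` trivially: the sum of all such ideals. -/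
def radIdeal (R : Realization C 𝔥) : LieIdeal ℂ (AuxAlgebra R) :=
  sSup {I : LieIdeal ℂ (AuxAlgebra R) | ∀ x : 𝔥, auxH R x ∈ I → auxH R x = 0}

/-- The Kac-Moody algebra `g(A)`. -/
abbrev KMAlgebra (R : Realization C 𝔥) := AuxAlgebra R ⧸ radIdeal R

/-- The image of `x ∈ 𝔥` in `g(A)`. -/
def kmH (R : Realization C 𝔥) (x : 𝔥) : KMAlgebra R :=
  LieSubmodule.Quotient.mk (N := radIdeal R) (auxH R x)

/-- The root lattice `Q = ⊕ ℤ α_i`, in coordinates. -/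
abbrev RootLattice (r : ℕ) := Fin r → ℤ

/-- The weight `∑ β_i α_i ∈ 𝔥*` of `β ∈ Q`. -/
def Realization.weight (R : Realization C 𝔥) (β : RootLattice r) : Module.Dual ℂ 𝔥 :=
  ∑ i, (β i : ℂ) • R.α i

/-- The space `g_β = {y | [x, y] = β(x) y for all x ∈ 𝔥}`. -/
def rootSpace (R : Realization C 𝔥) (β : RootLattice r) : Submodule ℂ (KMAlgebra R) :=
  ⨅ x : 𝔥, Module.End.eigenspace (LieAlgebra.ad ℂ (KMAlgebra R) (kmH R x)) (R.weight β x)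

/-- The multiplicity `mult(β) = dim g_β`. A nonzero `β ∈ Q` is a root if and only if
`mult(β) ≠ 0`. -/
def rootMult (R : Realization C 𝔥) (β : RootLattice r) : ℕ := Module.finrank ℂ (rootSpace R β)

end KacMoody

/-! ## The Weyl group -/

section Weyl

variable (C : CartanDatum r)

/-- `β(h_i)` for `β ∈ Q`, using `α_j(h_i) = a_{ij}`. -/
def pairing (i : Fin r) : RootLattice r →ₗ[ℤ] ℤ := ∑ j, C.A i j • LinearMap.proj j

/-- The simple root `α_i` as an element of `Q`. -/
def simpleRoot (i : Fin r) : RootLattice r := Pi.single i 1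

lemma pairing_simpleRoot (i : Fin r) : pairing C i (simpleRoot i) = 2 := by
  simp [pairing, simpleRoot, Pi.single_apply, C.diag]

/-- The simple reflection `σ_i β = β - β(h_i) α_i` on `Q`. -/
def simpleReflection (i : Fin r) : RootLattice r ≃ₗ[ℤ] RootLattice r :=
  Module.reflection (pairing_simpleRoot C i)

/-- The Weyl group, through its (faithful) action on `Q`. -/
def weylGroup : Subgroup (RootLattice r ≃ₗ[ℤ] RootLattice r) :=
  Subgroup.closure (Set.range (simpleReflection C))

/-- `L = [i_1, …, i_k]` is a reduced word of `w`: `w = σ_{i_1} ⋯ σ_{i_k}` with `k` minimal. -/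
def IsReducedWord (w : weylGroup C) (L : List (Fin r)) : Prop :=
  (L.map (simpleReflection C)).prod = w ∧
    ∀ L' : List (Fin r), (L'.map (simpleReflection C)).prod = w → L.length ≤ L'.length

/-- A reduced word of `w`. -/
def reducedWord (w : weylGroup C) : List (Fin r) := Classical.epsilon (IsReducedWord C w)

/-- The real roots in `Q`: the Weyl group translates of the simple roots. -/
def IsRealRoot (β : RootLattice r) : Prop :=
  ∃ w ∈ weylGroup C, ∃ i, β = w (simpleRoot i)

/-- The bilinear form on `Q` with `(α_i, α_j) = b_{ij}`. -/
def form (β γ : RootLattice r) : ℚ := ∑ i, ∑ j, (β i : ℚ) * (γ j : ℚ) * C.B i j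

/-- `d(β) = ∑ k_i` for `β = ∑ k_i α_i`. -/
def depth (β : RootLattice r) : ℤ := ∑ i, β i

open Classical in
/-- `m(α) = n / gcd(n, (α, α))` if `α` is a real root, and `m(α) = n` if `α` is imaginary. -/
def mRoot (n : ℕ) (β : RootLattice r) : ℕ :=
  if IsRealRoot C β then n / Int.gcd n (form C β β).num else n

end Weyl

/-! ## Formal distributions, the Weyl group action and the deformed character -/

section Local

/-- Formal distributions `∑_{β ∈ Q} c(β) x^β`, given by their coefficients. -/
abbrev Dist (r : ℕ) := RootLattice r → ℂ

/-- The monomial `a x^β`. -/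
def mono (β : RootLattice r) (a : ℂ) : Dist r := Pi.single β a

/-- The product of two formal distributions (meaningful if all the sums converge absolutely). -/
def Dist.mul (f g : Dist r) : Dist r := fun γ => ∑' β, f β * g (γ - β)

open Classical in
/-- A power series as a formal distribution. -/
def toDist (f : MvPowerSeries (Fin r) ℂ) : Dist r := fun β =>
  if 0 ≤ β then MvPowerSeries.coeff (Finsupp.equivFunOnFinite.symm fun i => (β i).toNat) f else 0

/-- The power series formed by the terms of a formal distribution with exponent in `Q_+`. -/
def toSeries (f : Dist r) : MvPowerSeries (Fin r) ℂ := fun β => f fun i => (β i : ℤ)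

open Classical in
/-- A formal distribution as an element of the ring `ℂ[[x_1, …, x_r]][x_1⁻¹, …, x_r⁻¹]` of formal
distributions with a lower bound. A subset of `ℤ^r` is partially well-ordered
for the componentwise order if and only if it is bounded below, so this is Mathlib's ring of
Hahn series over `ℤ^r`. -/
def toLaurent (f : Dist r) : HahnSeries (RootLattice r) ℂ :=
  if h : (Function.support f).IsPWO then ⟨f, h⟩ else 0

variable (C : CartanDatum r) {𝔥 : Type*} [AddCommGroup 𝔥] [Module ℂ 𝔥] (R : Realization C 𝔥)
  (n q : ℕ) (γ : ℤ → ℂ) (l : Fin r → ℕ)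

/-- The change of variables `f(w x)`, with `(w x)^β = q^{d(w⁻¹β - β)} x^{w⁻¹β}`, that is
`(σ_i x)_j = (q x_i)^{-a_{ij}} x_j` for the simple reflections. -/
def changeVar (w : RootLattice r ≃ₗ[ℤ] RootLattice r) (f : Dist r) : Dist r := fun β =>
  f (w β) * (q : ℂ) ^ (depth β - depth (w β))

/-- `m(α_i)`. -/
def mSimple (i : Fin r) : ℕ := mRoot C n (simpleRoot i)

/-- `μ_i(β) = (λ + ρ - β)(h_i)`, where `λ = ∑ l_i ω_i`. -/
def muFun (i : Fin r) (β : RootLattice r) : ℤ := (l i : ℤ) + 1 - pairing C i β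

/-- The shifted action `σ_i · β = σ_i (β - λ - ρ) + λ + ρ = β + μ_i(β) α_i` on `Q`. -/
def dotAction (i : Fin r) (β : RootLattice r) : RootLattice r :=
  β + muFun C l i β • simpleRoot i

/-- The largest multiple `[k]_m` of `m` that is at most `k`. -/
def floorMul (m : ℕ) (k : ℤ) : ℤ := m * (k / m)

/-- The series `∑_{k ≥ 0} (q^{m-1} x^{m α_i})^k` with `m = m(α_i)`. -/
def geomSeries (i : Fin r) : Dist r := fun β =>
  ∑' k : ℕ, mono (((mSimple C n i * k : ℕ) : ℤ) • simpleRoot i)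
    (((q : ℂ) ^ (mSimple C n i - 1)) ^ k) β

/-- `𝒫_{β,i}(x) = (q x^{α_i})^{[μ_i(β)]_m} (1 - 1/q) ∑_{k ≥ 0} (q^{m-1} x^{m α_i})^k`. -/
def calP (i : Fin r) (β : RootLattice r) : Dist r :=
  Dist.mul
    (mono (floorMul (mSimple C n i) (muFun C l i β) • simpleRoot i)
      ((q : ℂ) ^ floorMul (mSimple C n i) (muFun C l i β) * (1 - 1 / (q : ℂ))))
    (geomSeries C n q i)

/-- `𝒬_{β,i}(x) =
γ(b_i μ_i(β)) q^{μ_i(β)} (1 - (q x^{α_i})^{-m}) ∑_{k ≥ 0} (q^{m-1} x^{m α_i})^k`. -/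
def calQ (i : Fin r) (β : RootLattice r) : Dist r :=
  Dist.mul
    ((γ (C.b i * muFun C l i β) * (q : ℂ) ^ muFun C l i β) •
      (mono 0 1 - mono (-(mSimple C n i : ℤ) • simpleRoot i) ((q : ℂ) ^ (-(mSimple C n i : ℤ)))))
    (geomSeries C n q i)

/-- `x^β |_λ σ_i = 𝒫_{β,i}(x) x^β + 𝒬_{β,i}(x) x^{σ_i · β}`. -/
def monoAct (i : Fin r) (β : RootLattice r) : Dist r :=
  Dist.mul (calP C n q l i β) (mono β 1) + Dist.mul (calQ C n q γ l i β) (mono (dotAction C l i β) 1)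

/-- `f |_λ σ_i = ∑ c(β) (x^β |_λ σ_i)` for `f = ∑ c(β) x^β`. -/
def distAct (i : Fin r) (f : Dist r) : Dist r := fun δ => ∑' β, f β * monoAct C n q γ l i β δ

/-- `f |_λ w = f |_λ σ_{i_1} |_λ ⋯ |_λ σ_{i_k}` for a reduced expression `w = σ_{i_1} ⋯ σ_{i_k}`. -/
def weylAct (w : weylGroup C) (f : Dist r) : Dist r :=
  (reducedWord C w).foldl (fun g i => distAct C n q γ l i g) f

/-- The coordinates in `Q` of an element of `Q_+`. -/
def ofQplus (β : Fin r →₀ ℕ) : RootLattice r := fun i => (β i : ℤ)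

/-- `Δ(x) = ∏_{α > 0} (1 - q^{m(α) d(α)} x^{m(α) α})^{mult(α)}`. Only the roots `α ≤ β`
contribute to the coefficient of `x^β`, so each coefficient is given by a finite product. -/
def deltaSeries : MvPowerSeries (Fin r) ℂ := fun β =>
  MvPowerSeries.coeff β (∏ α ∈ (Finset.Iic β).erase 0,
    (1 - MvPowerSeries.monomial (mRoot C n (ofQplus α) • α)
      ((q : ℂ) ^ (mRoot C n (ofQplus α) * depth (ofQplus α)))) ^ rootMult R (ofQplus α))

/-- `D(x) = ∏_{α > 0} (1 - q^{m(α) d(α) - 1} x^{m(α) α})^{mult(α)}`, as for `Δ`. -/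
def dSeries : MvPowerSeries (Fin r) ℂ := fun β =>
  MvPowerSeries.coeff β (∏ α ∈ (Finset.Iic β).erase 0,
    (1 - MvPowerSeries.monomial (mRoot C n (ofQplus α) • α)
      ((q : ℂ) ^ (mRoot C n (ofQplus α) * depth (ofQplus α) - 1))) ^ rootMult R (ofQplus α))

/-- The factor `j(w, x) = Δ(x) / Δ(w x)`, the quotient being taken in
`ℂ[[x_1, …, x_r]][x_1⁻¹, …, x_r⁻¹]`. -/
def jFactor (w : weylGroup C) : Dist r :=
  (toLaurent (toDist (deltaSeries C R n q)) *
    Ring.inverse (toLaurent (changeVar q w (toDist (deltaSeries C R n q))))).coeff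

/-- `s(x, λ) = ∑_{w ∈ W} j(w, x) (1 |_λ w)(x)`. -/
def weylSum : Dist r := fun β =>
  ∑' w : weylGroup C, Dist.mul (jFactor C R n q w) (weylAct C n q γ l w (mono 0 1)) β

/-- The deformed Weyl-Kac character `h(x; λ) = Δ(x)⁻¹ s(x, λ)`. -/
def deformedCharacter : MvPowerSeries (Fin r) ℂ :=
  (deltaSeries C R n q)⁻¹ * toSeries (weylSum C R n q γ l)

/-- `N(x; λ) = h(x; λ) D(x)`. -/
def nSeries : MvPowerSeries (Fin r) ℂ := deformedCharacter C R n q γ l * dSeries C R n q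

end Local

/-! ## The local Hilbert symbol -/

section Hilbert

variable {K : Type*} [Field K] (𝒪 : ValuationSubring K)

/-- For a finite extension `M / K` inside the algebraic closure of a nonarchimedean local field `K`
with ring of integers `𝒪`, `φ` is a (lift of the) Frobenius automorphism of `M`: it fixes `M` and
acts as `x ↦ x^{q_M}` on the residue field of the integral closure of `𝒪` in the algebraic
closure, `q_M` being the cardinality of the residue field of `M`. The integral closures of `𝒪` are
local rings, so their Jacobson radicals are their maximal ideals. -/
def IsFrobenius (M : IntermediateField K (AlgebraicClosure K))
    (φ : AlgebraicClosure K ≃ₐ[K] AlgebraicClosure K) : Prop :=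
  (∀ x ∈ M, φ x = x) ∧
  ∀ x : integralClosure 𝒪 (AlgebraicClosure K),
    ∃ y ∈ Ring.jacobson (integralClosure 𝒪 (AlgebraicClosure K)),
      φ x - (x : AlgebraicClosure K) ^
        Nat.card (integralClosure 𝒪 M ⧸ Ring.jacobson (integralClosure 𝒪 M)) = y

/-- `π` is a prime element of the finite extension `M / K`. -/
def IsPrimeElement (M : IntermediateField K (AlgebraicClosure K)) (π : M) : Prop :=
  ∃ p : integralClosure 𝒪 M, (p : M) = π ∧ Ideal.span {p} = Ring.jacobson (integralClosure 𝒪 M)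

/-- The norm residue symbol of `a` for the Kummer extension `L = K(β)`, `β^n = b`, maps `β` to
`ζ β`. By definition of the reciprocity map, `(a, L/K) = σ` means that
`a ∈ N_{M/K}(π_M) N_{L/K}(L^×)`, where `M / K` is a finite extension such that `L` is contained in
the maximal unramified extension of `M`, the Frobenius automorphism of `M` restricts to `σ` on `L`,
and `π_M` is a prime element of `M`. (All Frobenius lifts of `M` agree on `β` exactly if
`β` lies in the maximal unramified extension of `M`.) -/
def NormResidueRel (n : ℕ) (a b ζ : K) : Prop :=
  ∃ β : AlgebraicClosure K, β ^ n = algebraMap K _ b ∧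
  ∃ M : IntermediateField K (AlgebraicClosure K), FiniteDimensional K M ∧
  ∃ π : M, IsPrimeElement 𝒪 M π ∧
    (∃ y : IntermediateField.adjoin K {β}, y ≠ 0 ∧ a = Algebra.norm K π * Algebra.norm K y) ∧
    ∀ φ, IsFrobenius 𝒪 M φ → φ β = algebraMap K _ ζ * β

end Hilbert

/-! ## The arithmetic data -/

section Arithmetic

open IsDedekindDomain NumberField

/-- `F_S = ∏_{v ∈ S} F_v`, where `S` consists of the archimedean places and of the finite places
in `Sfin`. -/
abbrev FS (F : Type*) [Field F] [NumberField F] (Sfin : Finset (HeightOneSpectrum (𝓞 F))) :=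
  ((v : InfinitePlace F) → v.Completion) × ((v : Sfin) → v.1.adicCompletion F)

/-- The ring `𝔬_S` of `S`-integers. -/
abbrev OS (F : Type*) [Field F] [NumberField F] (Sfin : Finset (HeightOneSpectrum (𝓞 F))) :=
  (Sfin : Set (HeightOneSpectrum (𝓞 F))).integer F

/-- The nonzero prime ideals of a ring. -/
abbrev NonzeroPrime (O : Type*) [CommRing O] := {p : Ideal O // p.IsPrime ∧ p ≠ ⊥}

/-- The norm `|c|` of a nonzero `S`-integer, the cardinality of `𝔬_S / c 𝔬_S`. -/
def elemNorm {O : Type*} [CommRing O] (c : O) : ℕ := Nat.card (O ⧸ Ideal.span {c})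

/-- The norm of a prime. -/
def primeNorm {O : Type*} [CommRing O] (p : NonzeroPrime O) : ℕ := Nat.card (O ⧸ p.1)

/-- The exponent of the prime `p` in `c ≠ 0`. -/
def ord {O : Type*} [CommRing O] (p : NonzeroPrime O) (c : O) : ℕ :=
  multiplicity p.1 (Ideal.span {c})

/-- The arithmetic data: a number field `F` containing `μ_{2n}`, a finite set `S` of places that
contains the archimedean places and the places ramified over `ℚ` and is such that `𝔬_S` is
a principal ideal domain, a nontrivial additive character `ψ` of `F_S` with `ψ(x 𝔬_S) = 1` if and
only if `x ∈ 𝔬_S`, an isomorphism between the groups of `n`-th roots of unity in `F` and in `ℂ`,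
and a generator `ϖ` of each nonzero prime ideal of `𝔬_S`. -/
structure ArithDatum (F : Type*) [Field F] [NumberField F] (n : ℕ) where
  roots : ∃ ζ : F, IsPrimitiveRoot ζ (2 * n)
  Sfin : Finset (HeightOneSpectrum (𝓞 F))
  ramified : ∀ v : HeightOneSpectrum (𝓞 F), v.asIdeal.ramificationIdx ℤ ≠ 1 → v ∈ Sfin
  pid : IsPrincipalIdealRing (OS F Sfin)
  ψ : AddChar (FS F Sfin) Circle
  ψ_continuous : Continuous ψ
  ψ_nontrivial : ψ ≠ 1
  ψ_integers : ∀ x : FS F Sfin,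
    (∀ a : OS F Sfin, ψ (x * algebraMap F (FS F Sfin) a) = 1) ↔
      ∃ a : OS F Sfin, x = algebraMap F (FS F Sfin) a
  ϵ : rootsOfUnity n F ≃* rootsOfUnity n ℂ
  ϖ : NonzeroPrime (OS F Sfin) → OS F Sfin
  ϖ_span : ∀ p, Ideal.span {ϖ p} = p.1

variable {F : Type*} [Field F] [NumberField F] {n : ℕ} (𝒟 : ArithDatum F n)

namespace ArithDatum

/-- The ring `𝔬_S`. -/
abbrev O := OS F 𝒟.Sfin

/-- The group `F_S^×`. -/
abbrev FSx := (FS F 𝒟.Sfin)ˣ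

open Classical in
/-- The residue symbol `(c / p)` for `p` prime and `c` prime to `p`: the `n`-th root of unity
congruent to `c^{(|p| - 1)/n}` modulo `p`. -/
def residueRoot (c : 𝒟.O) (p : NonzeroPrime 𝒟.O) : rootsOfUnity n F :=
  if h : ∃ ζ : rootsOfUnity n F, ∃ z : 𝒟.O, (z : F) = ((ζ : Fˣ) : F) ∧
      z - c ^ ((primeNorm p - 1) / n) ∈ p.1
  then h.choose else 1

/-- The `n`-th power residue symbol `(c / d)` for coprime `c, d ∈ 𝔬_S`, with values in `ℂ`. -/
def resSymbol (c d : 𝒟.O) : ℂ :=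
  ∏ᶠ p : NonzeroPrime 𝒟.O, (((𝒟.ϵ (𝒟.residueRoot c p) : ℂˣ) : ℂ)) ^ ord p d

/-- The Gauss sum `g(a, c; t) = ∑_{d mod c} (d / c)^t ψ(a d / c)`, over `d` prime to `c`. -/
def gaussSum (a c : 𝒟.O) (t : ℤ) : ℂ :=
  ∑ᶠ u : (𝒟.O ⧸ Ideal.span {c})ˣ,
    𝒟.resSymbol (Quotient.out (u : 𝒟.O ⧸ Ideal.span {c})) c ^ t *
      (𝒟.ψ (algebraMap F (FS F 𝒟.Sfin)
        ((a : F) * ((Quotient.out (u : 𝒟.O ⧸ Ideal.span {c}) : 𝒟.O) : F) / (c : F))) : ℂ)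

open Classical in
/-- The local `n`-th Hilbert symbol `(a, b)_v` at a finite place `v`: the inverse of the root of
unity by which the norm residue symbol of `a` acts on an `n`-th root of `b`. -/
def localSymbol (n : ℕ) (v : HeightOneSpectrum (𝓞 F)) (a b : v.adicCompletion F) : rootsOfUnity n F :=
  if h : ∃ ζ : rootsOfUnity n F, NormResidueRel (v.adicCompletionIntegers F) n a b
      (algebraMap F (v.adicCompletion F) ((ζ : Fˣ) : F))
  then (h.choose)⁻¹ else 1

/-- The `S`-Hilbert symbol `(x, y)_S = ∏_{v ∈ S} (x_v, y_v)_v`, with values in `ℂ`. Archimedean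
places contribute trivially: since `F` contains `μ_{2n}`, they are complex unless `n = 1`. -/
def hilbertS (x y : 𝒟.FSx) : ℂ :=
  ∏ v : 𝒟.Sfin, ((𝒟.ϵ (localSymbol n v.1
    ((x : FS F 𝒟.Sfin).2 v) ((y : FS F 𝒟.Sfin).2 v)) : ℂˣ) : ℂ)

variable (C : CartanDatum r)

/-- `(x, y)^B_S = ∏_i (x_i, y_i)_S^{b_i} ∏_{i < j} (x_i, y_j)_S^{2 b_{ij}}`. -/
def hilbertB (x y : Fin r → 𝒟.FSx) : ℂ :=
  ∏ i, (𝒟.hilbertS (x i) (y i) ^ C.b i *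
    ∏ j ∈ Finset.Ioi i, 𝒟.hilbertS (x i) (y j) ^ C.twoB i j)

/-- The subgroup `Ω = 𝔬_S^× F_S^{×,n}` of `F_S^×`. -/
def Ω : Subgroup 𝒟.FSx :=
  (Units.map ((algebraMap F (FS F 𝒟.Sfin)).comp (algebraMap 𝒟.O F)).toMonoidHom).range ⊔
    (powMonoidHom n : 𝒟.FSx →* 𝒟.FSx).range

/-- `ℳ_B(Ω)`: the functions `Φ` on `(F_S^×)^r` such that `Φ(e c) = (e, c)^B_S Φ(c)` for
`e ∈ Ω^r`. -/
def calM : Set ((Fin r → 𝒟.FSx) → ℂ) :=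
  {Φ | ∀ e c : Fin r → 𝒟.FSx, (∀ i, e i ∈ 𝒟.Ω) → Φ (e * c) = 𝒟.hilbertB C e c * Φ c}

variable {C} {𝔥 : Type*} [AddCommGroup 𝔥] [Module ℂ 𝔥] (R : Realization C 𝔥)

/-- `𝔐_B(Ω) = 𝔄 ⊗ ℳ_B(Ω)` as a space of functions on `𝔥 × (F_S^×)^r`, where `𝔄` is the ring of
Laurent polynomials in the functions `s ↦ |ϖ_v|^{s_i}`, `s_i = α_i(s)`, with `v ∈ S` finite and
`|ϖ_v| = (N v)⁻¹`. -/
def frakM : Submodule ℂ (𝔥 → (Fin r → 𝒟.FSx) → ℂ) :=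
  Submodule.span ℂ {Ψ | ∃ k : 𝒟.Sfin → Fin r → ℤ, ∃ Φ ∈ 𝒟.calM C, Ψ = fun s c =>
    (∏ v : 𝒟.Sfin, ∏ i, ((Ideal.absNorm v.1.asIdeal : ℂ) ^ (-(R.α i s))) ^ k v i) * Φ c}

/-- The function `γ` at the prime `p`:
`γ(i) = g(1, ϖ; i)/q` if `n ∤ i`, and `γ(i) = -1` otherwise. -/
def gammaFun (p : NonzeroPrime 𝒟.O) (i : ℤ) : ℂ :=
  if (n : ℤ) ∣ i then -1 else 𝒟.gaussSum 1 (𝒟.ϖ p) i / (primeNorm p : ℂ)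

/-- `H(ϖ_Q^β; ϖ_P^λ)`, the coefficient of `x^β` in `N(x; λ)`, for `λ = ∑ l_i ω_i`. -/
def localH (p : NonzeroPrime 𝒟.O) (β l : Fin r → ℕ) : ℂ :=
  MvPowerSeries.coeff (Finsupp.equivFunOnFinite.symm β)
    (nSeries C R n (primeNorm p) (𝒟.gammaFun p) l)

/-- The part `ϖ^{ord_ϖ(c)}` of `c` at the prime `p = (ϖ)`. -/
def primePart (p : NonzeroPrime 𝒟.O) (c : 𝒟.O) : 𝒟.O := 𝒟.ϖ p ^ ord p c

open Classical in
/-- The cofactor `c / ϖ^{ord_ϖ(c)}` of the `p`-part. -/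
def coPart (p : NonzeroPrime 𝒟.O) (c : 𝒟.O) : 𝒟.O :=
  if h : ∃ d, c = 𝒟.primePart p c * d then h.choose else 1

/-- The coefficients `H(c; m)`, for `c_i, m_i ≠ 0`. They are determined by
`H(ϖ_Q^β; ϖ_P^λ)`, by `H(u; m) = 1` for units `u`, by the twisted multiplicativity
`H(c c'; m) = ξ_B(c, c') H(c; m) H(c'; m)` if `c_1 ⋯ c_r` and `c'_1 ⋯ c'_r` are coprime, where
`ξ_B(x, y) = ∏_i (x_i/y_i)^{b_i} (y_i/x_i)^{b_i} ∏_{i<j} (x_i/y_j)^{2b_{ij}} (y_i/x_j)^{2b_{ij}}`,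
and by `H(c; m m') = ∏_i (m'_i / c_i)^{-b_i} H(c; m)` if `c_1 ⋯ c_r` and `m'_1 ⋯ m'_r` are
coprime. Writing `c = u ∏_ϖ c_ϖ` with `c_ϖ = ϖ_Q^β` and collecting, for each
prime `ϖ` dividing `c_1 ⋯ c_r`, the symbols with denominator a power of `ϖ`, these rules give
the product below, in which `ĉ_i` and `m̂_i` are the cofactors of the `ϖ`-parts of `c_i`
and `m_i`. -/
def coeffH (c m : Fin r → 𝒟.O) : ℂ :=
  ∏ᶠ p ∈ {p : NonzeroPrime 𝒟.O | ∃ i, c i ∈ p.1},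
    (∏ i, (𝒟.resSymbol (𝒟.coPart p (c i)) (𝒟.primePart p (c i)) ^ C.b i *
      ∏ j ∈ Finset.Ioi i,
        𝒟.resSymbol (𝒟.coPart p (c i)) (𝒟.primePart p (c j)) ^ C.twoB i j)) *
    (∏ i, 𝒟.resSymbol (𝒟.coPart p (m i)) (𝒟.primePart p (c i)) ^ (-C.b i)) *
    𝒟.localH R p (fun i => ord p (c i)) (fun i => ord p (m i))

/-- A nonzero `S`-integer as an element of `F_S^×`. -/
def embed (c : {c : 𝒟.O // c ≠ 0}) : 𝒟.FSx :=
  Units.map (algebraMap F (FS F 𝒟.Sfin)).toMonoidHom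
    (Units.mk0 ((c : 𝒟.O) : F) fun h => c.2 (Subtype.ext h))

/-- `|c|_Q^s = ∏_i |c_i|^{α_i(s)}`. -/
def absQ (c : Fin r → {c : 𝒟.O // c ≠ 0}) (s : 𝔥) : ℂ :=
  ∏ i, (elemNorm (c i).1 : ℂ) ^ R.α i s

/-- `|c|_P^s = ∏_i |c_i|^{ω_i(s)}`. -/
def absP (c : Fin r → {c : 𝒟.O // c ≠ 0}) (s : 𝔥) : ℂ :=
  ∏ i, (elemNorm (c i).1 : ℂ) ^ R.ω i s

/-- The general term `H(c; m) Ψ(s; c) |c|_Q^{-s} |m|_P^s` of the series `Z(s; m, Ψ)`. -/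
def zTerm (s : 𝔥) (m : Fin r → {c : 𝒟.O // c ≠ 0}) (Ψ : 𝔥 → (Fin r → 𝒟.FSx) → ℂ)
    (c : Fin r → {c : 𝒟.O // c ≠ 0}) : ℂ :=
  𝒟.coeffH R (fun i => (c i).1) (fun i => (m i).1) * Ψ s (fun i => 𝒟.embed (c i)) *
    𝒟.absQ R c (-s) * 𝒟.absP R m s

end ArithDatum

end Arithmetic

end KMDirichlet

end

open KMDirichlet

/-!
The series is dominated by an Euler product. Power residue symbols and Hilbert symbols have absolute
value `1`, so the absolute value of `H(c; m)` is the product over the primes of absolute values of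
coefficients of the local series `N(x; λ)` (`enorm_coeffH`). For fixed `s` the function `Ψ(s; ·)` is
bounded: up to factors of absolute value `1` it depends only on the classes of the `c_i` modulo
`n`-th powers of `F_S^×`, and these have finite index (`finiteIndex_range_pow`). It remains to bound
`∑_p ∑_{k ≠ 0} |H(ϖ^k; m)| |p|^{-∑ k_i σ_i}`, where `σ_i = Re s_i`.

For the local series with `q = |p|`, everything is estimated by weighted `ℓ¹`-norms at a point
`q x_i = exp(-τ(α_i))` with `τ(α_i) > 0`; in the variables `q x_i` all bounds are independent of `q`,
`γ` and `λ`.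

* The action of `σ_i` maps `x^β` to terms with exponents `σ_i β + j α_i`, where `j ≥ 1 - m(α_i)`. Its
  norm is therefore at most `6 exp((m(α_i) - 1) τ(α_i))` if the norm of the argument is taken at the
  reflected point (`distNorm_monoAct_le`). Iteration along a reduced word of `w` gives a factor
  `6 exp((m(δ) - 1) τ(δ))` for each inversion `δ` of `w`.
* As `σ_i` permutes the positive roots other than `α_i`, preserving multiplicities, `Δ` satisfies
  `Δ(σ_i x) = -(q x_i)^{-m(α_i)} Δ(x)`. Hence `j(w, x)` is up to sign the product of the
  `(q^{d(δ)} x^δ)^{m(δ)}` over the inversions of `w` (`jFactor_eq`), and each inversion contributes a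
  total of `6 exp(-τ(δ))` to the term of `w`. An element of `W` is determined by its inversions, so
  the sum over `W` is at most `∏ (1 + 6 exp(-τ(δ)))` over the positive real roots
  (`distNorm_weylSum_le`).
* A root space is spanned by iterated commutators of the generators `e_i`, so that `mult(β)` is at
  most the number of words in which the letter `i` occurs `β_i` times. Summation over all words gives
  `∑ mult(β) exp(-τ(β)) ≤ 1 / (1 - T)` over the positive roots if `∑ exp(-τ(α_i)) ≤ T < 1`
  (`sum_rootMult_le`). This bounds the sum over `W` as well as `1 / Δ` and `D`, hence `N(x; λ)`
  (`psNorm_nSeries_le`).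

With `exp(-τ(α_i)) = 2^{1 - σ_i}` the requirement is `∑ 2^{1 - σ_i} < 1`, which holds for
`σ_i > 1 + log₂ r`; moreover `2^{1 - σ_i} ≤ 1 / 2`, so that the geometric series in `1 / Δ` converge
at a uniform rate. The point of interest is `q x_i = q^{1 - σ_i} ≤ 2^{1 - σ_i}`. If all `σ_i` are at
least `σ₀`, the passage to it makes every nonconstant monomial smaller by a factor
`(q / 2)^{1 - σ₀}` or more, so the nonconstant terms at the prime contribute `O(q^{1 - σ₀})`
(`tsum_nSeries_le`). The sum of `|p|^{1 - σ₀}` over the primes converges for `σ₀ > 2`, because at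
most `[F : ℚ]` primes lie above each rational prime.

The facts about Kac-Moody algebras that enter are that the multiplicities are invariant under `W`,
that the simple roots have multiplicity `1` and that their multiples `k α_i`, `k ≥ 2`, are not roots.
The simple root vectors do not vanish because `h_i` acts nontrivially on a Verma module of the
auxiliary algebra. The Serre elements generate ideals that meet `𝔥` trivially, hence are zero in
`𝔤(A)`, so that the `ad e_i` and `ad f_i` are locally nilpotent; the invariance of the multiplicities
is then the invariance of weights in representations of `sl₂`
(`ChevalleySystem.finrank_wtSpace_reflection`).
-/

open scoped BigOperators

noncomputable section

namespace KMDirichlet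

section

variable {r : ℕ} {C : CartanDatum r} {𝔥 : Type*} [AddCommGroup 𝔥] [Module ℂ 𝔥]

/-! ### Lie algebras generated by Chevalley generators -/

lemma Realization.weight_add (R : Realization C 𝔥) (β γ : RootLattice r) :
    R.weight (β + γ) = R.weight β + R.weight γ := by
  simp [Realization.weight, add_smul, Finset.sum_add_distrib]

lemma Realization.weight_neg (R : Realization C 𝔥) (β : RootLattice r) :
    R.weight (-β) = -R.weight β := by
  simp [Realization.weight]

lemma Realization.weight_zero (R : Realization C 𝔥) : R.weight 0 = 0 := by
  simp [Realization.weight]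

lemma Realization.weight_simpleRoot (R : Realization C 𝔥) (i : Fin r) :
    R.weight (simpleRoot i) = R.α i := by
  simp [Realization.weight, simpleRoot, Pi.single_apply]

lemma Realization.α_coroot (R : Realization C 𝔥) (i j : Fin r) :
    R.α j (R.coroot i) = (C.A i j : ℂ) := R.root_coroot i j

lemma Realization.weight_coroot (R : Realization C 𝔥) (β : RootLattice r) (i : Fin r) :
    R.weight β (R.coroot i) = (pairing C i β : ℂ) := by
  simp [Realization.weight, pairing, R.α_coroot, mul_comm]

/-- A point of `𝔥` at which distinct elements of the root lattice take distinct values: the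
values of the simple roots are chosen linearly independent over `ℤ`. -/
lemma Realization.exists_separating (R : Realization C 𝔥) :
    ∃ x : 𝔥, Function.Injective fun β : RootLattice r => R.weight β x := by
  have hrank : (r : Cardinal) ≤ Module.rank ℚ ℂ := by
    rw [Complex.rank_rat_complex]
    exact (Cardinal.natCast_lt_aleph0.trans Cardinal.aleph0_lt_continuum).le
  obtain ⟨g, hg⟩ := Module.le_rank_iff.1 hrank
  have : Module.Finite ℂ 𝔥 := Module.Finite.of_basis R.corootBasis
  have : Module.Free ℂ 𝔥 := Module.Free.of_basis R.corootBasis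
  let φ : Module.Dual ℂ (Module.Dual ℂ 𝔥) := R.rootBasis.constr ℂ (Sum.elim g 0)
  let x : 𝔥 := (Module.evalEquiv ℂ 𝔥).symm φ
  have hx : ∀ i, R.α i x = g i := fun i => by
    have h1 : (Module.evalEquiv ℂ 𝔥 x) (R.α i) = φ (R.α i) := by
      simp [x]
    rw [Module.evalEquiv_apply, Module.Dual.eval_apply] at h1
    rw [h1]
    exact (R.rootBasis.constr_basis ℂ _ _).trans rfl
  refine ⟨x, fun β γ h => ?_⟩
  have h0 : ∑ i, ((β i - γ i : ℤ) : ℚ) • g i = 0 := by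
    have h1 : ∑ i, (β i : ℂ) * g i = ∑ i, (γ i : ℂ) * g i := by
      simpa [Realization.weight, hx] using h
    have h2 : ∀ i, ((β i - γ i : ℤ) : ℚ) • g i = (β i : ℂ) * g i - (γ i : ℂ) * g i := fun i => by
      rw [Rat.smul_def]; push_cast; ring
    rw [Finset.sum_congr rfl fun i _ => h2 i, Finset.sum_sub_distrib]
    exact sub_eq_zero.2 h1
  ext i
  have := Fintype.linearIndependent_iff.1 hg _ h0 i
  exact sub_eq_zero.1 (by exact_mod_cast this)

/-- A Lie algebra generated by a commutative image of `𝔥` and by Chevalley generators `e_i`, `f_i`,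
subject to the relations of the auxiliary algebra `g̃(A)`: a Lie algebra quotient of `g̃(A)`. -/
structure ChevalleySystem (R : Realization C 𝔥) (L : Type*) [LieRing L] [LieAlgebra ℂ L] where
  H : 𝔥 →ₗ[ℂ] L
  e : Fin r → L
  f : Fin r → L
  lie_H_H : ∀ x y, ⁅H x, H y⁆ = 0
  lie_e_f : ∀ i j, ⁅e i, f j⁆ = if i = j then H (R.coroot i) else 0
  lie_H_e : ∀ x i, ⁅H x, e i⁆ = R.α i x • e i
  lie_H_f : ∀ x i, ⁅H x, f i⁆ = -(R.α i x • f i)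
  lieSpan_eq_top :
    LieSubalgebra.lieSpan ℂ L (Set.range H ∪ Set.range e ∪ Set.range f) = ⊤

/-- The content of a word: the sum of the simple roots indexed by its letters. -/
def content (w : List (Fin r)) : RootLattice r := (w.map simpleRoot).sum

@[simp] lemma content_nil : content ([] : List (Fin r)) = 0 := rfl

@[simp] lemma content_cons (i : Fin r) (w : List (Fin r)) :
    content (i :: w) = simpleRoot i + content w := by simp [content]

lemma content_apply (w : List (Fin r)) (i : Fin r) : content w i = w.count i := by
  induction w with
  | nil => simp
  | cons j w ih =>
    rw [content_cons, Pi.add_apply, ih, List.count_cons, simpleRoot, Pi.single_apply]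
    by_cases h : i = j
    · simp [h, add_comm]
    · simp [h, Ne.symm h]

lemma content_nonneg (w : List (Fin r)) : 0 ≤ content w := fun i => by
  simp [content_apply]

lemma content_eq_zero {w : List (Fin r)} (h : content w = 0) : w = [] := by
  rw [List.eq_nil_iff_forall_not_mem]
  intro i hi
  have := congrFun h i
  rw [content_apply] at this
  have h2 := List.count_pos_iff.2 hi
  simp at this
  omega

/-- A subspace stable under the adjoint action of a generating set is an ideal. -/
lemma lie_mem_of_stable {L : Type*} [LieRing L] [LieAlgebra ℂ L] {X : Set L}
    (hX : LieSubalgebra.lieSpan ℂ L X = ⊤) (M : Submodule ℂ L)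
    (hM : ∀ x ∈ X, ∀ y ∈ M, ⁅x, y⁆ ∈ M) (x y : L) (hy : y ∈ M) : ⁅x, y⁆ ∈ M := by
  let N : LieSubalgebra ℂ L :=
    { carrier := {x | ∀ y ∈ M, ⁅x, y⁆ ∈ M}
      add_mem' := fun {a b} ha hb y hy => by
        rw [add_lie]; exact M.add_mem (ha y hy) (hb y hy)
      zero_mem' := fun y _ => by simp
      smul_mem' := fun c x hx y hy => by
        rw [smul_lie]; exact M.smul_mem _ (hx y hy)
      lie_mem' := fun {a b} ha hb y hy => by
        rw [lie_lie]; exact M.sub_mem (ha _ (hb y hy)) (hb _ (ha y hy)) }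
  have hN : N = ⊤ := by
    rw [eq_top_iff, ← hX, LieSubalgebra.lieSpan_le]
    exact fun x hx => hM x hx
  exact (show x ∈ N by rw [hN]; trivial) y hy

/-- A subspace that contains a generating set of a Lie algebra and is stable under the adjoint
action of this set is the whole Lie algebra. -/
lemma eq_top_of_lie_stable {L : Type*} [LieRing L] [LieAlgebra ℂ L] {X : Set L}
    (hX : LieSubalgebra.lieSpan ℂ L X = ⊤) (M : Submodule ℂ L) (hXM : X ⊆ M)
    (hM : ∀ x ∈ X, ∀ y ∈ M, ⁅x, y⁆ ∈ M) : M = ⊤ := by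
  let M' : LieSubalgebra ℂ L :=
    { M with lie_mem' := fun {a b} _ hb => lie_mem_of_stable hX M hM a b hb }
  have hM' : M' = ⊤ := by
    rw [eq_top_iff, ← hX, LieSubalgebra.lieSpan_le]
    exact hXM
  ext x
  have : x ∈ M' := by rw [hM']; trivial
  exact ⟨fun _ => trivial, fun _ => this⟩

namespace ChevalleySystem

variable {R : Realization C 𝔥} {L : Type*} [LieRing L] [LieAlgebra ℂ L]

/-- The Chevalley involution at the level of generators: exchange `e_i` and `f_i`, and replace
`x ∈ 𝔥` by `-x`. -/
def swap (S : ChevalleySystem R L) : ChevalleySystem R L where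
  H := -S.H
  e := S.f
  f := S.e
  lie_H_H x y := by simp [S.lie_H_H]
  lie_e_f i j := by
    rw [← lie_skew, S.lie_e_f]
    by_cases h : i = j
    · simp [h]
    · simp [h, Ne.symm h]
  lie_H_e x i := by simp [S.lie_H_f]
  lie_H_f x i := by simp [S.lie_H_e]
  lieSpan_eq_top := by
    rw [eq_top_iff, ← S.lieSpan_eq_top, LieSubalgebra.lieSpan_le]
    rintro _ ((⟨x, rfl⟩ | ⟨i, rfl⟩) | ⟨i, rfl⟩)
    · exact LieSubalgebra.subset_lieSpan (Or.inl (Or.inl ⟨-x, by simp⟩))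
    · exact LieSubalgebra.subset_lieSpan (Or.inr ⟨i, rfl⟩)
    · exact LieSubalgebra.subset_lieSpan (Or.inl (Or.inr ⟨i, rfl⟩))

variable (S : ChevalleySystem R L)

@[simp] lemma swap_e : S.swap.e = S.f := rfl
@[simp] lemma swap_H (x : 𝔥) : S.swap.H x = -S.H x := rfl

/-- The right-normed commutator `[e_{i_1}, [e_{i_2}, …, e_{i_k}]]` of a word. -/
def eWord : List (Fin r) → L
  | [] => 0
  | [i] => S.e i
  | i :: j :: w => ⁅S.e i, eWord (j :: w)⁆

/-- The span of the commutators of the `e_i`. -/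
def nPos : Submodule ℂ L := Submodule.span ℂ (Set.range S.eWord)

/-- The right-normed commutator of the `f_i` of a word. -/
abbrev fWord : List (Fin r) → L := S.swap.eWord

lemma eWord_mem (w : List (Fin r)) : S.eWord w ∈ S.nPos := Submodule.subset_span ⟨w, rfl⟩

lemma eWord_cons (i : Fin r) {w : List (Fin r)} (hw : w ≠ []) :
    S.eWord (i :: w) = ⁅S.e i, S.eWord w⁆ := by
  cases w with
  | nil => exact absurd rfl hw
  | cons j w => rfl

lemma e_mem (i : Fin r) : S.e i ∈ S.nPos := S.eWord_mem [i]

lemma lie_e_eWord_mem (i : Fin r) (w : List (Fin r)) : ⁅S.e i, S.eWord w⁆ ∈ S.nPos := by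
  rcases eq_or_ne w [] with rfl | h
  · simp [eWord]
  · rw [← S.eWord_cons i h]; exact S.eWord_mem _

lemma lie_H_eWord (x : 𝔥) (w : List (Fin r)) :
    ⁅S.H x, S.eWord w⁆ = R.weight (content w) x • S.eWord w := by
  induction w with
  | nil => simp [eWord]
  | cons i w ih =>
    rcases eq_or_ne w [] with rfl | h
    · simp [eWord, S.lie_H_e, Realization.weight_simpleRoot]
    · rw [S.eWord_cons i h, leibniz_lie, S.lie_H_e, ih, content_cons, R.weight_add,
        R.weight_simpleRoot]
      simp [add_smul]

lemma lie_mem_of_span {s : Set L} {M : Submodule ℂ L} {x : L} (h : ∀ y ∈ s, ⁅x, y⁆ ∈ M) {y : L}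
    (hy : y ∈ Submodule.span ℂ s) : ⁅x, y⁆ ∈ M := by
  induction hy using Submodule.span_induction with
  | mem y hy => exact h y hy
  | zero => simp
  | add a b _ _ ha hb => rw [lie_add]; exact M.add_mem ha hb
  | smul c a _ ha => rw [lie_smul]; exact M.smul_mem _ ha

lemma lie_e_mem_nPos (i : Fin r) {y : L} (hy : y ∈ S.nPos) : ⁅S.e i, y⁆ ∈ S.nPos :=
  lie_mem_of_span (by rintro _ ⟨w, rfl⟩; exact S.lie_e_eWord_mem i w) hy

lemma lie_H_mem_nPos (x : 𝔥) {y : L} (hy : y ∈ S.nPos) : ⁅S.H x, y⁆ ∈ S.nPos :=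
  lie_mem_of_span (by
    rintro _ ⟨w, rfl⟩; rw [S.lie_H_eWord]; exact Submodule.smul_mem _ _ (S.eWord_mem w)) hy

lemma lie_e_H (i : Fin r) (x : 𝔥) : ⁅S.e i, S.H x⁆ = -(R.α i x • S.e i) := by
  rw [← lie_skew, S.lie_H_e]

lemma lie_f_e (i j : Fin r) : ⁅S.f i, S.e j⁆ = -(if j = i then S.H (R.coroot j) else 0) := by
  rw [← lie_skew, S.lie_e_f]

/-- Bracketing with `f_i` shortens a commutator of the `e_j`, down to an element of `𝔥`. -/
lemma lie_f_eWord (i : Fin r) (w : List (Fin r)) :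
    ⁅S.f i, S.eWord w⁆ ∈ S.nPos ⊔ LinearMap.range S.H := by
  induction w with
  | nil => simp [eWord]
  | cons j w ih =>
    rcases eq_or_ne w [] with rfl | h
    · refine Submodule.mem_sup_right ?_
      simp only [eWord, S.lie_f_e]
      split_ifs
      · exact Submodule.neg_mem _ ⟨_, rfl⟩
      · simp
    · refine Submodule.mem_sup_left ?_
      rw [S.eWord_cons j h, leibniz_lie]
      refine Submodule.add_mem _ ?_ ?_
      · rw [S.lie_f_e]
        split_ifs
        · rw [neg_lie]; exact Submodule.neg_mem _ (S.lie_H_mem_nPos _ (S.eWord_mem w))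
        · simp
      · obtain ⟨y, hy, z, ⟨x, rfl⟩, hyz⟩ := Submodule.mem_sup.1 ih
        rw [← hyz, lie_add, S.lie_e_H]
        exact Submodule.add_mem _ (S.lie_e_mem_nPos j hy)
          (Submodule.neg_mem _ (Submodule.smul_mem _ _ (S.e_mem j)))

lemma lie_f_mem (i : Fin r) {y : L} (hy : y ∈ S.nPos) :
    ⁅S.f i, y⁆ ∈ S.nPos ⊔ LinearMap.range S.H :=
  lie_mem_of_span (by rintro _ ⟨w, rfl⟩; exact S.lie_f_eWord i w) hy

lemma range_swap_H : LinearMap.range S.swap.H = LinearMap.range S.H :=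
  LinearMap.range_neg S.H

/-- The triangular decomposition (without directness, which follows from weights). -/
lemma sup_eq_top : S.nPos ⊔ LinearMap.range S.H ⊔ S.swap.nPos = ⊤ := by
  have hp : S.nPos ⊔ LinearMap.range S.H ≤ S.nPos ⊔ LinearMap.range S.H ⊔ S.swap.nPos := le_sup_left
  have hn : S.swap.nPos ⊔ LinearMap.range S.H ≤
      S.nPos ⊔ LinearMap.range S.H ⊔ S.swap.nPos :=
    sup_le le_sup_right (le_sup_right.trans hp)
  have h1 : S.nPos ≤ S.nPos ⊔ LinearMap.range S.H ⊔ S.swap.nPos := le_sup_left.trans hp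
  have h2 : S.swap.nPos ≤ S.nPos ⊔ LinearMap.range S.H ⊔ S.swap.nPos := le_sup_right
  have h0 : LinearMap.range S.H ≤ S.nPos ⊔ LinearMap.range S.H ⊔ S.swap.nPos :=
    le_sup_right.trans hp
  refine eq_top_of_lie_stable S.lieSpan_eq_top _ ?_ ?_
  · rintro _ ((⟨x, rfl⟩ | ⟨i, rfl⟩) | ⟨i, rfl⟩)
    · exact h0 ⟨x, rfl⟩
    · exact h1 (S.e_mem i)
    · exact h2 (S.swap.e_mem i)
  · intro u hu y hy
    obtain ⟨y', hy', y3, hy3, rfl⟩ := Submodule.mem_sup.1 hy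
    obtain ⟨y1, hy1, _, ⟨x2, rfl⟩, rfl⟩ := Submodule.mem_sup.1 hy'
    rw [lie_add, lie_add]
    rcases hu with ((⟨x, rfl⟩ | ⟨i, rfl⟩) | ⟨i, rfl⟩)
    · refine Submodule.add_mem _ (Submodule.add_mem _ (h1 (S.lie_H_mem_nPos x hy1)) ?_) (h2 ?_)
      · rw [S.lie_H_H]; exact Submodule.zero_mem _
      · have := S.swap.lie_H_mem_nPos (-x) hy3
        simpa using this
    · refine Submodule.add_mem _ (Submodule.add_mem _ (h1 (S.lie_e_mem_nPos i hy1)) ?_) (hn ?_)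
      · rw [S.lie_e_H]
        exact h1 (Submodule.neg_mem _ (Submodule.smul_mem _ _ (S.e_mem i)))
      · have := S.swap.lie_f_mem i hy3
        rwa [range_swap_H] at this
    · refine Submodule.add_mem _ (Submodule.add_mem _ (hp (S.lie_f_mem i hy1)) ?_)
        (h2 (S.swap.lie_e_mem_nPos i hy3))
      · rw [← lie_skew, S.lie_H_f, neg_neg]
        exact h2 (Submodule.smul_mem _ _ (S.swap.e_mem i))

/-- The weight space of weight `β ∈ Q`. -/
def wtSpace (β : RootLattice r) : Submodule ℂ L :=
  ⨅ x : 𝔥, Module.End.eigenspace (LieAlgebra.ad ℂ L (S.H x)) (R.weight β x)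

lemma mem_wtSpace {β : RootLattice r} {y : L} :
    y ∈ S.wtSpace β ↔ ∀ x, ⁅S.H x, y⁆ = R.weight β x • y := by
  simp [wtSpace]

/-- The span of the commutators of words of a given content, which turns out to be the weight
space. -/
def piece (β : RootLattice r) : Submodule ℂ L :=
  Submodule.span ℂ ({y | ∃ w, content w = β ∧ y = S.eWord w} ∪
    {y | ∃ w, -content w = β ∧ y = S.fWord w} ∪ {y | β = 0 ∧ ∃ x, y = S.H x})

lemma swap_wtSpace (β : RootLattice r) : S.swap.wtSpace β = S.wtSpace (-β) := by
  ext y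
  simp only [mem_wtSpace, R.weight_neg, swap_H, neg_lie, LinearMap.neg_apply, neg_smul]
  exact forall_congr' fun x => ⟨fun h => by rw [← h, neg_neg], fun h => by rw [h, neg_neg]⟩

lemma eWord_mem_wtSpace (w : List (Fin r)) : S.eWord w ∈ S.wtSpace (content w) :=
  S.mem_wtSpace.2 fun x => S.lie_H_eWord x w

lemma fWord_mem_wtSpace (w : List (Fin r)) : S.fWord w ∈ S.wtSpace (-content w) := by
  have := S.swap.eWord_mem_wtSpace w
  rwa [swap_wtSpace] at this

lemma H_mem_wtSpace (x : 𝔥) : S.H x ∈ S.wtSpace 0 :=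
  S.mem_wtSpace.2 fun y => by simp [S.lie_H_H, R.weight_zero]

lemma piece_le_wtSpace (β : RootLattice r) : S.piece β ≤ S.wtSpace β := by
  refine Submodule.span_le.2 ?_
  rintro _ ((⟨w, rfl, rfl⟩ | ⟨w, rfl, rfl⟩) | ⟨rfl, x, rfl⟩)
  · exact S.eWord_mem_wtSpace w
  · exact S.fWord_mem_wtSpace w
  · exact S.H_mem_wtSpace x

lemma iSup_piece : ⨆ β, S.piece β = ⊤ := by
  rw [eq_top_iff, ← S.sup_eq_top]
  refine sup_le (sup_le (Submodule.span_le.2 ?_) ?_) (Submodule.span_le.2 ?_)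
  · rintro _ ⟨w, rfl⟩
    exact Submodule.mem_iSup_of_mem (content w)
      (Submodule.subset_span (Or.inl (Or.inl ⟨w, rfl, rfl⟩)))
  · rintro _ ⟨x, rfl⟩
    exact Submodule.mem_iSup_of_mem 0 (Submodule.subset_span (Or.inr ⟨rfl, x, rfl⟩))
  · rintro _ ⟨w, rfl⟩
    exact Submodule.mem_iSup_of_mem (-content w)
      (Submodule.subset_span (Or.inl (Or.inr ⟨w, rfl, rfl⟩)))

/-- The weight spaces are eigenspaces of a single `ad x`, with `x ∈ 𝔥` separating the weights. -/
lemma iSupIndep_wtSpace : iSupIndep S.wtSpace := by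
  obtain ⟨x, hx⟩ := R.exists_separating
  exact ((Module.End.eigenspaces_iSupIndep (LieAlgebra.ad ℂ L (S.H x))).comp hx).mono
    fun β => iInf_le _ x

/-- The pieces span the Lie algebra and lie in the independent weight spaces, so they fill them. -/
lemma wtSpace_eq_piece (β : RootLattice r) : S.wtSpace β = S.piece β := by
  refine le_antisymm ?_ (S.piece_le_wtSpace β)
  intro y hy
  have h1 : S.piece β ⊔ ⨆ γ ≠ β, S.piece γ = ⊤ := by
    rw [eq_top_iff, ← S.iSup_piece]
    refine iSup_le fun γ => ?_
    by_cases h : γ = β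
    · rw [h]; exact le_sup_left
    · exact le_sup_of_le_right (le_iSup₂_of_le γ h le_rfl)
  obtain ⟨a, ha, b, hb, rfl⟩ := Submodule.mem_sup.1 (h1 ▸ Submodule.mem_top : y ∈ _)
  have hb2 : b ∈ ⨆ γ ≠ β, S.wtSpace γ :=
    (iSup₂_mono fun γ _ => S.piece_le_wtSpace γ : (⨆ γ ≠ β, S.piece γ) ≤ _) hb
  have hb1 : b ∈ S.wtSpace β := by
    have := Submodule.sub_mem _ hy (S.piece_le_wtSpace β ha)
    simpa using this
  have : b = 0 := Submodule.disjoint_def.1 (S.iSupIndep_wtSpace β) b hb1 hb2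
  simpa [this] using ha

end ChevalleySystem

end

section

variable {r : ℕ} {C : CartanDatum r} {𝔥 : Type*} [AddCommGroup 𝔥] [Module ℂ 𝔥]

/-! ### Weight spaces and their dimensions -/

section SL2

variable {V : Type*} [AddCommGroup V] [Module ℂ V] {E F h : Module.End ℂ V}

/-- The commutation formula of `sl₂` for `E F ^ (n + 1)` on a vector of weight `μ`, stated for
endomorphisms that satisfy only the two relations it needs. The vector need not be primitive. -/
lemma sl2_apply_pow (hEF : ∀ v, E (F v) = F (E v) + h v)
    (hhF : ∀ v, h (F v) = F (h v) - (2 : ℂ) • F v) {μ : ℂ} {v : V} (hv : h v = μ • v) (n : ℕ) :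
    E ((F ^ (n + 1)) v) = (F ^ (n + 1)) (E v) + ((n + 1) * (μ - n)) • (F ^ n) v := by
  have hw : ∀ n : ℕ, h ((F ^ n) v) = (μ - 2 * n) • (F ^ n) v := by
    intro n
    induction n with
    | zero => simp [hv]
    | succ n ih =>
      rw [pow_succ', Module.End.mul_apply, hhF, ih, map_smul, ← sub_smul]
      congr 1
      push_cast
      ring
  induction n with
  | zero => simp [hEF, hv]
  | succ n ih =>
    rw [pow_succ' F (n + 1), Module.End.mul_apply, hEF, ih, hw, map_add, map_smul,
      ← Module.End.mul_apply, ← pow_succ', ← Module.End.mul_apply F (F ^ n), ← pow_succ',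
      add_assoc, ← add_smul]
    congr 2
    push_cast
    ring

/-- In a representation of `sl₂`, the operator `F ^ k` is injective on the part of the weight space
of weight `k` on which `E` is nilpotent. -/
lemma sl2_pow_injective (hEF : ∀ v, E (F v) = F (E v) + h v)
    (hhF : ∀ v, h (F v) = F (h v) - (2 : ℂ) • F v)
    (hhE : ∀ v, h (E v) = E (h v) + (2 : ℂ) • E v) (N : ℕ) :
    ∀ (k : ℕ) (v : V), h v = (k : ℂ) • v → (E ^ N) v = 0 → (F ^ k) v = 0 → v = 0 := by
  induction N with
  | zero => intro k v _ h1 _; simpa using h1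
  | succ N ih =>
    intro k v hv hE hF
    have hF1 : (F ^ (k + 1)) v = 0 := by rw [pow_succ', Module.End.mul_apply, hF, map_zero]
    have hF2 : (F ^ (k + 2)) v = 0 := by rw [pow_succ', Module.End.mul_apply, hF1, map_zero]
    have hEv : E v = 0 := by
      refine ih (k + 2) (E v) ?_ ?_ ?_
      · rw [hhE, hv, map_smul, ← add_smul]; push_cast; rfl
      · rw [pow_succ, Module.End.mul_apply] at hE; exact hE
      · have := sl2_apply_pow hEF hhF hv (k + 1)
        rw [hF2, hF1, map_zero, smul_zero, add_zero] at this
        exact this.symm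
    -- a primitive vector of weight `k` is not killed by the powers `F ^ j`, `j ≤ k`
    have key : ∀ j : ℕ, j ≤ k → (F ^ j) v = 0 → v = 0 := by
      intro j
      induction j with
      | zero => intro _ h; simpa using h
      | succ j ihj =>
        intro hj h0
        have h1 := sl2_apply_pow hEF hhF hv j
        rw [h0, hEv, map_zero, map_zero, zero_add, eq_comm, smul_eq_zero] at h1
        refine ihj (by omega) (h1.resolve_left
          (mul_ne_zero (by exact_mod_cast Nat.succ_ne_zero j) ?_))
        rw [sub_ne_zero]
        exact_mod_cast (by omega : k ≠ j)
    exact key k le_rfl hF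

end SL2

lemma finite_content_eq (β : RootLattice r) : {w : List (Fin r) | content w = β}.Finite := by
  refine (List.finite_length_eq (Fin r) (depth β).toNat).subset ?_
  rintro w rfl
  have : ∀ w : List (Fin r), depth (content w) = w.length := by
    intro w
    induction w with
    | nil => simp [depth]
    | cons i w ih =>
      simp only [depth, content_cons, Pi.add_apply, Finset.sum_add_distrib] at ih ⊢
      rw [ih]
      simp [simpleRoot, add_comm]
  simp [this]

namespace ChevalleySystem

variable {R : Realization C 𝔥} {L : Type*} [LieRing L] [LieAlgebra ℂ L] (S : ChevalleySystem R L)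

lemma lie_mem_wtSpace {β γ : RootLattice r} {x y : L} (hx : x ∈ S.wtSpace β)
    (hy : y ∈ S.wtSpace γ) : ⁅x, y⁆ ∈ S.wtSpace (β + γ) := by
  rw [mem_wtSpace] at *
  intro z
  rw [leibniz_lie, hx, hy, R.weight_add]
  simp [add_smul]

lemma e_mem_wtSpace (i : Fin r) : S.e i ∈ S.wtSpace (simpleRoot i) := by
  simpa [eWord] using S.eWord_mem_wtSpace [i]

lemma wtSpace_zero : S.wtSpace 0 = LinearMap.range S.H := by
  refine le_antisymm ?_ (by rintro _ ⟨x, rfl⟩; exact S.H_mem_wtSpace x)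
  rw [wtSpace_eq_piece]
  refine Submodule.span_le.2 ?_
  rintro _ ((⟨w, hw, rfl⟩ | ⟨w, hw, rfl⟩) | ⟨_, x, rfl⟩)
  · simp [content_eq_zero hw, eWord]
  · simp [content_eq_zero (neg_eq_zero.1 hw), eWord]
  · exact ⟨x, rfl⟩

lemma wtSpace_eq_span_of_pos {β : RootLattice r} (h0 : β ≠ 0) (hβ : 0 ≤ β) :
    S.wtSpace β = Submodule.span ℂ (S.eWord '' {w | content w = β}) := by
  rw [wtSpace_eq_piece]
  refine le_antisymm (Submodule.span_le.2 ?_) (Submodule.span_mono ?_)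
  · rintro _ ((⟨w, hw, rfl⟩ | ⟨w, hw, rfl⟩) | ⟨h, x, rfl⟩)
    · exact Submodule.subset_span ⟨w, hw, rfl⟩
    · exact absurd (le_antisymm (by rw [← hw]; simpa using content_nonneg w) hβ) h0
    · exact absurd h h0
  · rintro _ ⟨w, hw, rfl⟩
    exact Or.inl (Or.inl ⟨w, hw, rfl⟩)

/-- The root space of a positive root is spanned by the commutators of the words of that content. -/
lemma finrank_wtSpace_le {β : RootLattice r} (h0 : β ≠ 0) (hβ : 0 ≤ β) :
    Module.finrank ℂ (S.wtSpace β) ≤ {w : List (Fin r) | content w = β}.ncard := by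
  have hfin := finite_content_eq β
  rw [S.wtSpace_eq_span_of_pos h0 hβ]
  have := (hfin.image S.eWord).fintype
  refine (finrank_span_le_card _).trans ?_
  rw [← Set.ncard_eq_toFinset_card']
  exact Set.ncard_image_le hfin

lemma nonneg_or_nonpos_of_wtSpace {β : RootLattice r} (h : S.wtSpace β ≠ ⊥) : 0 ≤ β ∨ β ≤ 0 := by
  by_contra! hc
  refine h ?_
  rw [wtSpace_eq_piece, piece, Submodule.span_eq_bot]
  rintro _ ((⟨w, hw, rfl⟩ | ⟨w, hw, rfl⟩) | ⟨h, x, rfl⟩)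
  · exact absurd (content_nonneg w) (hw ▸ hc.1)
  · exact absurd (neg_nonpos.2 (content_nonneg w)) (hw ▸ hc.2)
  · exact absurd h.le hc.2

lemma finiteDimensional_wtSpace (β : RootLattice r) : FiniteDimensional ℂ (S.wtSpace β) := by
  have hpos : ∀ (S : ChevalleySystem R L) (β : RootLattice r), 0 ≤ β →
      FiniteDimensional ℂ (S.wtSpace β) := by
    intro S β hβ
    by_cases h0 : β = 0
    · subst h0
      rw [wtSpace_zero]
      have : Module.Finite ℂ 𝔥 := Module.Finite.of_basis R.corootBasis
      infer_instance
    · rw [S.wtSpace_eq_span_of_pos h0 hβ]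
      exact FiniteDimensional.span_of_finite ℂ ((finite_content_eq β).image _)
  by_cases h : S.wtSpace β = ⊥
  · rw [h]; infer_instance
  · rcases S.nonneg_or_nonpos_of_wtSpace h with h | h
    · exact hpos S β h
    · have := hpos S.swap (-β) (by simpa using h)
      rwa [swap_wtSpace, neg_neg] at this

lemma mem_of_content_smul {w : List (Fin r)} {i : Fin r} {k : ℕ}
    (h : content w = k • simpleRoot i) : w = List.replicate k i := by
  have hi : ∀ j, j ≠ i → j ∉ w := fun j hj hm => by
    have := congrFun h j
    rw [content_apply] at this
    have h2 := List.count_pos_iff.2 hm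
    simp [simpleRoot, hj] at this
    omega
  have hall : ∀ j ∈ w, j = i := fun j hj => by
    by_contra h; exact hi j h hj
  have hw := List.eq_replicate_of_mem hall
  have := congrFun h i
  rw [content_apply, hw, List.count_replicate_self] at this
  simp [simpleRoot] at this
  rw [hw, this]

lemma wtSpace_simpleRoot (i : Fin r) : S.wtSpace (simpleRoot i) = ℂ ∙ S.e i := by
  rw [S.wtSpace_eq_span_of_pos (by simp [simpleRoot]) (by simp [simpleRoot])]
  congr 1
  have : {w : List (Fin r) | content w = simpleRoot i} = {[i]} := by
    ext w
    simp only [Set.mem_ofPred, Set.mem_singleton_iff]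
    constructor
    · intro h
      exact mem_of_content_smul (k := 1) (by simpa using h)
    · rintro rfl; simp
  rw [this]
  simp [eWord]

lemma wtSpace_nsmul_simpleRoot (i : Fin r) {k : ℕ} (hk : 2 ≤ k) :
    S.wtSpace (k • simpleRoot i) = ⊥ := by
  rw [S.wtSpace_eq_span_of_pos (fun h => by
      have := congrFun h i
      simp [simpleRoot] at this
      omega)
    (by rw [simpleRoot]; exact smul_nonneg (by simp) (by simp)), Submodule.span_eq_bot]
  rintro _ ⟨w, hw, rfl⟩
  rw [mem_of_content_smul hw]
  obtain ⟨k, rfl⟩ := Nat.exists_eq_add_of_le hk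
  have : ∀ k, S.eWord (List.replicate (k + 2) i) = 0 := by
    intro k
    induction k with
    | zero => simp [List.replicate, eWord]
    | succ k ih =>
      rw [List.replicate_succ, S.eWord_cons i (by simp [List.replicate_succ]), ih, lie_zero]
  rw [add_comm]
  exact this k

/-- The elements without component in the weight space of weight `0`. -/
def nonzeroPart : Submodule ℂ L := ⨆ β ≠ 0, S.wtSpace β

lemma nPos_le_nonzeroPart : S.nPos ≤ S.nonzeroPart := by
  refine Submodule.span_le.2 ?_
  rintro _ ⟨w, rfl⟩
  rcases eq_or_ne w [] with rfl | h
  · simp [eWord]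
  · exact Submodule.mem_iSup_of_mem (content w)
      (Submodule.mem_iSup_of_mem (fun h0 => h (content_eq_zero h0)) (S.eWord_mem_wtSpace w))

lemma H_eq_zero_of_mem_nonzeroPart {x : 𝔥} (h : S.H x ∈ S.nonzeroPart) : S.H x = 0 :=
  Submodule.disjoint_def.1 (S.iSupIndep_wtSpace 0) _ (S.H_mem_wtSpace x) h

/-- An ideal that meets `𝔥` trivially is contained in the sum of the root spaces. -/
lemma ideal_le_nonzeroPart (I : LieIdeal ℂ L) (hI : ∀ x, S.H x ∈ I → S.H x = 0) :
    (I : Submodule ℂ L) ≤ S.nonzeroPart := by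
  intro y hy
  obtain ⟨x, hx⟩ := R.exists_separating
  set T := LieAlgebra.ad ℂ L (S.H x) with hT
  have hTI : ∀ P : Polynomial ℂ, ∀ z ∈ I, Polynomial.aeval T P z ∈ I := by
    intro P z hz
    induction P using Polynomial.induction_on' with
    | add p q hp hq => rw [map_add]; exact I.add_mem hp hq
    | monomial n a =>
      have : ∀ n : ℕ, (T ^ n) z ∈ I := by
        intro n
        induction n with
        | zero => simpa using hz
        | succ n ih =>
          rw [pow_succ', Module.End.mul_apply, hT, LieAlgebra.ad_apply]
          exact I.lie_mem ih
      rw [Polynomial.aeval_monomial]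
      exact I.smul_mem a (this n)
  have htop : S.wtSpace 0 ⊔ S.nonzeroPart = ⊤ := by
    rw [eq_top_iff, ← S.iSup_piece]
    refine iSup_le fun γ => ?_
    rw [← wtSpace_eq_piece]
    by_cases h : γ = 0
    · rw [h]; exact le_sup_left
    · exact le_sup_of_le_right (le_iSup₂_of_le γ h le_rfl)
  -- a polynomial in `ad x` that kills `b` and acts on the weight space of weight `0` as a
  -- nonzero scalar
  have hpoly : ∀ b ∈ S.nonzeroPart,
      ∃ P : Polynomial ℂ, Polynomial.aeval T P b = 0 ∧ P.eval 0 ≠ 0 := by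
    intro b hb
    rw [nonzeroPart, iSup_subtype'] at hb
    induction hb using Submodule.iSup_induction' with
    | mem γ z hz =>
      refine ⟨Polynomial.X - Polynomial.C (R.weight γ x), ?_, ?_⟩
      · have := S.mem_wtSpace.1 hz x
        simp [hT, this]
      · have : R.weight γ.1 x ≠ R.weight 0 x := fun h => γ.2 (hx h)
        rw [R.weight_zero] at this
        simpa using this
    | zero => exact ⟨1, by simp, by simp⟩
    | add u v _ _ hu hv =>
      obtain ⟨P, hP, hP'⟩ := hu
      obtain ⟨Q, hQ, hQ'⟩ := hv
      refine ⟨P * Q, ?_, by simpa using ⟨hP', hQ'⟩⟩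
      rw [map_add, map_mul, Module.End.mul_apply, Module.End.mul_apply, hQ, map_zero, add_zero,
        ← Module.End.mul_apply, ← map_mul, mul_comm, map_mul, Module.End.mul_apply, hP, map_zero]
  obtain ⟨a, ha, b, hb, rfl⟩ := Submodule.mem_sup.1 (htop ▸ Submodule.mem_top : y ∈ _)
  obtain ⟨P, hPb, hP0⟩ := hpoly b hb
  have hTa : T a = (0 : ℂ) • a := by
    have := S.mem_wtSpace.1 ha x
    rw [R.weight_zero] at this
    exact this
  have hPa : Polynomial.aeval T P a = P.eval 0 • a :=
    Module.End.aeval_apply_of_mem_apply_eq_smul hTa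
  have h1 := hTI P _ hy
  rw [map_add, hPb, add_zero, hPa] at h1
  have h2 : a ∈ I := by
    have := I.smul_mem (P.eval 0)⁻¹ h1
    rwa [smul_smul, inv_mul_cancel₀ hP0, one_smul] at this
  rw [wtSpace_zero] at ha
  obtain ⟨z, rfl⟩ := ha
  rw [hI z h2, zero_add]
  exact hb

end ChevalleySystem

end

section

variable {r : ℕ} {C : CartanDatum r} {𝔥 : Type*} [AddCommGroup 𝔥] [Module ℂ 𝔥]

/-! ### Serre relations, integrability and Weyl invariance of the multiplicities -/

lemma simpleReflection_apply (i : Fin r) (β : RootLattice r) :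
    simpleReflection C i β = β - pairing C i β • simpleRoot i := rfl

namespace ChevalleySystem

variable {R : Realization C 𝔥} {L : Type*} [LieRing L] [LieAlgebra ℂ L] (S : ChevalleySystem R L)

/-- A weight vector in the span of the commutators of the `e_i` that is killed by all `f_i`
generates an ideal that meets `𝔥` trivially. -/
lemma H_eq_zero_of_mem_lieSpan {θ : L} {β : RootLattice r} (hβ : θ ∈ S.wtSpace β)
    (hθ : θ ∈ S.nPos) (hf : ∀ i, ⁅S.f i, θ⁆ = 0) {x : 𝔥}
    (hx : S.H x ∈ LieSubmodule.lieSpan ℂ L {θ}) : S.H x = 0 := by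
  let y : List (Fin r) → L := fun w => w.foldr (fun i z => ⁅S.e i, z⁆) θ
  let P : Submodule ℂ L := Submodule.span ℂ (Set.range y)
  have hy : ∀ w, y w ∈ P := fun w => Submodule.subset_span ⟨w, rfl⟩
  have hcons : ∀ i w, y (i :: w) = ⁅S.e i, y w⁆ := fun i w => rfl
  have hwt : ∀ w, y w ∈ S.wtSpace (content w + β) := by
    intro w
    induction w with
    | nil => simpa [y] using hβ
    | cons i w ih =>
      rw [hcons, content_cons, add_assoc]
      exact S.lie_mem_wtSpace (S.e_mem_wtSpace i) ih
  have hPn : P ≤ S.nPos := by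
    refine Submodule.span_le.2 ?_
    rintro _ ⟨w, rfl⟩
    induction w with
    | nil => exact hθ
    | cons i w ih => exact S.lie_e_mem_nPos i ih
  have hfy : ∀ i w, ⁅S.f i, y w⁆ ∈ P := by
    intro i w
    induction w with
    | nil => simp [y, hf]
    | cons j w ih =>
      rw [hcons, leibniz_lie]
      refine P.add_mem ?_ (lie_mem_of_span (M := P) ?_ ih)
      · rw [S.lie_f_e]
        split_ifs
        · rw [neg_lie, S.mem_wtSpace.1 (hwt w)]
          exact P.neg_mem (P.smul_mem _ (hy w))
        · simp
      · rintro _ ⟨w, rfl⟩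
        exact hy (j :: w)
  have hstab : ∀ a b : L, b ∈ P → ⁅a, b⁆ ∈ P := by
    refine lie_mem_of_stable S.lieSpan_eq_top P ?_
    rintro _ ((⟨x, rfl⟩ | ⟨i, rfl⟩) | ⟨i, rfl⟩) z hz
    · refine lie_mem_of_span ?_ hz
      rintro _ ⟨w, rfl⟩
      rw [S.mem_wtSpace.1 (hwt w)]
      exact P.smul_mem _ (hy w)
    · refine lie_mem_of_span ?_ hz
      rintro _ ⟨w, rfl⟩
      exact hy (i :: w)
    · refine lie_mem_of_span ?_ hz
      rintro _ ⟨w, rfl⟩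
      exact hfy i w
  let I : LieIdeal ℂ L := { P with lie_mem := fun {a b} hb => hstab a b hb }
  have hI : LieSubmodule.lieSpan ℂ L {θ} ≤ I := by
    rw [LieSubmodule.lieSpan_le]
    rintro _ rfl
    exact hy []
  exact S.H_eq_zero_of_mem_nonzeroPart (S.nPos_le_nonzeroPart (hPn (hI hx)))

/-- The element `(ad e_i)^(1 - a_{ij}) e_j`. -/
def serre (i j : Fin r) : L :=
  ((LieAlgebra.ad ℂ L (S.e i)) ^ ((-C.A i j).toNat + 1)) (S.e j)

lemma ad_pow_mem_nPos (i : Fin r) {y : L} (hy : y ∈ S.nPos) (n : ℕ) :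
    ((LieAlgebra.ad ℂ L (S.e i)) ^ n) y ∈ S.nPos := by
  induction n with
  | zero => simpa using hy
  | succ n ih => rw [pow_succ', Module.End.mul_apply]; exact S.lie_e_mem_nPos i ih

lemma ad_pow_mem_wtSpace (i : Fin r) {β : RootLattice r} {y : L} (hy : y ∈ S.wtSpace β) (n : ℕ) :
    ((LieAlgebra.ad ℂ L (S.e i)) ^ n) y ∈ S.wtSpace (n • simpleRoot i + β) := by
  induction n with
  | zero => simpa using hy
  | succ n ih =>
    rw [pow_succ', Module.End.mul_apply, succ_nsmul', add_assoc]
    exact S.lie_mem_wtSpace (S.e_mem_wtSpace i) ih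

/-- The Serre elements are killed by all `f_k`; for `k = i` this is the formula `sl2_apply_pow` at
the exponent where its scalar vanishes. -/
lemma lie_f_serre {i j : Fin r} (hij : i ≠ j) (k : Fin r) : ⁅S.f k, S.serre i j⁆ = 0 := by
  have hneg : ((-C.A i j).toNat : ℤ) = -C.A i j :=
    Int.toNat_of_nonneg (neg_nonneg.2 (C.off_diag i j hij))
  have hcomm : k ≠ i → ∀ n : ℕ, ∀ y : L,
      ⁅S.f k, ((LieAlgebra.ad ℂ L (S.e i)) ^ n) y⁆ =
        ((LieAlgebra.ad ℂ L (S.e i)) ^ n) ⁅S.f k, y⁆ := by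
    intro hk n y
    induction n with
    | zero => simp
    | succ n ih =>
      rw [pow_succ', Module.End.mul_apply, LieAlgebra.ad_apply, leibniz_lie, S.lie_f_e,
        if_neg (Ne.symm hk), neg_zero, zero_lie, zero_add, ih]
      rfl
  rw [serre]
  by_cases hki : k = i
  · subst hki
    -- the triple `(f_i, e_i, -h_i)` acts on `e_j`, a vector killed by `f_i` of weight `-a_{ij}`
    have h := sl2_apply_pow (E := LieAlgebra.ad ℂ L (S.f k)) (F := LieAlgebra.ad ℂ L (S.e k))
      (h := LieAlgebra.ad ℂ L (-S.H (R.coroot k))) (μ := ((-C.A k j).toNat : ℂ)) (v := S.e j)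
      ?_ ?_ ?_ (-C.A k j).toNat
    · rw [LieAlgebra.ad_apply] at h
      rw [h, LieAlgebra.ad_apply, S.lie_f_e, if_neg (Ne.symm hij)]
      simp
    · intro v
      simp only [LieAlgebra.ad_apply]
      rw [leibniz_lie, S.lie_f_e, if_pos rfl, add_comm]
    · intro v
      simp only [LieAlgebra.ad_apply, neg_lie, lie_neg]
      rw [leibniz_lie (S.H _), S.lie_H_e, R.α_coroot, C.diag, smul_lie]
      push_cast
      abel
    · rw [LieAlgebra.ad_apply, neg_lie, S.lie_H_e, R.α_coroot, ← neg_smul]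
      congr 1
      exact_mod_cast hneg.symm
  · rw [hcomm hki, S.lie_f_e]
    split_ifs with hjk
    · subst hjk
      rw [pow_succ, Module.End.mul_apply, LieAlgebra.ad_apply, lie_neg, S.lie_e_H, R.α_coroot,
        neg_neg, map_smul]
      rcases Nat.eq_zero_or_pos (-C.A i j).toNat with h0 | h0
      · have h1 : C.A i j = 0 := by omega
        rw [(C.zero_iff i j).1 h1]
        simp
      · obtain ⟨n, hn⟩ := Nat.exists_eq_succ_of_ne_zero h0.ne'
        rw [hn, pow_succ, Module.End.mul_apply, LieAlgebra.ad_apply, lie_self, map_zero, smul_zero]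
    · simp

/-- If the Serre elements vanish, then `ad e_i` is locally nilpotent: the elements on which it is
nilpotent form a subalgebra, and this subalgebra contains the generators. -/
lemma exists_ad_e_pow_eq_zero (hserre : ∀ i j, i ≠ j → S.serre i j = 0) (i : Fin r) (y : L) :
    ∃ N : ℕ, ((LieAlgebra.ad ℂ L (S.e i)) ^ N) y = 0 := by
  rw [← LieSubalgebra.mem_engel_iff ℂ]
  suffices h : LieSubalgebra.engel ℂ (S.e i) = ⊤ by rw [h]; trivial
  rw [eq_top_iff, ← S.lieSpan_eq_top, LieSubalgebra.lieSpan_le]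
  have hH : ∀ x, ((LieAlgebra.ad ℂ L (S.e i)) ^ 2) (S.H x) = 0 := fun x => by
    rw [pow_two, Module.End.mul_apply]
    simp [S.lie_e_H]
  rintro _ ((⟨x, rfl⟩ | ⟨j, rfl⟩) | ⟨j, rfl⟩)
  · exact (LieSubalgebra.mem_engel_iff ℂ _ _).2 ⟨2, hH x⟩
  · by_cases hij : i = j
    · subst hij
      exact LieSubalgebra.self_mem_engel ℂ _
    · exact (LieSubalgebra.mem_engel_iff ℂ _ _).2 ⟨_, hserre i j hij⟩
  · refine (LieSubalgebra.mem_engel_iff ℂ _ _).2 ⟨3, ?_⟩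
    rw [pow_succ, Module.End.mul_apply, LieAlgebra.ad_apply, S.lie_e_f]
    split_ifs
    · exact hH _
    · simp

/-- The dimension of a weight space does not decrease under a simple reflection: for
`k = β(h_i) ≥ 0` the operator `(ad f_i) ^ k` embeds the weight space of `β` into that of `σ_i β`;
the case `β(h_i) ≤ 0` follows by the Chevalley involution. -/
lemma finrank_wtSpace_le_reflection
    (he : ∀ (i : Fin r) (y : L), ∃ N : ℕ, ((LieAlgebra.ad ℂ L (S.e i)) ^ N) y = 0)
    (hf : ∀ (i : Fin r) (y : L), ∃ N : ℕ, ((LieAlgebra.ad ℂ L (S.f i)) ^ N) y = 0)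
    (i : Fin r) (β : RootLattice r) :
    Module.finrank ℂ (S.wtSpace β) ≤ Module.finrank ℂ (S.wtSpace (simpleReflection C i β)) := by
  have main : ∀ (S : ChevalleySystem R L),
      (∀ (i : Fin r) (y : L), ∃ N : ℕ, ((LieAlgebra.ad ℂ L (S.e i)) ^ N) y = 0) →
      ∀ β : RootLattice r, 0 ≤ pairing C i β →
      Module.finrank ℂ (S.wtSpace β) ≤ Module.finrank ℂ (S.wtSpace (simpleReflection C i β)) := by
    intro S he β hβ
    obtain ⟨k, hk⟩ := Int.eq_ofNat_of_zero_le hβ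
    have hmap : ∀ y ∈ S.wtSpace β,
        ((LieAlgebra.ad ℂ L (S.f i)) ^ k) y ∈ S.wtSpace (simpleReflection C i β) := by
      intro y hy
      have := S.swap.ad_pow_mem_wtSpace i (β := -β) (y := y)
        (by rwa [swap_wtSpace, neg_neg]) k
      rw [swap_wtSpace, swap_e] at this
      convert this using 2
      rw [simpleReflection_apply, hk]
      simp [sub_eq_add_neg]
    have := S.finiteDimensional_wtSpace (simpleReflection C i β)
    refine LinearMap.finrank_le_finrank_of_injective
      (f := ((LieAlgebra.ad ℂ L (S.f i)) ^ k).restrict hmap) ?_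
    rw [← LinearMap.ker_eq_bot, LinearMap.ker_eq_bot']
    rintro ⟨y, hy⟩ h0
    have h1 : ((LieAlgebra.ad ℂ L (S.f i)) ^ k) y = 0 := congrArg Subtype.val h0
    obtain ⟨N, hN⟩ := he i y
    refine Subtype.ext (sl2_pow_injective (E := LieAlgebra.ad ℂ L (S.e i))
      (F := LieAlgebra.ad ℂ L (S.f i)) (h := LieAlgebra.ad ℂ L (S.H (R.coroot i)))
      ?_ ?_ ?_ N k y ?_ hN h1)
    · intro v
      simp only [LieAlgebra.ad_apply]
      rw [leibniz_lie, S.lie_e_f, if_pos rfl, add_comm]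
    · intro v
      simp only [LieAlgebra.ad_apply]
      rw [leibniz_lie (S.H _), S.lie_H_f, R.α_coroot, C.diag, neg_lie, smul_lie]
      push_cast
      abel
    · intro v
      simp only [LieAlgebra.ad_apply]
      rw [leibniz_lie (S.H _), S.lie_H_e, R.α_coroot, C.diag, smul_lie]
      push_cast
      abel
    · rw [LieAlgebra.ad_apply, S.mem_wtSpace.1 hy, R.weight_coroot, hk]
      simp
  rcases le_total 0 (pairing C i β) with h | h
  · exact main S he β h
  · have := main S.swap hf (-β) (by rw [map_neg]; omega)
    rwa [swap_wtSpace, swap_wtSpace, neg_neg, map_neg, neg_neg] at this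

lemma finrank_wtSpace_reflection
    (he : ∀ (i : Fin r) (y : L), ∃ N : ℕ, ((LieAlgebra.ad ℂ L (S.e i)) ^ N) y = 0)
    (hf : ∀ (i : Fin r) (y : L), ∃ N : ℕ, ((LieAlgebra.ad ℂ L (S.f i)) ^ N) y = 0)
    (i : Fin r) (β : RootLattice r) :
    Module.finrank ℂ (S.wtSpace (simpleReflection C i β)) = Module.finrank ℂ (S.wtSpace β) := by
  refine le_antisymm ?_ (S.finrank_wtSpace_le_reflection he hf i β)
  have := S.finrank_wtSpace_le_reflection he hf i (simpleReflection C i β)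
  rwa [simpleReflection, Module.involutive_reflection (pairing_simpleRoot C i) β] at this

end ChevalleySystem

end

section

variable {r : ℕ} {C : CartanDatum r} {𝔥 : Type*} [AddCommGroup 𝔥] [Module ℂ 𝔥]

/-! ### The Kac-Moody algebra and its root multiplicities -/

lemma freeLieAlgebra_lieSpan_range_of (X : Type*) :
    LieSubalgebra.lieSpan ℂ (FreeLieAlgebra ℂ X) (Set.range (FreeLieAlgebra.of ℂ)) = ⊤ := by
  set K := LieSubalgebra.lieSpan ℂ (FreeLieAlgebra ℂ X) (Set.range (FreeLieAlgebra.of ℂ))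
  let F : FreeLieAlgebra ℂ X →ₗ⁅ℂ⁆ K := FreeLieAlgebra.lift ℂ fun x =>
    ⟨FreeLieAlgebra.of ℂ x, LieSubalgebra.subset_lieSpan ⟨x, rfl⟩⟩
  have h : K.incl.comp F = LieHom.id := FreeLieAlgebra.hom_ext fun x => by
    simp [F, FreeLieAlgebra.lift_of_apply]
  rw [eq_top_iff]
  intro x _
  have := LieHom.congr_fun h x
  rw [LieHom.comp_apply, LieHom.id_apply] at this
  rw [← this]
  exact (F x).2

/-- The quotient map of a Lie algebra by an ideal. -/
def quotientMap {L : Type*} [LieRing L] [LieAlgebra ℂ L] (I : LieIdeal ℂ L) : L →ₗ⁅ℂ⁆ L ⧸ I :=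
  { (LieSubmodule.Quotient.mk' I : L →ₗ[ℂ] L ⧸ I) with
    map_lie' := fun {_ _} => rfl }

lemma quotientMap_eq_zero {L : Type*} [LieRing L] [LieAlgebra ℂ L] (I : LieIdeal ℂ L) (x : L) :
    quotientMap I x = 0 ↔ x ∈ I := LieSubmodule.Quotient.mk_eq_zero' (N := I)

lemma quotientMap_surjective {L : Type*} [LieRing L] [LieAlgebra ℂ L] (I : LieIdeal ℂ L) :
    Function.Surjective (quotientMap I) := LieSubmodule.Quotient.surjective_mk' I

lemma lieSpan_image_eq_top {L L' : Type*} [LieRing L] [LieAlgebra ℂ L] [LieRing L']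
    [LieAlgebra ℂ L'] (φ : L →ₗ⁅ℂ⁆ L') (hφ : Function.Surjective φ) {s : Set L}
    (hs : LieSubalgebra.lieSpan ℂ L s = ⊤) : LieSubalgebra.lieSpan ℂ L' (φ '' s) = ⊤ := by
  rw [← LieSubalgebra.map_lieSpan, hs, eq_top_iff]
  intro y _
  obtain ⟨x, rfl⟩ := hφ y
  exact ⟨x, trivial, rfl⟩

/-- The image of a Chevalley system under a surjective homomorphism. -/
def ChevalleySystem.map {R : Realization C 𝔥} {L L' : Type*} [LieRing L] [LieAlgebra ℂ L]
    [LieRing L'] [LieAlgebra ℂ L'] (S : ChevalleySystem R L) (φ : L →ₗ⁅ℂ⁆ L')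
    (hφ : Function.Surjective φ) : ChevalleySystem R L' where
  H := (φ : L →ₗ[ℂ] L') ∘ₗ S.H
  e i := φ (S.e i)
  f i := φ (S.f i)
  lie_H_H x y := by simp [← LieHom.map_lie, S.lie_H_H]
  lie_e_f i j := by
    rw [← LieHom.map_lie, S.lie_e_f]
    split_ifs <;> simp
  lie_H_e x i := by simp [← LieHom.map_lie, S.lie_H_e]
  lie_H_f x i := by simp [← LieHom.map_lie, S.lie_H_f]
  lieSpan_eq_top := by
    have := lieSpan_image_eq_top φ hφ S.lieSpan_eq_top
    rw [Set.image_union, Set.image_union, ← Set.range_comp, ← Set.range_comp, ← Set.range_comp]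
      at this
    exact this

variable (R : Realization C 𝔥)

lemma quotientMap_eq_of_mem {a b : FreeLieAlgebra ℂ (Gen r 𝔥)} (h : a - b ∈ relations R) :
    quotientMap (relIdeal R) a = quotientMap (relIdeal R) b := by
  rw [← sub_eq_zero, ← map_sub, quotientMap_eq_zero]
  exact LieSubmodule.subset_lieSpan h

lemma auxH_eq (x : 𝔥) : auxH R x = quotientMap (relIdeal R) (freeH x) := rfl

lemma auxH_smul_add (a : ℂ) (x y : 𝔥) : auxH R (a • x + y) = a • auxH R x + auxH R y := by
  rw [auxH_eq, auxH_eq, auxH_eq, ← map_smul, ← map_add]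
  exact quotientMap_eq_of_mem R (Or.inl (Or.inl (Or.inl (Or.inl ⟨a, x, y, rfl⟩))))

lemma auxH_zero : auxH R 0 = 0 := by
  have := auxH_smul_add R 1 0 0
  simpa using this

/-- The Chevalley generators of the auxiliary Lie algebra. -/
def auxSystem : ChevalleySystem R (AuxAlgebra R) where
  H :=
    { toFun := auxH R
      map_add' := fun x y => by simpa using auxH_smul_add R 1 x y
      map_smul' := fun a x => by simpa [auxH_zero] using auxH_smul_add R a x 0 }
  e i := quotientMap (relIdeal R) (freeE 𝔥 i)
  f i := quotientMap (relIdeal R) (freeF 𝔥 i)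
  lie_H_H x y := by
    change ⁅auxH R x, auxH R y⁆ = 0
    rw [auxH_eq, auxH_eq, ← LieHom.map_lie, quotientMap_eq_zero]
    exact LieSubmodule.subset_lieSpan (Or.inl (Or.inl (Or.inl (Or.inr ⟨x, y, rfl⟩))))
  lie_e_f i j := by
    rw [← LieHom.map_lie,
      quotientMap_eq_of_mem R (Or.inl (Or.inl (Or.inr ⟨i, j, rfl⟩)))]
    split_ifs
    · rfl
    · simp
  lie_H_e x i := by
    change ⁅auxH R x, _⁆ = _
    rw [auxH_eq, ← LieHom.map_lie, ← map_smul]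
    exact quotientMap_eq_of_mem R (Or.inl (Or.inr ⟨x, i, rfl⟩))
  lie_H_f x i := by
    change ⁅auxH R x, _⁆ = _
    rw [auxH_eq, ← LieHom.map_lie, ← map_smul, ← map_neg]
    exact quotientMap_eq_of_mem R (Or.inr ⟨x, i, by rw [sub_neg_eq_add]⟩)
  lieSpan_eq_top := by
    have := lieSpan_image_eq_top _ (quotientMap_surjective (relIdeal R))
      (freeLieAlgebra_lieSpan_range_of (Gen r 𝔥))
    rw [eq_top_iff, ← this]
    refine LieSubalgebra.lieSpan_mono ?_
    rintro _ ⟨_, ⟨(x | i | i), rfl⟩, rfl⟩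
    · exact Or.inl (Or.inl ⟨x, rfl⟩)
    · exact Or.inl (Or.inr ⟨i, rfl⟩)
    · exact Or.inr ⟨i, rfl⟩

lemma auxSystem_H (x : 𝔥) : (auxSystem R).H x = auxH R x := rfl

/-- The Chevalley generators of the Kac-Moody algebra. -/
def kmSystem : ChevalleySystem R (KMAlgebra R) :=
  (auxSystem R).map (quotientMap (radIdeal R)) (quotientMap_surjective _)

lemma rootSpace_eq (β : RootLattice r) : rootSpace R β = (kmSystem R).wtSpace β := rfl

section Verma

/-- The module of the auxiliary algebra with basis the words, on which `f_i` acts by adjoining the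
letter `i`. It is the Verma module of highest weight `φ`, with the action of `wordH` and `wordE`
below. -/
abbrev WordModule (r : ℕ) := List (Fin r) →₀ ℂ

/-- The action of `f_i`. -/
def wordF (i : Fin r) : Module.End ℂ (WordModule r) :=
  Finsupp.linearCombination ℂ fun w => Finsupp.single (i :: w) 1

/-- The action of `x ∈ 𝔥`; the empty word has weight `φ`. -/
def wordH (φ : Module.Dual ℂ 𝔥) (x : 𝔥) : Module.End ℂ (WordModule r) :=
  Finsupp.linearCombination ℂ fun w => Finsupp.single w (φ x - R.weight (content w) x)

/-- The action of `e_i` on basis vectors, determined by `[e_i, f_j] = δ_{ij} h_i` and by the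
vanishing of `e_i` on the empty word. -/
def wordEVec (φ : Module.Dual ℂ 𝔥) (i : Fin r) : List (Fin r) → WordModule r
  | [] => 0
  | j :: w => wordF j (wordEVec φ i w) +
      if i = j then wordH R φ (R.coroot i) (Finsupp.single w 1) else 0

/-- The action of `e_i`. -/
def wordE (φ : Module.Dual ℂ 𝔥) (i : Fin r) : Module.End ℂ (WordModule r) :=
  Finsupp.linearCombination ℂ (wordEVec R φ i)

lemma wordF_single (i : Fin r) (w : List (Fin r)) :
    wordF i (Finsupp.single w 1) = Finsupp.single (i :: w) 1 := by
  simp [wordF]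

lemma wordH_single (φ : Module.Dual ℂ 𝔥) (x : 𝔥) (w : List (Fin r)) :
    wordH R φ x (Finsupp.single w 1) = (φ x - R.weight (content w) x) • Finsupp.single w 1 := by
  simp [wordH]

lemma wordE_single (φ : Module.Dual ℂ 𝔥) (i : Fin r) (w : List (Fin r)) :
    wordE R φ i (Finsupp.single w 1) = wordEVec R φ i w := by
  simp [wordE]

lemma wordEnd_ext {S T : Module.End ℂ (WordModule r)}
    (h : ∀ w, S (Finsupp.single w 1) = T (Finsupp.single w 1)) : S = T :=
  Finsupp.lhom_ext' fun w => LinearMap.ext_ring (h w)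

lemma wordH_wordF (φ : Module.Dual ℂ 𝔥) (x : 𝔥) (i : Fin r) (v : WordModule r) :
    wordH R φ x (wordF i v) = wordF i (wordH R φ x v) - R.α i x • wordF i v := by
  have : wordH R φ x * wordF i = wordF i * wordH R φ x - R.α i x • wordF i := by
    refine wordEnd_ext fun w => ?_
    simp only [Module.End.mul_apply, LinearMap.sub_apply, LinearMap.smul_apply, wordF_single,
      wordH_single, map_smul, content_cons, R.weight_add, R.weight_simpleRoot,
      LinearMap.add_apply, ← sub_smul]
    congr 1
    ring
  exact LinearMap.congr_fun this v

lemma wordH_wordEVec (φ : Module.Dual ℂ 𝔥) (x : 𝔥) (i : Fin r) (w : List (Fin r)) :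
    wordH R φ x (wordEVec R φ i w) =
      (φ x - R.weight (content w) x + R.α i x) • wordEVec R φ i w := by
  induction w with
  | nil => simp [wordEVec]
  | cons j w ih =>
    rw [wordEVec, map_add, wordH_wordF, ih, content_cons, R.weight_add, R.weight_simpleRoot,
      map_smul, ← sub_smul, smul_add, LinearMap.add_apply]
    congr 1
    · congr 1
      ring
    · split_ifs with h
      · subst h
        rw [wordH_single, map_smul, wordH_single, smul_comm]
        congr 1
        ring
      · simp

lemma wordE_wordF (φ : Module.Dual ℂ 𝔥) (i j : Fin r) (v : WordModule r) :
    wordE R φ i (wordF j v) =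
      wordF j (wordE R φ i v) + if i = j then wordH R φ (R.coroot i) v else 0 := by
  have : wordE R φ i * wordF j =
      wordF j * wordE R φ i + if i = j then wordH R φ (R.coroot i) else 0 := by
    refine wordEnd_ext fun w => ?_
    simp only [Module.End.mul_apply, LinearMap.add_apply, wordF_single, wordE_single]
    rw [wordEVec]
    split_ifs <;> simp
  have h := LinearMap.congr_fun this v
  simp only [Module.End.mul_apply, LinearMap.add_apply] at h
  rw [h]
  split_ifs <;> simp

/-- The action of the generators on the word module. -/
def wordGen (φ : Module.Dual ℂ 𝔥) : Gen r 𝔥 → Module.End ℂ (WordModule r)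
  | .h x => wordH R φ x
  | .e i => wordE R φ i
  | .f i => wordF i

/-- The relations of the auxiliary algebra do not kill `h_i`, since it acts on the word module of
highest weight `ω_i` and multiplies the empty word by `1`. -/
lemma coroot_notMem_relIdeal (i : Fin r) : (freeH (R.coroot i)) ∉ relIdeal R := by
  let _ : LieRing (Module.End ℂ (WordModule r)) := LieRing.ofAssociativeRing
  let _ : LieAlgebra ℂ (Module.End ℂ (WordModule r)) := LieAlgebra.ofAssociativeAlgebra
  let φ := R.ω i
  let Φ : FreeLieAlgebra ℂ (Gen r 𝔥) →ₗ⁅ℂ⁆ Module.End ℂ (WordModule r) :=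
    FreeLieAlgebra.lift ℂ (wordGen R φ)
  have hof : ∀ g, Φ (FreeLieAlgebra.of ℂ g) = wordGen R φ g := fun g =>
    FreeLieAlgebra.lift_of_apply _ g
  have hker : relIdeal R ≤ Φ.ker := by
    refine LieSubmodule.lieSpan_le.2 ?_
    rintro _ ((((⟨a, x, y, rfl⟩ | ⟨x, y, rfl⟩) | ⟨i, j, rfl⟩) | ⟨x, i, rfl⟩) | ⟨x, i, rfl⟩)
    all_goals
      simp only [SetLike.mem_coe, LieHom.mem_ker, map_sub, map_add, map_smul, LieHom.map_lie, hof,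
        wordGen, Ring.lie_def]
      refine wordEnd_ext fun w => ?_
    · simp only [LinearMap.sub_apply, LinearMap.add_apply, LinearMap.smul_apply, wordH_single,
        smul_smul, ← add_smul, ← sub_smul, map_add, map_smul, smul_eq_mul, LinearMap.zero_apply]
      rw [smul_eq_zero]
      left
      ring
    · simp only [LinearMap.sub_apply, Module.End.mul_apply, wordH_single, map_smul, smul_smul,
        LinearMap.zero_apply, mul_comm, sub_self]
    · rw [LinearMap.sub_apply, LinearMap.sub_apply, Module.End.mul_apply, Module.End.mul_apply,
        wordE_wordF]
      split_ifs <;> simp [hof, wordGen]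
    · rw [LinearMap.sub_apply, LinearMap.sub_apply, Module.End.mul_apply, Module.End.mul_apply,
        LinearMap.smul_apply, wordH_single, map_smul, wordE_single, wordH_wordEVec,
        ← sub_smul, ← sub_smul, LinearMap.zero_apply, smul_eq_zero]
      left
      ring
    · rw [LinearMap.add_apply, LinearMap.sub_apply, Module.End.mul_apply, Module.End.mul_apply,
        LinearMap.smul_apply, wordH_wordF]
      simp
  intro hmem
  have h0 : Φ (freeH (R.coroot i)) = 0 := LieHom.mem_ker.1 (hker hmem)
  have h1 := LinearMap.congr_fun h0 (Finsupp.single [] 1)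
  rw [hof, wordGen, wordH_single] at h1
  have hω : φ (R.coroot i) = 1 := by
    simp [φ, Realization.ω, Realization.coroot]
  have h2 := DFunLike.congr_fun h1 []
  simp [hω, R.weight_zero] at h2

end Verma

lemma auxH_coroot_ne_zero (i : Fin r) : auxH R (R.coroot i) ≠ 0 := fun h =>
  coroot_notMem_relIdeal R i ((quotientMap_eq_zero _ _).1 h)

/-- The maximal ideal meeting `𝔥` trivially does meet `𝔥` trivially. -/
lemma auxH_eq_zero_of_mem_radIdeal {x : 𝔥} (h : auxH R x ∈ radIdeal R) : auxH R x = 0 := by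
  have hle : LieSubmodule.toSubmodule (radIdeal R) ≤ (auxSystem R).nonzeroPart := by
    rw [radIdeal, LieSubmodule.sSup_toSubmodule_eq_iSup]
    exact iSup₂_le fun I hI => (auxSystem R).ideal_le_nonzeroPart I hI
  exact (auxSystem R).H_eq_zero_of_mem_nonzeroPart (hle h)

lemma kmSystem_e_ne_zero (i : Fin r) : (kmSystem R).e i ≠ 0 := by
  intro h
  have h1 := (kmSystem R).lie_e_f i i
  rw [h, zero_lie, if_pos rfl] at h1
  have h2 : auxH R (R.coroot i) ∈ radIdeal R := (quotientMap_eq_zero (radIdeal R) _).1 h1.symm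
  exact auxH_coroot_ne_zero R i (auxH_eq_zero_of_mem_radIdeal R h2)

/-- An element that generates an ideal meeting `𝔥` trivially dies in the Kac-Moody algebra. -/
lemma mem_radIdeal_of_lieSpan {θ : AuxAlgebra R}
    (h : ∀ x, auxH R x ∈ LieSubmodule.lieSpan ℂ (AuxAlgebra R) {θ} → auxH R x = 0) :
    θ ∈ radIdeal R :=
  (le_sSup (show LieSubmodule.lieSpan ℂ (AuxAlgebra R) {θ} ∈
    {I : LieIdeal ℂ (AuxAlgebra R) | ∀ x : 𝔥, auxH R x ∈ I → auxH R x = 0} from h))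
    (LieSubmodule.subset_lieSpan rfl)

lemma serre_mem_radIdeal {i j : Fin r} (hij : i ≠ j) : (auxSystem R).serre i j ∈ radIdeal R :=
  mem_radIdeal_of_lieSpan R fun _ hx => (auxSystem R).H_eq_zero_of_mem_lieSpan
    ((auxSystem R).ad_pow_mem_wtSpace i ((auxSystem R).e_mem_wtSpace j) _)
    ((auxSystem R).ad_pow_mem_nPos i ((auxSystem R).e_mem j) _)
    (fun k => (auxSystem R).lie_f_serre hij k) hx

lemma swap_serre_mem_radIdeal {i j : Fin r} (hij : i ≠ j) :
    (auxSystem R).swap.serre i j ∈ radIdeal R :=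
  mem_radIdeal_of_lieSpan R fun x hx => by
    have := (auxSystem R).swap.H_eq_zero_of_mem_lieSpan
      ((auxSystem R).swap.ad_pow_mem_wtSpace i ((auxSystem R).swap.e_mem_wtSpace j) _)
      ((auxSystem R).swap.ad_pow_mem_nPos i ((auxSystem R).swap.e_mem j) _)
      (fun k => (auxSystem R).swap.lie_f_serre hij k) (x := x)
      (by rw [ChevalleySystem.swap_H]; exact neg_mem hx)
    simpa [auxSystem_H] using this

lemma map_ad_pow {L L' : Type*} [LieRing L] [LieAlgebra ℂ L] [LieRing L'] [LieAlgebra ℂ L']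
    (φ : L →ₗ⁅ℂ⁆ L') (x y : L) (n : ℕ) :
    φ (((LieAlgebra.ad ℂ L x) ^ n) y) = ((LieAlgebra.ad ℂ L' (φ x)) ^ n) (φ y) := by
  induction n with
  | zero => simp
  | succ n ih =>
    rw [pow_succ', pow_succ', Module.End.mul_apply, Module.End.mul_apply, LieAlgebra.ad_apply,
      LieHom.map_lie, ih, LieAlgebra.ad_apply]

lemma kmSystem_serre {i j : Fin r} (hij : i ≠ j) : (kmSystem R).serre i j = 0 := by
  have h := (quotientMap_eq_zero (radIdeal R) _).2 (serre_mem_radIdeal R hij)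
  rw [ChevalleySystem.serre, map_ad_pow] at h
  exact h

lemma kmSystem_swap_serre {i j : Fin r} (hij : i ≠ j) : (kmSystem R).swap.serre i j = 0 := by
  have h := (quotientMap_eq_zero (radIdeal R) _).2 (swap_serre_mem_radIdeal R hij)
  rw [ChevalleySystem.serre, map_ad_pow] at h
  exact h

/-- The root multiplicities are invariant under the Weyl group. -/
theorem rootMult_simpleReflection (i : Fin r) (β : RootLattice r) :
    rootMult R (simpleReflection C i β) = rootMult R β :=
  (kmSystem R).finrank_wtSpace_reflection
    (fun i y => (kmSystem R).exists_ad_e_pow_eq_zero (fun _ _ h => kmSystem_serre R h) i y)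
    (fun i y => (kmSystem R).swap.exists_ad_e_pow_eq_zero
      (fun _ _ h => kmSystem_swap_serre R h) i y) i β

/-- The multiplicity of a positive root is at most the number of words of that content. -/
theorem rootMult_le {β : RootLattice r} (h0 : β ≠ 0) (hβ : 0 ≤ β) :
    rootMult R β ≤ {w : List (Fin r) | content w = β}.ncard :=
  (kmSystem R).finrank_wtSpace_le h0 hβ

theorem rootMult_simpleRoot (i : Fin r) : rootMult R (simpleRoot i) = 1 := by
  rw [rootMult, rootSpace_eq, ChevalleySystem.wtSpace_simpleRoot]
  exact finrank_span_singleton (kmSystem_e_ne_zero R i)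

theorem rootMult_nsmul_simpleRoot (i : Fin r) {k : ℕ} (hk : 2 ≤ k) :
    rootMult R (k • simpleRoot i) = 0 := by
  rw [rootMult, rootSpace_eq, ChevalleySystem.wtSpace_nsmul_simpleRoot _ i hk]
  exact finrank_bot ℂ _

theorem nonneg_or_nonpos_of_rootMult {β : RootLattice r} (h : rootMult R β ≠ 0) :
    0 ≤ β ∨ β ≤ 0 := by
  refine (kmSystem R).nonneg_or_nonpos_of_wtSpace fun h0 => h ?_
  rw [rootMult, rootSpace_eq, h0]
  exact finrank_bot ℂ _

end

section

variable {r : ℕ} {C : CartanDatum r} {𝔥 : Type*} [AddCommGroup 𝔥] [Module ℂ 𝔥]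

/-! ### Inversion sets in the Weyl group -/

lemma simpleReflection_involutive (i : Fin r) (β : RootLattice r) :
    simpleReflection C i (simpleReflection C i β) = β :=
  Module.involutive_reflection (pairing_simpleRoot C i) β

lemma simpleReflection_mul_self (i : Fin r) :
    simpleReflection C i * simpleReflection C i = 1 :=
  LinearEquiv.ext fun β => simpleReflection_involutive i β

lemma simpleReflection_inv (i : Fin r) : (simpleReflection C i)⁻¹ = simpleReflection C i :=
  inv_eq_of_mul_eq_one_left (simpleReflection_mul_self i)

lemma simpleReflection_simpleRoot (i : Fin r) :
    simpleReflection C i (simpleRoot i) = -simpleRoot i :=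
  Module.reflection_apply_self (pairing_simpleRoot C i)

lemma simpleReflection_apply_of_ne {i j : Fin r} (h : j ≠ i) (β : RootLattice r) :
    simpleReflection C i β j = β j := by
  simp [simpleReflection_apply, simpleRoot, h]

/-- The element of the Weyl group with a given word. -/
def wordProd (C : CartanDatum r) (L : List (Fin r)) : RootLattice r ≃ₗ[ℤ] RootLattice r :=
  (L.map (simpleReflection C)).prod

@[simp] lemma wordProd_nil : wordProd C [] = 1 := rfl

@[simp] lemma wordProd_cons (i : Fin r) (L : List (Fin r)) :
    wordProd C (i :: L) = simpleReflection C i * wordProd C L := by simp [wordProd]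

lemma wordProd_append (L L' : List (Fin r)) :
    wordProd C (L ++ L') = wordProd C L * wordProd C L' := by simp [wordProd]

lemma wordProd_reverse (L : List (Fin r)) : wordProd C L.reverse = (wordProd C L)⁻¹ := by
  induction L with
  | nil => simp
  | cons i L ih => simp [wordProd_append, ih, simpleReflection_inv]

lemma wordProd_mem (L : List (Fin r)) : wordProd C L ∈ weylGroup C := by
  induction L with
  | nil => exact one_mem _
  | cons i L ih =>
    rw [wordProd_cons]
    exact mul_mem (Subgroup.subset_closure ⟨i, rfl⟩) ih

lemma exists_word {w : RootLattice r ≃ₗ[ℤ] RootLattice r} (hw : w ∈ weylGroup C) :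
    ∃ L, wordProd C L = w := by
  induction hw using Subgroup.closure_induction with
  | mem x hx => obtain ⟨i, rfl⟩ := hx; exact ⟨[i], by simp⟩
  | one => exact ⟨[], rfl⟩
  | mul x y _ _ hx hy =>
    obtain ⟨L, rfl⟩ := hx
    obtain ⟨L', rfl⟩ := hy
    exact ⟨L ++ L', wordProd_append L L'⟩
  | inv x _ hx =>
    obtain ⟨L, rfl⟩ := hx
    exact ⟨L.reverse, wordProd_reverse L⟩

lemma form_sub_left (β β' γ : RootLattice r) : form C (β - β') γ = form C β γ - form C β' γ := by
  simp only [form, Pi.sub_apply, Int.cast_sub, sub_mul, Finset.sum_sub_distrib]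

lemma form_smul_left (k : ℤ) (β γ : RootLattice r) : form C (k • β) γ = k * form C β γ := by
  simp only [form, Pi.smul_apply, smul_eq_mul, Int.cast_mul, Finset.mul_sum, mul_assoc]

lemma form_comm (β γ : RootLattice r) : form C β γ = form C γ β := by
  rw [form, form, Finset.sum_comm]
  refine Finset.sum_congr rfl fun i _ => Finset.sum_congr rfl fun j _ => ?_
  have h : C.B j i = C.B i j := congrFun (congrFun C.symm i) j
  rw [h]
  ring

lemma form_simpleRoot_left (i : Fin r) (γ : RootLattice r) :
    C.ε i * form C (simpleRoot i) γ = pairing C i γ := by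
  have h1 : form C (simpleRoot i) γ = ∑ j, (γ j : ℚ) * C.B i j := by
    rw [form, Finset.sum_eq_single i]
    · simp [simpleRoot]
    · intro j _ hj
      simp [simpleRoot, hj]
    · simp
  have h2 : ∀ j, (C.A i j : ℚ) = C.ε i * C.B i j := fun j => by
    have := congrFun (congrFun C.decomp i) j
    simpa [Matrix.diagonal_mul] using this
  rw [h1, Finset.mul_sum]
  simp only [pairing, LinearMap.sum_apply, LinearMap.smul_apply, LinearMap.proj_apply, smul_eq_mul,
    Int.cast_sum, Int.cast_mul]
  refine Finset.sum_congr rfl fun j _ => ?_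
  rw [h2]
  ring

lemma form_simpleReflection (i : Fin r) (β γ : RootLattice r) :
    form C (simpleReflection C i β) (simpleReflection C i γ) = form C β γ := by
  have hε := (C.ε_pos i).ne'
  have h1 := form_simpleRoot_left (C := C) i β
  have h2 := form_simpleRoot_left (C := C) i γ
  have h3 := form_simpleRoot_left (C := C) i (simpleRoot i)
  rw [pairing_simpleRoot] at h3
  rw [simpleReflection_apply, simpleReflection_apply, form_sub_left, form_smul_left,
    form_comm β, form_comm (simpleRoot i), form_sub_left, form_sub_left, form_smul_left,
    form_smul_left, form_comm γ β, form_comm γ (simpleRoot i)]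
  have h1' : form C (simpleRoot i) β = pairing C i β / C.ε i := by rw [← h1]; field_simp
  have h2' : form C (simpleRoot i) γ = pairing C i γ / C.ε i := by rw [← h2]; field_simp
  have h3' : form C (simpleRoot i) (simpleRoot i) = 2 / C.ε i := by
    rw [eq_div_iff hε, mul_comm, h3]; norm_num
  rw [h1', h2', h3']
  ring

lemma form_wordProd (L : List (Fin r)) (β γ : RootLattice r) :
    form C (wordProd C L β) (wordProd C L γ) = form C β γ := by
  induction L with
  | nil => rfl
  | cons i L ih =>
    rw [wordProd_cons, LinearEquiv.mul_apply, LinearEquiv.mul_apply, form_simpleReflection, ih]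

/-- If `w α_i = α_j` then `σ_j w = w σ_i`, since `w` preserves the form and so carries the coroot
of `α_i` to that of `α_j`. -/
lemma simpleReflection_eq_conj {L : List (Fin r)} {i j : Fin r}
    (h : wordProd C L (simpleRoot i) = simpleRoot j) :
    simpleReflection C j * wordProd C L = wordProd C L * simpleReflection C i := by
  ext1 β
  have hpair : pairing C j (wordProd C L β) = pairing C i β := by
    have h1 := form_simpleRoot_left (C := C) j (wordProd C L β)
    have h2 := form_simpleRoot_left (C := C) i β
    have h3 := form_simpleRoot_left (C := C) j (simpleRoot j)
    have h4 := form_simpleRoot_left (C := C) i (simpleRoot i)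
    rw [← h, form_wordProd] at h1
    rw [← h, form_wordProd, h, pairing_simpleRoot] at h3
    rw [pairing_simpleRoot] at h4
    have h5 : form C (simpleRoot i) (simpleRoot i) ≠ 0 := by
      intro h0
      rw [h0, mul_zero] at h4
      norm_num at h4
    have h6 : C.ε i = C.ε j := mul_right_cancel₀ h5 (h4.trans h3.symm)
    rw [← h6, h2] at h1
    exact_mod_cast h1.symm
  simp only [LinearEquiv.mul_apply, simpleReflection_apply]
  rw [hpair, map_sub, map_smul, h]

/-- A real root of the root lattice, presented through a word. -/
lemma isRealRoot_iff {δ : RootLattice r} :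
    IsRealRoot C δ ↔ ∃ L i, δ = wordProd C L (simpleRoot i) := by
  constructor
  · rintro ⟨w, hw, i, rfl⟩
    obtain ⟨L, rfl⟩ := exists_word hw
    exact ⟨L, i, rfl⟩
  · rintro ⟨L, i, rfl⟩
    exact ⟨_, wordProd_mem L, i, rfl⟩

lemma isRealRoot_simpleRoot (i : Fin r) : IsRealRoot C (simpleRoot i) :=
  ⟨1, one_mem _, i, rfl⟩

lemma isRealRoot_map {w : RootLattice r ≃ₗ[ℤ] RootLattice r} (hw : w ∈ weylGroup C)
    {δ : RootLattice r} (h : IsRealRoot C δ) : IsRealRoot C (w δ) := by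
  obtain ⟨v, hv, i, rfl⟩ := h
  exact ⟨w * v, mul_mem hw hv, i, rfl⟩

lemma isRealRoot_simpleReflection_iff {i : Fin r} {δ : RootLattice r} :
    IsRealRoot C (simpleReflection C i δ) ↔ IsRealRoot C δ := by
  have hmem : simpleReflection C i ∈ weylGroup C := Subgroup.subset_closure ⟨i, rfl⟩
  refine ⟨fun h => ?_, isRealRoot_map hmem⟩
  have := isRealRoot_map hmem h
  rwa [simpleReflection_involutive] at this

lemma mRoot_simpleReflection (n : ℕ) (i : Fin r) (δ : RootLattice r) :
    mRoot C n (simpleReflection C i δ) = mRoot C n δ := by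
  classical
  rw [mRoot, mRoot]
  simp only [isRealRoot_simpleReflection_iff, form_simpleReflection]

lemma mRoot_wordProd (n : ℕ) (L : List (Fin r)) (δ : RootLattice r) :
    mRoot C n (wordProd C L δ) = mRoot C n δ := by
  induction L with
  | nil => rfl
  | cons i L ih => rw [wordProd_cons, LinearEquiv.mul_apply, mRoot_simpleReflection, ih]

lemma mRoot_pos {n : ℕ} (hn : 1 ≤ n) (β : RootLattice r) : 1 ≤ mRoot C n β := by
  rw [mRoot]
  split_ifs
  · exact Nat.div_pos (Nat.le_of_dvd hn (by exact_mod_cast Int.gcd_dvd_left (n : ℤ) _))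
      (Int.gcd_pos_of_ne_zero_left _ (by omega))
  · exact hn

section Roots

variable (R : Realization C 𝔥)

lemma rootMult_wordProd (L : List (Fin r)) (β : RootLattice r) :
    rootMult R (wordProd C L β) = rootMult R β := by
  induction L with
  | nil => rfl
  | cons i L ih => rw [wordProd_cons, LinearEquiv.mul_apply, rootMult_simpleReflection, ih]

lemma rootMult_of_isRealRoot {δ : RootLattice r} (h : IsRealRoot C δ) : rootMult R δ = 1 := by
  obtain ⟨L, i, rfl⟩ := isRealRoot_iff.1 h
  rw [rootMult_wordProd, rootMult_simpleRoot]

lemma simpleRoot_nonneg (i : Fin r) : (0 : RootLattice r) ≤ simpleRoot i := by simp [simpleRoot]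

lemma simpleRoot_ne_zero (i : Fin r) : (simpleRoot i : RootLattice r) ≠ 0 := by simp [simpleRoot]

lemma IsRealRoot.ne_zero {δ : RootLattice r} (h : IsRealRoot C δ) : δ ≠ 0 := by
  obtain ⟨w, _, i, rfl⟩ := h
  simpa using simpleRoot_ne_zero i

include R in
lemma IsRealRoot.nonneg_or_nonpos {δ : RootLattice r} (h : IsRealRoot C δ) : 0 ≤ δ ∨ δ ≤ 0 :=
  nonneg_or_nonpos_of_rootMult R (by rw [rootMult_of_isRealRoot R h]; exact one_ne_zero)

/-- A simple reflection permutes the positive roots other than its simple root. -/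
lemma simpleReflection_nonneg {β : RootLattice r} (hm : rootMult R β ≠ 0) (hβ : 0 ≤ β)
    (h0 : β ≠ 0) {i : Fin r} (hi : β ≠ simpleRoot i) : 0 ≤ simpleReflection C i β := by
  obtain ⟨j, hj, hpos⟩ : ∃ j, j ≠ i ∧ 0 < β j := by
    by_contra! hcon
    have hβi : β = (β i).toNat • simpleRoot i := by
      ext j
      by_cases h : j = i
      · subst h
        have := hβ j
        simp [simpleRoot] at this ⊢
        omega
      · have := hβ j
        have := hcon j h
        simp [simpleRoot, h] at *
        omega
    rcases Nat.lt_or_ge (β i).toNat 2 with h | h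
    · interval_cases h2 : (β i).toNat
      · exact h0 (by simpa using hβi)
      · exact hi (by simpa using hβi)
    · rw [hβi, rootMult_nsmul_simpleRoot R i h] at hm
      exact hm rfl
  rcases nonneg_or_nonpos_of_rootMult R (β := simpleReflection C i β)
    (by rwa [rootMult_simpleReflection]) with h | h
  · exact h
  · have := h j
    rw [simpleReflection_apply_of_ne hj] at this
    exact absurd this (not_le.2 hpos)

/-- The sequence of inversions of a word `i_1 ⋯ i_k`: the roots
`σ_{i_k} ⋯ σ_{i_{j+1}} α_{i_j}`. -/
def invRoots (C : CartanDatum r) : List (Fin r) → List (RootLattice r)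
  | [] => []
  | i :: L => (wordProd C L)⁻¹ (simpleRoot i) :: invRoots C L

lemma isRealRoot_of_mem_invRoots {L : List (Fin r)} {δ : RootLattice r} (h : δ ∈ invRoots C L) :
    IsRealRoot C δ := by
  induction L with
  | nil => simp [invRoots] at h
  | cons i L ih =>
    rw [invRoots, List.mem_cons] at h
    rcases h with rfl | h
    · exact ⟨_, inv_mem (wordProd_mem L), i, rfl⟩
    · exact ih h

lemma mem_invRoots_iff {L : List (Fin r)} {δ : RootLattice r} :
    δ ∈ invRoots C L ↔
      ∃ L₁ i L₂, L = L₁ ++ i :: L₂ ∧ wordProd C L₂ δ = simpleRoot i := by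
  induction L with
  | nil => simp [invRoots]
  | cons j L ih =>
    rw [invRoots, List.mem_cons, ih]
    constructor
    · rintro (rfl | ⟨L₁, i, L₂, rfl, h⟩)
      · exact ⟨[], j, L, rfl, by rw [← LinearEquiv.mul_apply, mul_inv_cancel]; rfl⟩
      · exact ⟨j :: L₁, i, L₂, rfl, h⟩
    · rintro ⟨L₁, i, L₂, hL, h⟩
      rcases L₁ with _ | ⟨k, L₁⟩
      · obtain ⟨rfl, rfl⟩ := List.cons.inj hL
        left
        rw [← h, ← LinearEquiv.mul_apply, inv_mul_cancel]
        rfl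
      · obtain ⟨rfl, rfl⟩ := List.cons.inj hL
        exact Or.inr ⟨L₁, i, L₂, rfl, h⟩

include R in
/-- A positive real root that is made negative by a word is an inversion of the word: the sign
changes at some letter, and a simple reflection only changes the sign of its own simple root. -/
lemma mem_invRoots_of_nonpos {δ : RootLattice r} (hδ : IsRealRoot C δ) (hpos : 0 ≤ δ)
    {L : List (Fin r)} (hneg : wordProd C L δ ≤ 0) : δ ∈ invRoots C L := by
  induction L with
  | nil => exact absurd (le_antisymm hneg hpos) hδ.ne_zero
  | cons i L ih =>
    have hr : IsRealRoot C (wordProd C L δ) := isRealRoot_map (wordProd_mem L) hδ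
    rw [invRoots, List.mem_cons]
    rcases hr.nonneg_or_nonpos R with h | h
    · left
      by_contra hne
      have h1 : wordProd C L δ ≠ simpleRoot i := by
        intro h2
        apply hne
        rw [← h2, ← LinearEquiv.mul_apply, inv_mul_cancel]
        rfl
      have h2 := simpleReflection_nonneg R
        (by rw [rootMult_of_isRealRoot R hr]; exact one_ne_zero) h hr.ne_zero h1
      rw [wordProd_cons, LinearEquiv.mul_apply] at hneg
      have h3 := le_antisymm hneg h2
      exact hr.ne_zero (by simpa using h3)
    · exact Or.inr (ih h)

/-- A word of minimal length among the words of the same element. -/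
def IsReduced (C : CartanDatum r) (L : List (Fin r)) : Prop :=
  ∀ L', wordProd C L' = wordProd C L → L.length ≤ L'.length

lemma IsReduced.of_append_right {L₁ L₂ : List (Fin r)} (h : IsReduced C (L₁ ++ L₂)) :
    IsReduced C L₂ := fun L' h' => by
  have := h (L₁ ++ L') (by rw [wordProd_append, wordProd_append, h'])
  simpa using this

include R in
/-- The exchange property: if `α_i` becomes negative under `L₁`, then `L₁ i` is not reduced. -/
lemma exists_shorter_of_nonpos {L₁ : List (Fin r)} {i : Fin r}
    (h : wordProd C L₁ (simpleRoot i) ≤ 0) :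
    ∃ L', wordProd C L' = wordProd C (L₁ ++ [i]) ∧ L'.length < L₁.length := by
  have hmem := mem_invRoots_of_nonpos R (isRealRoot_simpleRoot i) (simpleRoot_nonneg i) h
  obtain ⟨A, j, B, rfl, hB⟩ := mem_invRoots_iff.1 hmem
  refine ⟨A ++ B, ?_, by simp⟩
  have hc := simpleReflection_eq_conj hB
  rw [List.append_assoc, wordProd_append, wordProd_append, List.cons_append, wordProd_cons,
    wordProd_append, ← mul_assoc (simpleReflection C j), hc]
  simp [mul_assoc, simpleReflection_mul_self]

include R in
lemma IsReduced.invRoots_nonneg {L : List (Fin r)} (hL : IsReduced C L) {δ : RootLattice r}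
    (hδ : δ ∈ invRoots C L) : 0 ≤ δ := by
  obtain ⟨L₁, i, L₂, rfl, h⟩ := mem_invRoots_iff.1 hδ
  have hδ' : δ = wordProd C L₂.reverse (simpleRoot i) := by
    rw [wordProd_reverse, ← h, ← LinearEquiv.mul_apply, inv_mul_cancel]
    rfl
  rcases (isRealRoot_of_mem_invRoots hδ).nonneg_or_nonpos R with h0 | h0
  · exact h0
  · exfalso
    rw [hδ'] at h0
    obtain ⟨L', hL', hlen⟩ := exists_shorter_of_nonpos R h0
    have h1 : wordProd C (L₁ ++ L'.reverse) = wordProd C (L₁ ++ i :: L₂) := by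
      rw [wordProd_append, wordProd_append, wordProd_reverse, hL', wordProd_append,
        wordProd_reverse, mul_inv_rev, inv_inv, wordProd_cons, wordProd_cons, wordProd_nil, mul_one,
        simpleReflection_inv]
    have := hL _ h1
    simp at this hlen
    omega

include R in
lemma IsReduced.wordProd_nonpos {L : List (Fin r)} (hL : IsReduced C L) {δ : RootLattice r}
    (hδ : δ ∈ invRoots C L) : wordProd C L δ ≤ 0 := by
  obtain ⟨L₁, i, L₂, rfl, h⟩ := mem_invRoots_iff.1 hδ
  rw [wordProd_append, wordProd_cons, LinearEquiv.mul_apply, LinearEquiv.mul_apply, h,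
    simpleReflection_simpleRoot, map_neg, neg_nonpos]
  rcases (isRealRoot_map (wordProd_mem L₁) (isRealRoot_simpleRoot i)).nonneg_or_nonpos R with
    h0 | h0
  · exact h0
  · exfalso
    obtain ⟨L', hL', hlen⟩ := exists_shorter_of_nonpos R h0
    have h1 : wordProd C (L' ++ L₂) = wordProd C (L₁ ++ i :: L₂) := by
      rw [wordProd_append, hL']
      simp [wordProd_append, mul_assoc]
    have := hL _ h1
    simp at this
    omega

include R in
lemma IsReduced.nodup_invRoots {L : List (Fin r)} (hL : IsReduced C L) :
    (invRoots C L).Nodup := by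
  induction L with
  | nil => simp [invRoots]
  | cons i L ih =>
    have hL' : IsReduced C L := IsReduced.of_append_right (L₁ := [i]) hL
    rw [invRoots, List.nodup_cons]
    refine ⟨fun hmem => ?_, ih hL'⟩
    have h1 := hL'.wordProd_nonpos R hmem
    rw [← LinearEquiv.mul_apply, mul_inv_cancel] at h1
    exact simpleRoot_ne_zero i (le_antisymm h1 (simpleRoot_nonneg i))

include R in
lemma IsReduced.mem_invRoots_iff_nonpos {L : List (Fin r)} (hL : IsReduced C L)
    {δ : RootLattice r} :
    δ ∈ invRoots C L ↔ IsRealRoot C δ ∧ 0 ≤ δ ∧ wordProd C L δ ≤ 0 :=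
  ⟨fun h => ⟨isRealRoot_of_mem_invRoots h, hL.invRoots_nonneg R h, hL.wordProd_nonpos R h⟩,
    fun h => mem_invRoots_of_nonpos R h.1 h.2.1 h.2.2⟩

lemma exists_isReducedWord (w : weylGroup C) : ∃ L, IsReducedWord C w L := by
  obtain ⟨L, hL⟩ := exists_word w.2
  have hne : {k : ℕ | ∃ L : List (Fin r), wordProd C L = w ∧ L.length = k}.Nonempty :=
    ⟨_, L, hL, rfl⟩
  obtain ⟨L₀, h₀, hlen⟩ := Nat.sInf_mem hne
  refine ⟨L₀, h₀, fun L' h' => ?_⟩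
  rw [hlen]
  exact Nat.sInf_le ⟨L', h', rfl⟩

lemma isReducedWord_reducedWord (w : weylGroup C) : IsReducedWord C w (reducedWord C w) :=
  Classical.epsilon_spec (exists_isReducedWord w)

lemma wordProd_reducedWord (w : weylGroup C) : wordProd C (reducedWord C w) = w :=
  (isReducedWord_reducedWord w).1

lemma isReduced_reducedWord (w : weylGroup C) : IsReduced C (reducedWord C w) := fun L' h =>
  (isReducedWord_reducedWord w).2 L' (h.trans (wordProd_reducedWord w))

include R in
/-- An element of the Weyl group is determined by its set of inversions. -/
lemma invRoots_injective {w w' : weylGroup C}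
    (h : ∀ δ, δ ∈ invRoots C (reducedWord C w) ↔ δ ∈ invRoots C (reducedWord C w')) : w = w' := by
  simp only [(isReduced_reducedWord _).mem_invRoots_iff_nonpos R, wordProd_reducedWord] at h
  -- `v = w w'⁻¹` maps the simple roots to positive roots
  set v : weylGroup C := w * w'⁻¹ with hv
  have hpos : ∀ i, 0 ≤ (v : RootLattice r ≃ₗ[ℤ] RootLattice r) (simpleRoot i) := by
    intro i
    set δ := (w' : RootLattice r ≃ₗ[ℤ] RootLattice r)⁻¹ (simpleRoot i) with hδ
    have hreal : IsRealRoot C δ := isRealRoot_map (inv_mem w'.2) (isRealRoot_simpleRoot i)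
    have hw' : (w' : RootLattice r ≃ₗ[ℤ] RootLattice r) δ = simpleRoot i := by
      rw [hδ, ← LinearEquiv.mul_apply, mul_inv_cancel]
      rfl
    have hvw : (v : RootLattice r ≃ₗ[ℤ] RootLattice r) (simpleRoot i) =
        (w : RootLattice r ≃ₗ[ℤ] RootLattice r) δ := rfl
    have hneg : IsRealRoot C (-δ) := by
      have h1 := isRealRoot_map (inv_mem w'.2)
        (isRealRoot_map (Subgroup.subset_closure ⟨i, rfl⟩ : simpleReflection C i ∈ weylGroup C)
          (isRealRoot_simpleRoot i))
      rwa [simpleReflection_simpleRoot, map_neg] at h1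
    rw [hvw]
    rcases hreal.nonneg_or_nonpos R with h0 | h0
    · rcases (isRealRoot_map w.2 hreal).nonneg_or_nonpos R with h1 | h1
      · exact h1
      · have := ((h δ).1 ⟨hreal, h0, h1⟩).2.2
        rw [hw'] at this
        exact absurd (le_antisymm this (simpleRoot_nonneg i)) (simpleRoot_ne_zero i)
    · have := ((h (-δ)).2 ⟨hneg, neg_nonneg.2 h0, by
        rw [map_neg, hw']; exact neg_nonpos.2 (simpleRoot_nonneg i)⟩).2.2
      rw [map_neg] at this
      exact neg_nonpos.1 this
  have hL := isReduced_reducedWord v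
  have hprod := wordProd_reducedWord v
  rcases List.eq_nil_or_concat (reducedWord C v) with hnil | ⟨L, i, hLi⟩
  · rw [hnil] at hprod
    have : v = 1 := Subtype.ext hprod.symm
    rw [hv] at this
    exact mul_inv_eq_one.1 this
  · exfalso
    have h1 : simpleRoot i ∈ invRoots C (reducedWord C v) :=
      mem_invRoots_iff.2 ⟨L, i, [], by rw [hLi, List.concat_eq_append], rfl⟩
    have h2 := hL.wordProd_nonpos R h1
    rw [hprod] at h2
    have h3 := le_antisymm h2 (hpos i)
    exact simpleRoot_ne_zero i (by simpa using h3)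

end Roots

end

section

variable {r : ℕ} {C : CartanDatum r}

/-! ### Weighted `ℓ¹`-norms of formal distributions -/

/-- The exponential function with values in the extended nonnegative reals. -/
def expE (x : ℝ) : ENNReal := ENNReal.ofReal (Real.exp x)

lemma expE_add (x y : ℝ) : expE (x + y) = expE x * expE y := by
  rw [expE, Real.exp_add, ENNReal.ofReal_mul (Real.exp_pos _).le]; rfl

lemma expE_zero : expE 0 = 1 := by simp [expE]

lemma expE_mono {x y : ℝ} (h : x ≤ y) : expE x ≤ expE y :=
  ENNReal.ofReal_le_ofReal (Real.exp_le_exp.2 h)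

lemma expE_ne_top (x : ℝ) : expE x ≠ ⊤ := ENNReal.ofReal_ne_top

lemma expE_nsmul (k : ℕ) (x : ℝ) : expE (k * x) = expE x ^ k := by
  rw [expE, expE, Real.exp_nat_mul, ENNReal.ofReal_pow (Real.exp_pos _).le]

lemma prod_expE {ι : Type*} (s : Finset ι) (f : ι → ℝ) :
    ∏ k ∈ s, expE (f k) = expE (∑ k ∈ s, f k) := by
  classical
  induction s using Finset.induction_on with
  | empty => simp [expE_zero]
  | insert a s ha ih => rw [Finset.prod_insert ha, Finset.sum_insert ha, expE_add, ih]

lemma expE_log_natCast {q : ℕ} (hq : 0 < q) (k : ℤ) :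
    ‖(q : ℂ) ^ k‖ₑ = expE (k * Real.log q) := by
  have hq' : (0 : ℝ) < q := by exact_mod_cast hq
  rw [← ofReal_norm, expE, norm_zpow, Complex.norm_natCast, mul_comm, Real.exp_mul,
    Real.exp_log hq', Real.rpow_intCast]

/-- The `ℓ¹`-norm of a formal distribution at the point `x^β = exp(-τ(β))`. -/
def distNorm (τ : RootLattice r →+ ℝ) (f : Dist r) : ENNReal := ∑' β, ‖f β‖ₑ * expE (-τ β)

variable (τ : RootLattice r →+ ℝ)

lemma expE_neg_add (β γ : RootLattice r) : expE (-τ (β + γ)) = expE (-τ β) * expE (-τ γ) := by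
  rw [map_add, neg_add, expE_add]

lemma distNorm_mono (β : RootLattice r) (a : ℂ) :
    distNorm τ (mono β a) = ‖a‖ₑ * expE (-τ β) := by
  rw [distNorm, tsum_eq_single β]
  · simp [mono]
  · intro γ hγ
    simp [mono, hγ]

lemma distNorm_add_le (f g : Dist r) : distNorm τ (f + g) ≤ distNorm τ f + distNorm τ g := by
  rw [distNorm, distNorm, distNorm, ← ENNReal.tsum_add]
  refine ENNReal.tsum_le_tsum fun β => ?_
  rw [← add_mul]
  exact mul_le_mul_left (enorm_add_le _ _) _

lemma distNorm_smul (c : ℂ) (f : Dist r) : distNorm τ (c • f) = ‖c‖ₑ * distNorm τ f := by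
  rw [distNorm, distNorm, ← ENNReal.tsum_mul_left]
  refine tsum_congr fun β => ?_
  rw [Pi.smul_apply, smul_eq_mul, enorm_mul, mul_assoc]

lemma distNorm_tsum_le {ι : Type*} (F : ι → Dist r) :
    distNorm τ (fun β => ∑' k, F k β) ≤ ∑' k, distNorm τ (F k) := by
  simp only [distNorm]
  rw [ENNReal.tsum_comm]
  refine ENNReal.tsum_le_tsum fun β => ?_
  rw [ENNReal.tsum_mul_right]
  exact mul_le_mul_left enorm_tsum_le_tsum_enorm _

lemma distNorm_mul_le (f g : Dist r) :
    distNorm τ (Dist.mul f g) ≤ distNorm τ f * distNorm τ g := by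
  refine (distNorm_tsum_le τ fun β γ => f β * g (γ - β)).trans ?_
  rw [distNorm, ← ENNReal.tsum_mul_right]
  refine ENNReal.tsum_le_tsum fun β => ?_
  rw [distNorm, distNorm, ← (Equiv.addRight β).tsum_eq, ← ENNReal.tsum_mul_left]
  refine ENNReal.tsum_le_tsum fun γ => le_of_eq ?_
  simp only [Equiv.coe_addRight, add_sub_cancel_right, expE_neg_add, enorm_mul]
  ring

/-- The weight `τ + log q · d`. The point `x^β = exp(-qShift q τ β)` is the one at which
`q x_i = exp(-τ(α_i))`. -/
def qShift (q : ℕ) (τ : RootLattice r →+ ℝ) : RootLattice r →+ ℝ where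
  toFun β := τ β + depth β * Real.log q
  map_zero' := by simp [depth]
  map_add' β γ := by
    simp only [map_add, depth, Pi.add_apply, Finset.sum_add_distrib, Int.cast_add]
    ring

lemma qShift_apply (q : ℕ) (β : RootLattice r) :
    qShift q τ β = τ β + depth β * Real.log q := rfl

lemma depth_simpleRoot (i : Fin r) : depth (simpleRoot i) = 1 := by
  simp [depth, simpleRoot]

lemma depth_add (β γ : RootLattice r) : depth (β + γ) = depth β + depth γ := by
  simp [depth, Finset.sum_add_distrib]

lemma depth_zsmul (k : ℤ) (β : RootLattice r) : depth (k • β) = k * depth β := by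
  simp [depth, Finset.mul_sum]

/-- The weight `τ ∘ w⁻¹`, which describes the point translated by `w`. -/
def twist (τ : RootLattice r →+ ℝ) (w : RootLattice r ≃ₗ[ℤ] RootLattice r) :
    RootLattice r →+ ℝ :=
  τ.comp ((w⁻¹ : RootLattice r ≃ₗ[ℤ] RootLattice r) : RootLattice r →+ RootLattice r)

lemma twist_apply (w : RootLattice r ≃ₗ[ℤ] RootLattice r) (β : RootLattice r) :
    twist τ w β = τ (w⁻¹ β) := rfl

variable {n q : ℕ} {γ : ℤ → ℂ} {l : Fin r → ℕ}

/-- The geometric series in the action of `σ_i` has ratio `q^{-1} (q x_i)^m`, of absolute value at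
most `1/2`. -/
lemma distNorm_geomSeries_le (hn : 1 ≤ n) (hq : 2 ≤ q) {i : Fin r} (hτ : 0 < τ (simpleRoot i)) :
    distNorm (qShift q τ) (geomSeries C n q i) ≤ 2 := by
  have hm : 1 ≤ mSimple C n i := mRoot_pos hn _
  set m := mSimple C n i with hmdef
  refine (distNorm_tsum_le _ fun k => mono (((m * k : ℕ) : ℤ) • simpleRoot i)
    (((q : ℂ) ^ (m - 1)) ^ k)).trans ?_
  have hlog : 0 < Real.log q := Real.log_pos (by exact_mod_cast hq)
  have hterm : ∀ k : ℕ, distNorm (qShift q τ) (mono (((m * k : ℕ) : ℤ) • simpleRoot i)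
      (((q : ℂ) ^ (m - 1)) ^ k)) ≤ (2⁻¹ : ENNReal) ^ k := by
    intro k
    have h1 : ((q : ℂ) ^ (m - 1)) ^ k = (q : ℂ) ^ (((m - 1) * k : ℕ) : ℤ) := by
      rw [zpow_natCast, pow_mul]
    rw [distNorm_mono, h1, expE_log_natCast (by omega), ← expE_add, qShift_apply, map_zsmul,
      depth_zsmul, depth_simpleRoot]
    have h2 : expE (-Real.log q) ≤ 2⁻¹ := by
      rw [expE, Real.exp_neg, Real.exp_log (by positivity),
        ENNReal.ofReal_inv_of_pos (by positivity), ENNReal.ofReal_natCast]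
      exact ENNReal.inv_le_inv.2 (by exact_mod_cast hq)
    refine le_trans ?_ (pow_le_pow_left' h2 k)
    rw [← expE_nsmul]
    refine expE_mono ?_
    obtain ⟨m', hm'⟩ : ∃ m', m = m' + 1 := ⟨m - 1, by omega⟩
    rw [hm', zsmul_eq_mul]
    push_cast
    have : 0 ≤ ((m' : ℝ) + 1) * k * τ (simpleRoot i) := by positivity
    nlinarith
  refine (ENNReal.tsum_le_tsum hterm).trans ?_
  rw [ENNReal.tsum_geometric, ENNReal.one_sub_inv_two, inv_inv]

lemma floorMul_gt {m : ℕ} (hm : 1 ≤ m) (k : ℤ) : k - m + 1 ≤ floorMul m k := by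
  rw [floorMul]
  have h1 := Int.emod_lt_of_pos k (by omega : (0 : ℤ) < m)
  have h2 := Int.mul_ediv_add_emod k m
  omega

/-- The norm of `x^β |_λ σ_i`. Both terms are supported on exponents `σ_i β + j α_i` with
`j ≥ l_i + 1 - m(α_i)`; the shift by `m(α_i) - 1` costs the exponential, and the constant `6` is
`2 + 2 · 2`, where each summand contains the bound `2` for the geometric series and the second
one a factor `1 - (q x_i)^{-m}`. -/
lemma distNorm_monoAct_le (hn : 1 ≤ n) (hq : 2 ≤ q) (hγ : ∀ k, ‖γ k‖ ≤ 1) {i : Fin r}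
    (hτ : 0 < τ (simpleRoot i)) (β : RootLattice r) :
    distNorm (qShift q τ) (monoAct C n q γ l i β) ≤
      6 * expE ((mSimple C n i - 1) * τ (simpleRoot i)) *
        expE (-qShift q (twist τ (simpleReflection C i)) β) := by
  have hm : 1 ≤ mSimple C n i := mRoot_pos hn _
  have hgeom := distNorm_geomSeries_le (C := C) τ hn hq hτ
  set m := mSimple C n i with hmdef
  set a := τ (simpleRoot i) with ha
  set μ := muFun C l i β with hμ
  have hq0 : 0 < q := by omega
  have hlog : 0 < Real.log q := Real.log_pos (by exact_mod_cast hq)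
  have htw : qShift q (twist τ (simpleReflection C i)) β =
      τ β - pairing C i β * a + depth β * Real.log q := by
    rw [qShift_apply, twist_apply, simpleReflection_inv, simpleReflection_apply, map_sub, map_zsmul,
      zsmul_eq_mul]
  have hμ' : (μ : ℝ) = l i + 1 - pairing C i β := by
    rw [hμ, muFun]; push_cast; ring
  have hla : 0 ≤ (l i : ℝ) * a := by positivity
  have hma : 0 ≤ ((m : ℝ) - 1) * a :=
    mul_nonneg (by rw [sub_nonneg]; exact_mod_cast hm) hτ.le
  have hmono : ∀ k : ℤ, -qShift q τ (k • simpleRoot i) = -k * a - k * Real.log q := by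
    intro k
    rw [qShift_apply, map_zsmul, depth_zsmul, depth_simpleRoot, zsmul_eq_mul]
    push_cast; ring
  have hsub : ‖(1 - 1 / (q : ℂ))‖ₑ ≤ 1 := by
    have h1 : (1 - 1 / (q : ℂ)) = ((1 - 1 / (q : ℝ) : ℝ) : ℂ) := by push_cast; rfl
    rw [h1, ← ofReal_norm, Complex.norm_real]
    refine ENNReal.ofReal_le_one.2 ?_
    rw [Real.norm_eq_abs, abs_le]
    have h2 : 1 / (q : ℝ) ≤ 1 := by
      rw [div_le_one (by positivity)]; exact_mod_cast hq0
    have h3 : 0 ≤ 1 / (q : ℝ) := by positivity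
    constructor <;> linarith
  have hP : distNorm (qShift q τ) (Dist.mul (calP C n q l i β) (mono β 1)) ≤
      2 * (expE ((m - 1) * a) * expE (-qShift q (twist τ (simpleReflection C i)) β)) := by
    refine (distNorm_mul_le _ _ _).trans ?_
    rw [distNorm_mono, enorm_one, one_mul]
    have h1 : distNorm (qShift q τ) (calP C n q l i β) ≤ expE (-floorMul m μ * a) * 2 := by
      refine (distNorm_mul_le _ _ _).trans (mul_le_mul' ?_ hgeom)
      rw [distNorm_mono, enorm_mul, expE_log_natCast hq0, hmono]
      calc _ ≤ expE (floorMul m μ * Real.log q) * 1 *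
              expE (-floorMul m μ * a - floorMul m μ * Real.log q) := by gcongr
        _ = _ := by rw [mul_one, ← expE_add]; congr 1; ring
    calc _ ≤ expE (-floorMul m μ * a) * 2 * expE (-qShift q τ β) := by gcongr
      _ = 2 * expE (-floorMul m μ * a + -qShift q τ β) := by rw [expE_add]; ring
      _ ≤ 2 * expE ((m - 1) * a + -qShift q (twist τ (simpleReflection C i)) β) := by
        refine mul_le_mul' le_rfl (expE_mono ?_)
        rw [htw, qShift_apply]
        have h2 : ((μ : ℝ) - m + 1) ≤ floorMul m μ := by exact_mod_cast floorMul_gt hm μ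
        nlinarith
      _ = _ := by rw [expE_add]
  have hQ : distNorm (qShift q τ) (Dist.mul (calQ C n q γ l i β) (mono (dotAction C l i β) 1)) ≤
      4 * (expE ((m - 1) * a) * expE (-qShift q (twist τ (simpleReflection C i)) β)) := by
    refine (distNorm_mul_le _ _ _).trans ?_
    rw [distNorm_mono, enorm_one, one_mul, dotAction, expE_neg_add, hmono]
    have hsm : distNorm (qShift q τ)
        (mono 0 1 - mono (-(m : ℤ) • simpleRoot i) ((q : ℂ) ^ (-(m : ℤ)))) ≤ 2 * expE (m * a) := by
      have h1 : (mono 0 1 - mono (-(m : ℤ) • simpleRoot i) ((q : ℂ) ^ (-(m : ℤ))) : Dist r) =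
          mono 0 1 + (-1 : ℂ) • mono (-(m : ℤ) • simpleRoot i) ((q : ℂ) ^ (-(m : ℤ))) := by
        rw [neg_one_smul, sub_eq_add_neg]
      rw [h1]
      refine (distNorm_add_le _ _ _).trans ?_
      rw [distNorm_smul, distNorm_mono, distNorm_mono, expE_log_natCast hq0, hmono, ← expE_add,
        map_zero, neg_zero, expE_zero, enorm_one, enorm_neg, enorm_one, one_mul, one_mul, two_mul]
      refine add_le_add ?_ (expE_mono (le_of_eq ?_))
      · rw [← expE_zero]; exact expE_mono (by positivity)
      · push_cast; ring
    have h1 : distNorm (qShift q τ) (calQ C n q γ l i β) ≤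
        expE (μ * Real.log q) * (2 * expE (m * a)) * 2 := by
      refine (distNorm_mul_le _ _ _).trans (mul_le_mul' ?_ hgeom)
      rw [distNorm_smul, enorm_mul, expE_log_natCast hq0]
      refine mul_le_mul' ?_ hsm
      have h2 : ‖γ (C.b i * muFun C l i β)‖ₑ ≤ 1 := by
        rw [← ofReal_norm]; exact ENNReal.ofReal_le_one.2 (hγ _)
      calc _ ≤ 1 * expE (μ * Real.log q) := by gcongr
        _ = _ := one_mul _
    calc _ ≤ expE (μ * Real.log q) * (2 * expE (m * a)) * 2 *
            (expE (-qShift q τ β) * expE (-μ * a - μ * Real.log q)) := by gcongr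
      _ = 4 * expE (μ * Real.log q + m * a + -qShift q τ β + (-μ * a - μ * Real.log q)) := by
        rw [expE_add, expE_add, expE_add, show (4 : ENNReal) = 2 * 2 by norm_num]; ring
      _ ≤ 4 * expE ((m - 1) * a + -qShift q (twist τ (simpleReflection C i)) β) := by
        refine mul_le_mul' le_rfl (expE_mono ?_)
        rw [htw, qShift_apply, hμ']
        nlinarith
      _ = _ := by rw [expE_add]
  calc _ ≤ 2 * (expE ((m - 1) * a) * expE (-qShift q (twist τ (simpleReflection C i)) β)) +
        4 * (expE ((m - 1) * a) * expE (-qShift q (twist τ (simpleReflection C i)) β)) :=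
        (distNorm_add_le _ _ _).trans (add_le_add hP hQ)
    _ = _ := by rw [← add_mul, mul_assoc]; norm_num

lemma distNorm_distAct_le (hn : 1 ≤ n) (hq : 2 ≤ q) (hγ : ∀ k, ‖γ k‖ ≤ 1) {i : Fin r}
    (hτ : 0 < τ (simpleRoot i)) (f : Dist r) :
    distNorm (qShift q τ) (distAct C n q γ l i f) ≤
      6 * expE ((mSimple C n i - 1) * τ (simpleRoot i)) *
        distNorm (qShift q (twist τ (simpleReflection C i))) f := by
  refine (distNorm_tsum_le _ fun β δ => f β * monoAct C n q γ l i β δ).trans ?_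
  conv_rhs => rw [distNorm, ← ENNReal.tsum_mul_left]
  refine ENNReal.tsum_le_tsum fun β => ?_
  have h : (fun δ => f β * monoAct C n q γ l i β δ) = f β • monoAct C n q γ l i β := rfl
  rw [h, distNorm_smul]
  refine (mul_le_mul' le_rfl (distNorm_monoAct_le τ hn hq hγ hτ β)).trans (le_of_eq ?_)
  ring

/-- The norm of `f |_λ σ_{i_1} ⋯ |_λ σ_{i_k}` at a point where `τ` is positive on all inversions
of the word is controlled by the norm of `f` at the translated point. -/
lemma distNorm_foldl_le (hn : 1 ≤ n) (hq : 2 ≤ q) (hγ : ∀ k, ‖γ k‖ ≤ 1) (L : List (Fin r))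
    (hτ : ∀ δ ∈ invRoots C L, 0 < τ δ) (f : Dist r) :
    distNorm (qShift q τ) (L.foldl (fun g i => distAct C n q γ l i g) f) ≤
      ((invRoots C L).map fun δ => 6 * expE ((mRoot C n δ - 1) * τ δ)).prod *
        distNorm (qShift q (twist τ (wordProd C L))) f := by
  induction L generalizing f with
  | nil =>
    simp only [List.foldl_nil, invRoots, List.map_nil, List.prod_nil, one_mul, wordProd_nil]
    exact le_rfl
  | cons i L ih =>
    rw [List.foldl_cons, invRoots, List.map_cons, List.prod_cons]
    refine (ih (fun δ h => hτ δ (List.mem_cons_of_mem _ h)) _).trans ?_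
    have h0 : 0 < twist τ (wordProd C L) (simpleRoot i) := hτ _ List.mem_cons_self
    have h1 := distNorm_distAct_le (C := C) (l := l) _ hn hq hγ h0 f
    have h2 : twist (twist τ (wordProd C L)) (simpleReflection C i) =
        twist τ (wordProd C (i :: L)) := by
      refine DFunLike.ext _ _ fun β => ?_
      rw [twist_apply, twist_apply, twist_apply, wordProd_cons, mul_inv_rev,
        LinearEquiv.mul_apply]
    have h3 : mRoot C n ((wordProd C L)⁻¹ (simpleRoot i)) = mSimple C n i := by
      rw [← wordProd_reverse, mRoot_wordProd]
      rfl
    rw [h2] at h1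
    rw [h3]
    refine (mul_le_mul' le_rfl h1).trans (le_of_eq ?_)
    rw [twist_apply]
    ring

end

section

variable {r : ℕ} {C : CartanDatum r} {𝔥 : Type*} [AddCommGroup 𝔥] [Module ℂ 𝔥]

/-! ### Locally finite products of power series -/

/-- `f` has no terms besides the constant term `1`, except in degrees `≥ α`. -/
def OneAbove (α : Fin r →₀ ℕ) (f : MvPowerSeries (Fin r) ℂ) : Prop :=
  ∀ β, ¬ α ≤ β → MvPowerSeries.coeff β f = MvPowerSeries.coeff β 1

lemma OneAbove.coeff_mul {α : Fin r →₀ ℕ} {f : MvPowerSeries (Fin r) ℂ} (hf : OneAbove α f)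
    (g : MvPowerSeries (Fin r) ℂ) {β : Fin r →₀ ℕ} (hβ : ¬ α ≤ β) :
    MvPowerSeries.coeff β (f * g) = MvPowerSeries.coeff β g := by
  classical
  conv_rhs => rw [← one_mul g]
  rw [MvPowerSeries.coeff_mul, MvPowerSeries.coeff_mul]
  refine Finset.sum_congr rfl fun p hp => ?_
  rw [hf p.1 fun h => hβ (h.trans
    (le_self_add.trans_eq (Finset.HasAntidiagonal.mem_antidiagonal.1 hp)))]

lemma OneAbove.one (α : Fin r →₀ ℕ) : OneAbove α 1 := fun _ _ => rfl

lemma OneAbove.mul {α : Fin r →₀ ℕ} {f g : MvPowerSeries (Fin r) ℂ} (hf : OneAbove α f)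
    (hg : OneAbove α g) : OneAbove α (f * g) := fun β hβ => by
  rw [hf.coeff_mul g hβ, hg β hβ]

lemma OneAbove.pow {α : Fin r →₀ ℕ} {f : MvPowerSeries (Fin r) ℂ} (hf : OneAbove α f) (k : ℕ) :
    OneAbove α (f ^ k) := by
  induction k with
  | zero => rw [pow_zero]; exact OneAbove.one α
  | succ k ih => rw [pow_succ]; exact ih.mul hf

lemma OneAbove.constantCoeff {α : Fin r →₀ ℕ} {f : MvPowerSeries (Fin r) ℂ} (hf : OneAbove α f)
    (hα : α ≠ 0) : MvPowerSeries.constantCoeff f = 1 := by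
  rw [← MvPowerSeries.coeff_zero_eq_constantCoeff_apply, hf 0 fun h => hα (le_antisymm h (zero_le)),
    MvPowerSeries.coeff_zero_one]

lemma OneAbove.inv {α : Fin r →₀ ℕ} {f : MvPowerSeries (Fin r) ℂ} (hf : OneAbove α f)
    (hα : α ≠ 0) : OneAbove α f⁻¹ := fun β hβ => by
  rw [← hf.coeff_mul f⁻¹ hβ, MvPowerSeries.mul_inv_cancel f (by rw [hf.constantCoeff hα]; simp)]

lemma OneAbove.one_sub_monomial {α : Fin r →₀ ℕ} {m : ℕ} (hm : 1 ≤ m) (c : ℂ) :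
    OneAbove α (1 - MvPowerSeries.monomial (m • α) c) := fun β hβ => by
  classical
  rw [map_sub, MvPowerSeries.coeff_monomial, if_neg, sub_zero]
  rintro rfl
  exact hβ (le_self_nsmul (zero_le) (by omega))

/-- The product of power series `f_α`, `α ≠ 0`. It is meant for `f_α` satisfying `OneAbove α`, of
which only those with `α ≤ β` contribute to the coefficient of `x^β`. -/
def locProd (f : (Fin r →₀ ℕ) → MvPowerSeries (Fin r) ℂ) : MvPowerSeries (Fin r) ℂ := fun β =>
  MvPowerSeries.coeff β (∏ α ∈ (Finset.Iic β).erase 0, f α)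

variable {f g : (Fin r →₀ ℕ) → MvPowerSeries (Fin r) ℂ}

/-- The coefficient of `x^β` may be computed from any finite product that contains the nontrivial
factors of index `≤ β`; the additional factors do not matter. -/
lemma coeff_locProd (hf : ∀ α, OneAbove α (f α)) {β : Fin r →₀ ℕ} {S : Finset (Fin r →₀ ℕ)}
    (h0 : 0 ∉ S) (hS : ∀ α, α ≠ 0 → α ≤ β → f α ≠ 1 → α ∈ S) :
    MvPowerSeries.coeff β (locProd f) = MvPowerSeries.coeff β (∏ α ∈ S, f α) := by
  classical
  have hdrop : ∀ T : Finset (Fin r →₀ ℕ), MvPowerSeries.coeff β (∏ α ∈ T, f α) =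
      MvPowerSeries.coeff β (∏ α ∈ T.filter (· ≤ β), f α) := by
    intro T
    induction T using Finset.induction_on with
    | empty => rfl
    | insert a T ha ih =>
      rw [Finset.prod_insert ha, Finset.filter_insert]
      split_ifs with h
      · rw [Finset.prod_insert (by simp [ha]), MvPowerSeries.coeff_mul, MvPowerSeries.coeff_mul]
        refine Finset.sum_congr rfl fun p hp => ?_
        congr 1
        have hle : p.2 ≤ β := le_add_self.trans_eq (Finset.HasAntidiagonal.mem_antidiagonal.1 hp)
        -- the same reduction in the lower degree `p.2`
        have hlow : ∀ (T U : Finset (Fin r →₀ ℕ)), T ⊆ U → (∀ x ∈ U, x ≤ β → x ∈ T) →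
            MvPowerSeries.coeff p.2 (∏ α ∈ U, f α) = MvPowerSeries.coeff p.2 (∏ α ∈ T, f α) := by
          intro T U hTU hU
          rw [← Finset.prod_sdiff hTU]
          have : ∀ V : Finset (Fin r →₀ ℕ), (∀ x ∈ V, ¬ x ≤ β) → ∀ g,
              MvPowerSeries.coeff p.2 ((∏ α ∈ V, f α) * g) = MvPowerSeries.coeff p.2 g := by
            intro V
            induction V using Finset.induction_on with
            | empty => intro _ g; simp
            | insert b V hb ihV =>
              intro hV g
              rw [Finset.prod_insert hb, mul_assoc, (hf b).coeff_mul _ fun hh =>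
                hV b (Finset.mem_insert_self _ _) (hh.trans hle)]
              exact ihV (fun x hx => hV x (Finset.mem_insert_of_mem hx)) g
          refine this _ (fun x hx hxβ => ?_) _
          rw [Finset.mem_sdiff] at hx
          exact hx.2 (hU x hx.1 hxβ)
        exact hlow _ _ (Finset.filter_subset _ _) fun x hx hxβ => Finset.mem_filter.2 ⟨hx, hxβ⟩
      · rw [(hf a).coeff_mul _ h, ih]
  have h1 : MvPowerSeries.coeff β (locProd f) =
      MvPowerSeries.coeff β (∏ α ∈ (Finset.Iic β).erase 0, f α) := rfl
  rw [h1, hdrop S]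
  congr 1
  refine (Finset.prod_subset ?_ ?_).symm
  · intro x hx
    rw [Finset.mem_filter] at hx
    rw [Finset.mem_erase, Finset.mem_Iic]
    exact ⟨fun h => h0 (h ▸ hx.1), hx.2⟩
  · intro x hx hx'
    rw [Finset.mem_erase, Finset.mem_Iic] at hx
    by_contra hne
    exact hx' (Finset.mem_filter.2 ⟨hS x hx.1 hx.2 hne, hx.2⟩)

lemma locProd_mul (hf : ∀ α, OneAbove α (f α)) (hg : ∀ α, OneAbove α (g α)) :
    locProd f * locProd g = locProd fun α => f α * g α := by
  classical
  ext β
  rw [coeff_locProd (fun α => (hf α).mul (hg α)) (S := (Finset.Iic β).erase 0) (by simp)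
    (fun α h h' _ => by simp [h, h']), Finset.prod_mul_distrib, MvPowerSeries.coeff_mul,
    MvPowerSeries.coeff_mul]
  refine Finset.sum_congr rfl fun p hp => ?_
  rw [coeff_locProd hf (S := (Finset.Iic β).erase 0) (by simp)
      (fun α h h' _ => by
        simp [h, h'.trans (le_self_add.trans_eq (Finset.HasAntidiagonal.mem_antidiagonal.1 hp))]),
    coeff_locProd hg (S := (Finset.Iic β).erase 0) (by simp)
      (fun α h h' _ => by
        simp [h, h'.trans (le_add_self.trans_eq (Finset.HasAntidiagonal.mem_antidiagonal.1 hp))])]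

lemma locProd_one : locProd (fun _ => 1 : (Fin r →₀ ℕ) → MvPowerSeries (Fin r) ℂ) = 1 := by
  ext β
  change MvPowerSeries.coeff β (∏ α ∈ (Finset.Iic β).erase 0, (1 : MvPowerSeries (Fin r) ℂ)) = _
  rw [Finset.prod_const_one]

lemma constantCoeff_locProd : MvPowerSeries.constantCoeff (locProd f) = 1 := by
  classical
  rw [← MvPowerSeries.coeff_zero_eq_constantCoeff_apply]
  change MvPowerSeries.coeff 0 (∏ α ∈ (Finset.Iic (0 : Fin r →₀ ℕ)).erase 0, f α) = 1
  have : (Finset.Iic (0 : Fin r →₀ ℕ)).erase 0 = ∅ := by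
    ext x
    simp only [Finset.mem_erase, Finset.mem_Iic, Finset.notMem_empty, iff_false, not_and]
    exact fun h h' => h (le_antisymm h' (zero_le))
  rw [this, Finset.prod_empty, MvPowerSeries.coeff_zero_one]

lemma locProd_congr (h : ∀ α, α ≠ 0 → f α = g α) : locProd f = locProd g := by
  ext β
  change MvPowerSeries.coeff β (∏ α ∈ (Finset.Iic β).erase 0, f α) =
    MvPowerSeries.coeff β (∏ α ∈ (Finset.Iic β).erase 0, g α)
  rw [Finset.prod_congr rfl fun α hα => h α (Finset.ne_of_mem_erase hα)]

lemma locProd_inv (hf : ∀ α, OneAbove α (f α)) :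
    (locProd f)⁻¹ = locProd fun α => if α = 0 then 1 else (f α)⁻¹ := by
  classical
  rw [MvPowerSeries.inv_eq_iff_mul_eq_one (by rw [constantCoeff_locProd]; simp), locProd_mul _ hf]
  · rw [← locProd_one]
    refine locProd_congr fun α hα => ?_
    rw [if_neg hα, MvPowerSeries.inv_mul_cancel _ (by rw [(hf α).constantCoeff hα]; simp)]
  · intro α
    split_ifs with h
    · exact OneAbove.one α
    · exact (hf α).inv h

/-! ### Weighted norms of power series -/

lemma ofQplus_injective : Function.Injective (ofQplus : (Fin r →₀ ℕ) → RootLattice r) := by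
  intro β γ h
  ext i
  have := congrFun h i
  simpa [ofQplus] using this

lemma ofQplus_add (β γ : Fin r →₀ ℕ) : ofQplus (β + γ) = ofQplus β + ofQplus γ := by
  ext i; simp [ofQplus]

lemma ofQplus_nsmul (k : ℕ) (β : Fin r →₀ ℕ) : ofQplus (k • β) = k • ofQplus β := by
  ext i; simp [ofQplus]

lemma ofQplus_zero : ofQplus (0 : Fin r →₀ ℕ) = 0 := by
  ext i; simp [ofQplus]

lemma ofQplus_nonneg (β : Fin r →₀ ℕ) : 0 ≤ ofQplus β := fun i => by simp [ofQplus]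

/-- The `ℓ¹`-norm of a power series at the point `x^β = exp(-τ(β))`. -/
def psNorm (τ : RootLattice r →+ ℝ) (f : MvPowerSeries (Fin r) ℂ) : ENNReal :=
  ∑' β, ‖MvPowerSeries.coeff β f‖ₑ * expE (-τ (ofQplus β))

variable (τ : RootLattice r →+ ℝ)

lemma psNorm_mul_le (f g : MvPowerSeries (Fin r) ℂ) :
    psNorm τ (f * g) ≤ psNorm τ f * psNorm τ g := by
  classical
  rw [psNorm, psNorm, psNorm, ← ENNReal.tsum_mul_right]
  simp only [← ENNReal.tsum_mul_left]
  rw [← ENNReal.tsum_prod (f := fun x y => ‖MvPowerSeries.coeff x f‖ₑ * expE (-τ (ofQplus x)) *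
    (‖MvPowerSeries.coeff y g‖ₑ * expE (-τ (ofQplus y)))),
    ← Finset.HasAntidiagonal.sigmaAntidiagonalEquivProd.tsum_eq, ENNReal.tsum_sigma']
  refine ENNReal.tsum_le_tsum fun β => ?_
  rw [tsum_fintype, MvPowerSeries.coeff_mul]
  refine (mul_le_mul' (enorm_sum_le _ _) le_rfl).trans ?_
  rw [Finset.sum_mul, ← Finset.sum_coe_sort]
  refine Finset.sum_le_sum fun p _ => le_of_eq ?_
  have hp : p.1.1 + p.1.2 = β := Finset.HasAntidiagonal.mem_antidiagonal.1 p.2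
  simp only [Finset.HasAntidiagonal.sigmaAntidiagonalEquivProd_apply]
  rw [show ofQplus β = ofQplus p.1.1 + ofQplus p.1.2 by rw [← ofQplus_add, hp], expE_neg_add,
    enorm_mul]
  ring

lemma psNorm_monomial (β : Fin r →₀ ℕ) (a : ℂ) :
    psNorm τ (MvPowerSeries.monomial β a) = ‖a‖ₑ * expE (-τ (ofQplus β)) := by
  classical
  rw [psNorm, tsum_eq_single β]
  · rw [MvPowerSeries.coeff_monomial_same]
  · intro γ hγ
    rw [MvPowerSeries.coeff_monomial_ne hγ]
    simp

lemma psNorm_one : psNorm τ (1 : MvPowerSeries (Fin r) ℂ) = 1 := by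
  rw [← MvPowerSeries.monomial_zero_one, psNorm_monomial, ofQplus_zero, map_zero, neg_zero,
    expE_zero]
  simp

lemma psNorm_sub_le (f g : MvPowerSeries (Fin r) ℂ) :
    psNorm τ (f - g) ≤ psNorm τ f + psNorm τ g := by
  rw [psNorm, psNorm, psNorm, ← ENNReal.tsum_add]
  refine ENNReal.tsum_le_tsum fun β => ?_
  rw [← add_mul, map_sub]
  exact mul_le_mul_left (enorm_sub_le) _

lemma psNorm_pow_le (f : MvPowerSeries (Fin r) ℂ) (k : ℕ) : psNorm τ (f ^ k) ≤ psNorm τ f ^ k := by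
  induction k with
  | zero => rw [pow_zero, pow_zero, psNorm_one]
  | succ k ih =>
    rw [pow_succ, pow_succ]
    exact (psNorm_mul_le τ _ _).trans (mul_le_mul' ih le_rfl)

lemma psNorm_sum_le {ι : Type*} (s : Finset ι) (F : ι → MvPowerSeries (Fin r) ℂ) :
    psNorm τ (∑ k ∈ s, F k) ≤ ∑ k ∈ s, psNorm τ (F k) := by
  simp only [psNorm]
  rw [← Summable.tsum_finsetSum fun _ _ => ENNReal.summable]
  refine ENNReal.tsum_le_tsum fun β => ?_
  rw [map_sum, ← Finset.sum_mul]
  exact mul_le_mul_left (enorm_sum_le _ _) _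

lemma psNorm_prod_le {ι : Type*} (s : Finset ι) (F : ι → MvPowerSeries (Fin r) ℂ) :
    psNorm τ (∏ k ∈ s, F k) ≤ ∏ k ∈ s, psNorm τ (F k) := by
  classical
  induction s using Finset.induction_on with
  | empty => rw [Finset.prod_empty, Finset.prod_empty, psNorm_one]
  | insert a s ha ih =>
    rw [Finset.prod_insert ha, Finset.prod_insert ha]
    exact (psNorm_mul_le τ _ _).trans (mul_le_mul' le_rfl ih)

/-- A bound for the norm of a power series follows from bounds for power series that agree with
it in a given finite set of degrees. -/
lemma psNorm_le_of_approx {f : MvPowerSeries (Fin r) ℂ} {B : ENNReal}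
    (h : ∀ T : Finset (Fin r →₀ ℕ), ∃ g, psNorm τ g ≤ B ∧
      ∀ β ∈ T, MvPowerSeries.coeff β f = MvPowerSeries.coeff β g) : psNorm τ f ≤ B := by
  rw [psNorm, ENNReal.tsum_eq_iSup_sum]
  refine iSup_le fun T => ?_
  obtain ⟨g, hg, hT⟩ := h T
  rw [Finset.sum_congr rfl fun β hβ => by rw [hT β hβ]]
  exact (ENNReal.sum_le_tsum T).trans hg

lemma psNorm_locProd_le (hf : ∀ α, OneAbove α (f α)) {c : (Fin r →₀ ℕ) → ℝ} {B : ℝ}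
    (hc : ∀ α, α ≠ 0 → psNorm τ (f α) ≤ expE (c α))
    (hB : ∀ S : Finset (Fin r →₀ ℕ), 0 ∉ S → ∑ α ∈ S, c α ≤ B) :
    psNorm τ (locProd f) ≤ expE B := by
  classical
  refine psNorm_le_of_approx τ fun T => ?_
  set S : Finset (Fin r →₀ ℕ) := (T.biUnion fun β => Finset.Iic β).erase 0 with hS
  have h0 : (0 : Fin r →₀ ℕ) ∉ S := by simp [hS]
  refine ⟨∏ α ∈ S, f α, ?_, fun β hβ => coeff_locProd hf h0 fun α hα hαβ _ => ?_⟩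
  · refine (psNorm_prod_le τ _ _).trans ((Finset.prod_le_prod' fun α hα =>
      hc α fun h => h0 (h ▸ hα)).trans ?_)
    rw [prod_expE]
    exact expE_mono (hB S h0)
  · rw [hS, Finset.mem_erase, Finset.mem_biUnion]
    exact ⟨hα, β, hβ, Finset.mem_Iic.2 hαβ⟩

lemma psNorm_one_sub_le {M : MvPowerSeries (Fin r) ℂ} {s : ℝ} (hs : 0 ≤ s)
    (hM : psNorm τ M ≤ ENNReal.ofReal s) : psNorm τ (1 - M) ≤ expE s := by
  refine (psNorm_sub_le τ _ _).trans ?_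
  rw [psNorm_one, expE]
  calc _ ≤ ENNReal.ofReal 1 + ENNReal.ofReal s := by
        rw [ENNReal.ofReal_one]; exact add_le_add le_rfl hM
    _ = ENNReal.ofReal (1 + s) := (ENNReal.ofReal_add zero_le_one hs).symm
    _ ≤ _ := ENNReal.ofReal_le_ofReal (by linarith [Real.add_one_le_exp s])

lemma one_div_one_sub_le_exp {s : ℝ} (hs : 0 ≤ s) (hs2 : s ≤ 1 / 2) :
    (1 - s)⁻¹ ≤ Real.exp (2 * s) := by
  have h1 : (1 - s)⁻¹ ≤ 1 + 2 * s := by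
    rw [inv_le_iff_one_le_mul₀ (by linarith)]
    nlinarith
  linarith [Real.add_one_le_exp (2 * s)]

lemma psNorm_inv_one_sub_monomial_le {β : Fin r →₀ ℕ} (hβ : β ≠ 0) {a : ℂ} {s : ℝ} (hs : 0 ≤ s)
    (hs2 : s ≤ 1 / 2) (hM : psNorm τ (MvPowerSeries.monomial β a) ≤ ENNReal.ofReal s) :
    psNorm τ (1 - MvPowerSeries.monomial β a)⁻¹ ≤ expE (2 * s) := by
  classical
  set M := MvPowerSeries.monomial β a with hMdef
  have hcc : MvPowerSeries.constantCoeff (1 - M) ≠ 0 := by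
    rw [map_sub, ← MvPowerSeries.coeff_zero_eq_constantCoeff_apply M, hMdef,
      MvPowerSeries.coeff_monomial_ne hβ.symm]
    simp
  refine psNorm_le_of_approx τ fun T => ?_
  obtain ⟨i, hi⟩ : ∃ i, β i ≠ 0 := by
    by_contra! h
    exact hβ (Finsupp.ext h)
  -- in the degrees of `T`, the inverse agrees with the first `K` terms of the geometric series
  set K := T.sup (fun x => x i) + 1 with hK
  refine ⟨∑ k ∈ Finset.range K, M ^ k, ?_, fun x hx => ?_⟩
  · refine (psNorm_sum_le τ _ _).trans ((Finset.sum_le_sum fun k _ =>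
      (psNorm_pow_le τ M k).trans (pow_le_pow_left' hM k)).trans ?_)
    rw [expE]
    refine le_trans ?_ (ENNReal.ofReal_le_ofReal (one_div_one_sub_le_exp hs hs2))
    have h1 : HasSum (fun k : ℕ => s ^ k) (1 - s)⁻¹ :=
      hasSum_geometric_of_lt_one hs (by linarith)
    rw [Finset.sum_congr rfl fun k _ => (ENNReal.ofReal_pow hs k).symm,
      ← ENNReal.ofReal_sum_of_nonneg fun k _ => pow_nonneg hs k]
    exact ENNReal.ofReal_le_ofReal (sum_le_hasSum _ (fun k _ => pow_nonneg hs k) h1)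
  · have h1 : (1 - M)⁻¹ = (∑ k ∈ Finset.range K, M ^ k) + M ^ K * (1 - M)⁻¹ := by
      rw [MvPowerSeries.inv_eq_iff_mul_eq_one hcc, add_mul, mul_assoc,
        MvPowerSeries.inv_mul_cancel _ hcc, mul_one, geom_sum_mul_neg, sub_add_cancel]
    rw [h1, map_add, hMdef, MvPowerSeries.monomial_pow, MvPowerSeries.coeff_monomial_mul, if_neg,
      add_zero]
    intro hle
    have h2 := hle i
    have h3 : x i ≤ T.sup (fun x => x i) := Finset.le_sup (f := fun x => x i) hx
    simp only [Finsupp.smul_apply, smul_eq_mul] at h2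
    have h4 : K ≤ K * β i := Nat.le_mul_of_pos_right _ (Nat.pos_of_ne_zero hi)
    omega

lemma psNorm_toSeries_le (g : Dist r) : psNorm τ (toSeries g) ≤ distNorm τ g :=
  ENNReal.tsum_comp_le_tsum_of_injective ofQplus_injective
    (fun β => ‖g β‖ₑ * expE (-τ β))

end

section

variable {r : ℕ} {C : CartanDatum r} {𝔥 : Type*} [AddCommGroup 𝔥] [Module ℂ 𝔥]

/-! ### The size of the root system -/

/-- The generating function of the words by content: a geometric series in the sum over the
letters. Both sides are infinite if this sum is at least `1`. -/
lemma tsum_expE_content (τ : RootLattice r →+ ℝ) :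
    ∑' w : List (Fin r), expE (-τ (content w)) = (1 - ∑ i, expE (-τ (simpleRoot i)))⁻¹ := by
  have hw : ∀ (k : ℕ) (v : Fin k → Fin r),
      expE (-τ (content (List.ofFn v))) = ∏ a, expE (-τ (simpleRoot (v a))) := by
    intro k
    induction k with
    | zero => intro v; simp [expE_zero]
    | succ k ih =>
      intro v
      rw [List.ofFn_succ, content_cons, expE_neg_add, ih, Fin.prod_univ_succ]
  rw [← List.equivSigmaTuple.symm.tsum_eq, ENNReal.tsum_sigma', ← ENNReal.tsum_geometric]
  refine tsum_congr fun k => ?_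
  rw [tsum_fintype, Fintype.sum_pow]
  exact Finset.sum_congr rfl fun v _ => hw k v

lemma sum_rootMult_le_tsum (R : Realization C 𝔥) (τ : RootLattice r →+ ℝ)
    {S : Finset (RootLattice r)} (hS : ∀ β ∈ S, 0 ≤ β ∧ β ≠ 0) :
    ∑ β ∈ S, (rootMult R β : ENNReal) * expE (-τ β) ≤
      ∑' w : List (Fin r), expE (-τ (content w)) := by
  rw [← (Equiv.sigmaFiberEquiv (content (r := r))).tsum_eq, ENNReal.tsum_sigma']
  refine (Finset.sum_le_sum fun β hβ => ?_).trans (ENNReal.sum_le_tsum S)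
  have h1 := (finite_content_eq β).fintype
  have h2 : ∀ w : {w // content w = β},
      expE (-τ (content (Equiv.sigmaFiberEquiv content ⟨β, w⟩))) = expE (-τ β) := fun w => by
    rw [Equiv.sigmaFiberEquiv_apply, w.2]
  rw [tsum_congr h2, ENNReal.tsum_const]
  refine mul_le_mul_left ?_ _
  have h3 : rootMult R β ≤ {w : List (Fin r) | content w = β}.ncard :=
    rootMult_le R (hS β hβ).2 (hS β hβ).1
  have : Finite {w // content w = β} := (finite_content_eq β).to_subtype
  rw [ENat.card_eq_coe_natCard]
  exact_mod_cast h3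

/-- The sum over the positive roots converges once the sum over the simple roots is small:
the multiplicity of `β` is at most the number of words of content `β`. -/
lemma sum_rootMult_le (R : Realization C 𝔥) {τ : RootLattice r →+ ℝ} {T : ℝ} (hT : T < 1)
    (hτ : ∑ i, Real.exp (-τ (simpleRoot i)) ≤ T) {S : Finset (RootLattice r)}
    (hS : ∀ β ∈ S, 0 ≤ β ∧ β ≠ 0) :
    ∑ β ∈ S, rootMult R β * Real.exp (-τ β) ≤ (1 - T)⁻¹ := by
  have h := sum_rootMult_le_tsum R τ hS
  rw [tsum_expE_content] at h
  have h1 : ∑ i, expE (-τ (simpleRoot i)) ≤ ENNReal.ofReal T := by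
    simp only [expE]
    rw [← ENNReal.ofReal_sum_of_nonneg fun i _ => (Real.exp_pos _).le]
    exact ENNReal.ofReal_le_ofReal hτ
  have h2 : (1 - ∑ i, expE (-τ (simpleRoot i)))⁻¹ ≤ ENNReal.ofReal (1 - T)⁻¹ := by
    rw [ENNReal.ofReal_inv_of_pos (by linarith), ENNReal.inv_le_inv,
      ENNReal.ofReal_sub _ ((Finset.sum_nonneg fun i _ => (Real.exp_pos _).le).trans hτ),
      ENNReal.ofReal_one]
    exact tsub_le_tsub_left h1 1
  have h3 : ∑ β ∈ S, (rootMult R β : ENNReal) * expE (-τ β) =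
      ENNReal.ofReal (∑ β ∈ S, rootMult R β * Real.exp (-τ β)) := by
    rw [ENNReal.ofReal_sum_of_nonneg fun i _ => by positivity]
    refine Finset.sum_congr rfl fun β _ => ?_
    rw [ENNReal.ofReal_mul (Nat.cast_nonneg _), ENNReal.ofReal_natCast, expE]
  rw [h3] at h
  have hpos : (0 : ℝ) ≤ (1 - T)⁻¹ := inv_nonneg.2 (by linarith)
  exact (ENNReal.ofReal_le_ofReal_iff hpos).1 (h.trans h2)

/-! ### The products `Δ` and `D` -/

/-- The factor `(1 - c(α) x^{m(α) α})^{mult(α)}` of a product over the positive roots. It is `1`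
if `α` is not a root. -/
def rootFactor (R : Realization C 𝔥) (n : ℕ) (c : (Fin r →₀ ℕ) → ℂ) (α : Fin r →₀ ℕ) :
    MvPowerSeries (Fin r) ℂ :=
  (1 - MvPowerSeries.monomial (mRoot C n (ofQplus α) • α) (c α)) ^ rootMult R (ofQplus α)

variable (R : Realization C 𝔥) {n q : ℕ} {c : (Fin r →₀ ℕ) → ℂ} {τ : RootLattice r →+ ℝ}

lemma deltaSeries_eq (n q : ℕ) : deltaSeries C R n q = locProd (rootFactor R n fun α =>
    (q : ℂ) ^ (mRoot C n (ofQplus α) * depth (ofQplus α))) := rfl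

lemma dSeries_eq (n q : ℕ) : dSeries C R n q = locProd (rootFactor R n fun α =>
    (q : ℂ) ^ (mRoot C n (ofQplus α) * depth (ofQplus α) - 1)) := rfl

lemma oneAbove_rootFactor (hn : 1 ≤ n) (c : (Fin r →₀ ℕ) → ℂ) (α : Fin r →₀ ℕ) :
    OneAbove α (rootFactor R n c α) :=
  (OneAbove.one_sub_monomial (mRoot_pos hn _) _).pow _

lemma psNorm_rootFactor_le {s : ℝ} (hs : 0 ≤ s) {α : Fin r →₀ ℕ}
    (h : psNorm τ (MvPowerSeries.monomial (mRoot C n (ofQplus α) • α) (c α)) ≤ ENNReal.ofReal s) :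
    psNorm τ (rootFactor R n c α) ≤ expE (rootMult R (ofQplus α) * s) := by
  rw [rootFactor, expE_nsmul]
  exact (psNorm_pow_le τ _ _).trans (pow_le_pow_left' (psNorm_one_sub_le τ hs h) _)

lemma psNorm_inv_rootFactor_le (hn : 1 ≤ n) {s : ℝ} (hs : 0 ≤ s) (hs2 : s ≤ 1 / 2)
    {α : Fin r →₀ ℕ} (hα : α ≠ 0)
    (h : psNorm τ (MvPowerSeries.monomial (mRoot C n (ofQplus α) • α) (c α)) ≤ ENNReal.ofReal s) :
    psNorm τ (rootFactor R n c α)⁻¹ ≤ expE (rootMult R (ofQplus α) * (2 * s)) := by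
  have hinv : ∀ (f : MvPowerSeries (Fin r) ℂ) (k : ℕ), (f ^ k)⁻¹ = f⁻¹ ^ k := by
    intro f k
    induction k with
    | zero => simp
    | succ k ih => rw [pow_succ, MvPowerSeries.mul_inv_rev, ih, pow_succ, mul_comm]
  have hm := mRoot_pos (C := C) hn (ofQplus α)
  rw [rootFactor, hinv, expE_nsmul]
  refine (psNorm_pow_le τ _ _).trans (pow_le_pow_left' (psNorm_inv_one_sub_monomial_le τ ?_ hs
    hs2 h) _)
  exact fun h0 => hα ((smul_eq_zero.1 h0).resolve_left (by omega))

lemma depth_nsmul (k : ℕ) (β : RootLattice r) : depth (k • β) = k * depth β := by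
  rw [← natCast_zsmul, depth_zsmul]

/-- In the variables `q x_i` the monomials in `Δ` (for `k = 0`) and `D` (for `k = 1`) have
coefficient at most `1`, so that `q` drops out of the bound; `m(β) ≥ 1` is used to bound
`exp(-m(β) τ(β))` by `exp(-τ(β))`. -/
lemma psNorm_qShift_monomial_le (hn : 1 ≤ n) (hq : 2 ≤ q) {k : ℕ} {β : Fin r →₀ ℕ}
    (hβ : 0 ≤ τ (ofQplus β)) :
    psNorm (qShift q τ) (MvPowerSeries.monomial (mRoot C n (ofQplus β) • β)
      ((q : ℂ) ^ (mRoot C n (ofQplus β) * depth (ofQplus β) - k))) ≤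
      ENNReal.ofReal (Real.exp (-τ (ofQplus β))) := by
  set m := mRoot C n (ofQplus β) with hm
  have hm1 : 1 ≤ m := mRoot_pos hn _
  rw [psNorm_monomial, expE_log_natCast (by omega), ← expE_add, ofQplus_nsmul, qShift_apply,
    map_nsmul, depth_nsmul]
  refine expE_mono ?_
  have hlog : 0 ≤ Real.log q := Real.log_nonneg (by exact_mod_cast (by omega : 1 ≤ q))
  have h1 : (1 : ℝ) ≤ m := by exact_mod_cast hm1
  push_cast
  rw [nsmul_eq_mul]
  nlinarith [mul_nonneg (Nat.cast_nonneg (α := ℝ) k) hlog, mul_nonneg (sub_nonneg.2 h1) hβ]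

lemma ofQplus_ne_zero {α : Fin r →₀ ℕ} (hα : α ≠ 0) : ofQplus α ≠ 0 := fun h =>
  hα (ofQplus_injective (h.trans ofQplus_zero.symm))

lemma sum_rootMult_ofQplus_le {T : ℝ} (hT : T < 1)
    (hτ : ∑ i, Real.exp (-τ (simpleRoot i)) ≤ T) {S : Finset (Fin r →₀ ℕ)} (hS : 0 ∉ S) :
    ∑ α ∈ S, rootMult R (ofQplus α) * Real.exp (-τ (ofQplus α)) ≤ (1 - T)⁻¹ := by
  classical
  rw [← Finset.sum_image (f := fun β => rootMult R β * Real.exp (-τ β))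
    ofQplus_injective.injOn]
  refine sum_rootMult_le R hT hτ fun β hβ => ?_
  obtain ⟨α, hα, rfl⟩ := Finset.mem_image.1 hβ
  exact ⟨ofQplus_nonneg α, ofQplus_ne_zero fun h => hS (h ▸ hα)⟩

lemma eq_sum_simpleRoot (β : RootLattice r) : β = ∑ i, β i • simpleRoot i := by
  ext j
  simp [simpleRoot, Finset.sum_apply, Pi.single_apply]

lemma weight_eq_sum (τ : RootLattice r →+ ℝ) (β : RootLattice r) :
    τ β = ∑ i, β i * τ (simpleRoot i) := by
  conv_lhs => rw [eq_sum_simpleRoot β, map_sum]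
  exact Finset.sum_congr rfl fun i _ => by rw [map_zsmul, zsmul_eq_mul]

lemma le_weight {b : ℝ} (hb : 0 ≤ b) (hτ : ∀ i, b ≤ τ (simpleRoot i)) {β : RootLattice r}
    (h : 0 ≤ β) (h0 : β ≠ 0) : b ≤ τ β := by
  obtain ⟨i, hi⟩ : ∃ i, β i ≠ 0 := by
    by_contra! hh
    exact h0 (funext hh)
  have hi1 : (1 : ℝ) ≤ β i := by
    have := h i
    simp only [Pi.zero_apply] at this
    exact_mod_cast (by omega : 1 ≤ β i)
  rw [weight_eq_sum]
  refine le_trans ?_ (Finset.single_le_sum (f := fun i => (β i : ℝ) * τ (simpleRoot i))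
    (fun j _ => mul_nonneg (by exact_mod_cast h j) (hb.trans (hτ j))) (Finset.mem_univ i))
  nlinarith [hτ i]

lemma psNorm_dSeries_le (hn : 1 ≤ n) (hq : 2 ≤ q) {T : ℝ} (hT : T < 1)
    (hτ : ∑ i, Real.exp (-τ (simpleRoot i)) ≤ T) (hτ0 : ∀ i, 0 ≤ τ (simpleRoot i)) :
    psNorm (qShift q τ) (dSeries C R n q) ≤ expE (1 - T)⁻¹ := by
  rw [dSeries_eq]
  refine psNorm_locProd_le _ (oneAbove_rootFactor R hn _)
    (c := fun α => rootMult R (ofQplus α) * Real.exp (-τ (ofQplus α))) (fun α hα => ?_)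
    fun S hS => sum_rootMult_ofQplus_le R hT hτ hS
  refine psNorm_rootFactor_le R (Real.exp_pos _).le ?_
  simpa using psNorm_qShift_monomial_le (C := C) hn hq (k := 1)
    (le_weight le_rfl hτ0 (ofQplus_nonneg α) (ofQplus_ne_zero hα))

lemma psNorm_inv_deltaSeries_le (hn : 1 ≤ n) (hq : 2 ≤ q) {T : ℝ} (hT : T < 1)
    (hτ : ∑ i, Real.exp (-τ (simpleRoot i)) ≤ T) (hτ0 : ∀ i, Real.log 2 ≤ τ (simpleRoot i)) :
    psNorm (qShift q τ) (deltaSeries C R n q)⁻¹ ≤ expE (2 * (1 - T)⁻¹) := by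
  have hlog : 0 ≤ Real.log 2 := Real.log_nonneg one_le_two
  rw [deltaSeries_eq, locProd_inv (oneAbove_rootFactor R hn _)]
  refine psNorm_locProd_le _ (fun α => ?_)
    (c := fun α => rootMult R (ofQplus α) * (2 * Real.exp (-τ (ofQplus α)))) (fun α hα => ?_)
    fun S hS => ?_
  · split_ifs with h
    · exact OneAbove.one α
    · exact (oneAbove_rootFactor R hn _ α).inv h
  · rw [if_neg hα]
    have hle := le_weight hlog hτ0 (ofQplus_nonneg α) (ofQplus_ne_zero hα)
    refine psNorm_inv_rootFactor_le R hn (Real.exp_pos _).le ?_ hα ?_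
    · calc Real.exp (-τ (ofQplus α)) ≤ Real.exp (-Real.log 2) := Real.exp_le_exp.2 (by linarith)
        _ = 1 / 2 := by rw [Real.exp_neg, Real.exp_log two_pos, one_div]
    · simpa using psNorm_qShift_monomial_le (C := C) hn hq (k := 0) (hlog.trans hle)
  · calc _ = 2 * ∑ α ∈ S, rootMult R (ofQplus α) * Real.exp (-τ (ofQplus α)) := by
          rw [Finset.mul_sum]
          exact Finset.sum_congr rfl fun α _ => by ring
      _ ≤ _ := by
          have := sum_rootMult_ofQplus_le R hT hτ hS
          linarith

end

section

variable {r : ℕ} {C : CartanDatum r} {𝔥 : Type*} [AddCommGroup 𝔥] [Module ℂ 𝔥]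

/-! ### The functional equation of `Δ` -/

/-- Laurent polynomials, as elements of the group ring of the root lattice. -/
abbrev LaurentRing (r : ℕ) := AddMonoidAlgebra ℂ (RootLattice r)

open AddMonoidAlgebra in
lemma coeff_single_mul_laurent (β δ : RootLattice r) (a : ℂ) (p : LaurentRing r) :
    (single β a * p).coeff δ = a * p.coeff (δ - β) := by
  classical
  induction p using AddMonoidAlgebra.induction_linear with
  | zero => simp
  | add x y hx hy => simp only [mul_add, coeff_add, Finsupp.add_apply, hx, hy]
  | single m b =>
    rw [single_mul_single, coeff_single, coeff_single, Finsupp.single_apply, Finsupp.single_apply]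
    have : β + m = δ ↔ m = δ - β := by rw [eq_sub_iff_add_eq, add_comm]
    simp [this]

open AddMonoidAlgebra in
/-- The substitution `x ↦ w x` on Laurent polynomials, where it is a ring homomorphism. -/
def laurentChange (q : ℕ) (hq : q ≠ 0) (w : RootLattice r ≃ₗ[ℤ] RootLattice r) :
    LaurentRing r →ₐ[ℂ] LaurentRing r :=
  lift ℂ (LaurentRing r) (RootLattice r)
    { toFun := fun β => single (w⁻¹ β.toAdd) ((q : ℂ) ^ (depth (w⁻¹ β.toAdd) - depth β.toAdd))
      map_one' := by simp [depth, one_def]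
      map_mul' := fun β β' => by
        rw [single_mul_single, toAdd_mul, map_add, depth_add, depth_add,
          ← zpow_add₀ (Nat.cast_ne_zero.2 hq)]
        congr 2
        ring }

open AddMonoidAlgebra in
lemma laurentChange_single (q : ℕ) (hq : q ≠ 0) (w : RootLattice r ≃ₗ[ℤ] RootLattice r)
    (β : RootLattice r) (a : ℂ) : laurentChange q hq w (single β a) =
      single (w⁻¹ β) (a * (q : ℂ) ^ (depth (w⁻¹ β) - depth β)) := by
  rw [laurentChange, lift_single]
  simp [smul_single]

open AddMonoidAlgebra in
lemma coeff_laurentChange (q : ℕ) (hq : q ≠ 0) (w : RootLattice r ≃ₗ[ℤ] RootLattice r)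
    (p : LaurentRing r) (β : RootLattice r) :
    (laurentChange q hq w p).coeff β = changeVar q w (p.coeff) β := by
  classical
  induction p using AddMonoidAlgebra.induction_linear with
  | zero => simp [changeVar]
  | add x y hx hy =>
    rw [map_add, coeff_add, Finsupp.add_apply, hx, hy]
    simp only [changeVar, coeff_add, Finsupp.add_apply, add_mul]
  | single m b =>
    rw [laurentChange_single, changeVar, coeff_single, coeff_single, Finsupp.single_apply,
      Finsupp.single_apply]
    have : w⁻¹ m = β ↔ m = w β := by
      constructor
      · rintro rfl; exact (w.apply_symm_apply m).symm
      · rintro rfl; exact w.symm_apply_apply β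
    by_cases h : m = w β
    · rw [if_pos h, if_pos (this.2 h), this.2 h, h]
    · rw [if_neg h, if_neg fun h' => h (this.1 h'), zero_mul]

/-- The factor `1 - q^{m(β) d(β)} x^{m(β) β}` of `Δ`. -/
def laurentFactor (C : CartanDatum r) (n q : ℕ) (β : RootLattice r) : LaurentRing r :=
  1 - AddMonoidAlgebra.single (mRoot C n β • β) ((q : ℂ) ^ (mRoot C n β * depth β))

lemma laurentChange_factor (n q : ℕ) (hq : q ≠ 0) (i : Fin r) (β : RootLattice r) :
    laurentChange q hq (simpleReflection C i) (laurentFactor C n q β) =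
      laurentFactor C n q (simpleReflection C i β) := by
  rw [laurentFactor, laurentFactor, map_sub, map_one, laurentChange_single, simpleReflection_inv,
    mRoot_simpleReflection, map_nsmul, ← zpow_add₀ (Nat.cast_ne_zero.2 hq), depth_nsmul,
    depth_nsmul]
  congr 3
  ring

/-- Polynomials as Laurent polynomials. -/
def polyToLaurent (r : ℕ) : MvPolynomial (Fin r) ℂ →ₐ[ℂ] LaurentRing r :=
  MvPolynomial.aeval fun i => AddMonoidAlgebra.single (simpleRoot i) 1

lemma toDist_ofQplus (f : MvPowerSeries (Fin r) ℂ) (α : Fin r →₀ ℕ) :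
    toDist f (ofQplus α) = MvPowerSeries.coeff α f := by
  rw [toDist, if_pos (ofQplus_nonneg α)]
  congr 1
  ext i
  simp [ofQplus]

lemma exists_ofQplus {β : RootLattice r} (h : 0 ≤ β) : ∃ α, ofQplus α = β := by
  refine ⟨Finsupp.equivFunOnFinite.symm fun i => (β i).toNat, ?_⟩
  ext i
  simpa [ofQplus] using h i

lemma polyToLaurent_monomial (α : Fin r →₀ ℕ) (a : ℂ) :
    polyToLaurent r (MvPolynomial.monomial α a) = AddMonoidAlgebra.single (ofQplus α) a := by
  have h1 : ∀ (i : Fin r) (k : ℕ), (AddMonoidAlgebra.single (simpleRoot i) (1 : ℂ)) ^ k =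
      AddMonoidAlgebra.single (k • simpleRoot i : RootLattice r) (1 : ℂ) := by
    intro i k
    rw [AddMonoidAlgebra.single_pow, one_pow]
  have h2 : ∀ s : Finset (Fin r),
      ∏ i ∈ s, AddMonoidAlgebra.single (α i • simpleRoot i : RootLattice r) (1 : ℂ) =
        AddMonoidAlgebra.single (∑ i ∈ s, α i • simpleRoot i : RootLattice r) (1 : ℂ) := by
    intro s
    induction s using Finset.induction_on with
    | empty => rfl
    | insert a s ha ih =>
      rw [Finset.prod_insert ha, ih, AddMonoidAlgebra.single_mul_single, Finset.sum_insert ha,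
        one_mul]
  rw [polyToLaurent, MvPolynomial.aeval_monomial, Finsupp.prod_fintype _ _ fun i => pow_zero _,
    Finset.prod_congr rfl fun i _ => h1 i _, h2, Algebra.algebraMap_eq_smul_one]
  have h3 : ∑ i, α i • simpleRoot i = ofQplus α := by
    rw [eq_sum_simpleRoot (ofQplus α)]
    exact Finset.sum_congr rfl fun i _ => by simp [ofQplus]
  rw [h3, smul_one_mul, AddMonoidAlgebra.smul_single, smul_eq_mul, mul_one]

lemma coeff_polyToLaurent (p : MvPolynomial (Fin r) ℂ) (β : RootLattice r) :
    (polyToLaurent r p).coeff β = toDist (p : MvPowerSeries (Fin r) ℂ) β := by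
  classical
  induction p using MvPolynomial.induction_on' with
  | monomial α a =>
    rw [polyToLaurent_monomial, AddMonoidAlgebra.coeff_single, Finsupp.single_apply]
    by_cases h : 0 ≤ β
    · obtain ⟨α', rfl⟩ := exists_ofQplus h
      rw [toDist_ofQplus, MvPolynomial.coeff_coe, MvPolynomial.coeff_monomial]
      simp only [ofQplus_injective.eq_iff]
    · rw [toDist, if_neg h, if_neg]
      rintro rfl
      exact h (ofQplus_nonneg α)
  | add p q hp hq =>
    rw [map_add, AddMonoidAlgebra.coeff_add, Finsupp.add_apply, hp, hq, MvPolynomial.coe_add,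
      toDist, toDist, toDist]
    split_ifs
    · rw [map_add]
    · rw [add_zero]

variable (R : Realization C 𝔥) {n q : ℕ}

/-- The coefficient of `x^β` in `Δ` is that of any finite product over positive elements of the
root lattice that contains the roots `≤ β`. -/
lemma toDist_deltaSeries (hn : 1 ≤ n) {S : Finset (RootLattice r)}
    (hS : ∀ δ ∈ S, 0 ≤ δ ∧ δ ≠ 0) {β : RootLattice r}
    (hβ : ∀ δ, 0 ≤ δ → δ ≠ 0 → δ ≤ β → rootMult R δ ≠ 0 → δ ∈ S) :
    toDist (deltaSeries C R n q) β =
      (∏ δ ∈ S, laurentFactor C n q δ ^ rootMult R δ).coeff β := by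
  classical
  set S' : Finset (Fin r →₀ ℕ) := S.preimage ofQplus ofQplus_injective.injOn with hS'
  have hSS : S = S'.image ofQplus := by
    ext δ
    simp only [hS', Finset.mem_image, Finset.mem_preimage]
    constructor
    · intro h
      obtain ⟨α, rfl⟩ := exists_ofQplus (hS δ h).1
      exact ⟨α, h, rfl⟩
    · rintro ⟨α, h, rfl⟩
      exact h
  have h0 : (0 : Fin r →₀ ℕ) ∉ S' := fun h => by
    rw [hS', Finset.mem_preimage] at h
    exact (hS _ h).2 ofQplus_zero
  set P : MvPolynomial (Fin r) ℂ := ∏ α ∈ S',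
    (1 - MvPolynomial.monomial (mRoot C n (ofQplus α) • α)
      ((q : ℂ) ^ (mRoot C n (ofQplus α) * depth (ofQplus α)))) ^ rootMult R (ofQplus α) with hP
  have h1 : ∏ δ ∈ S, laurentFactor C n q δ ^ rootMult R δ = polyToLaurent r P := by
    rw [hSS, Finset.prod_image ofQplus_injective.injOn, hP, map_prod]
    refine Finset.prod_congr rfl fun α _ => ?_
    rw [map_pow, map_sub, map_one, polyToLaurent_monomial, laurentFactor, ofQplus_nsmul]
  have h2 : (P : MvPowerSeries (Fin r) ℂ) = ∏ α ∈ S', rootFactor R n (fun α =>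
      (q : ℂ) ^ (mRoot C n (ofQplus α) * depth (ofQplus α))) α := by
    rw [hP, ← MvPolynomial.coeToMvPowerSeries.ringHom_apply, map_prod]
    refine Finset.prod_congr rfl fun α _ => ?_
    rw [map_pow, map_sub, map_one, MvPolynomial.coeToMvPowerSeries.ringHom_apply,
      MvPolynomial.coe_monomial, rootFactor]
  rw [h1, coeff_polyToLaurent, h2]
  by_cases h : 0 ≤ β
  · obtain ⟨α', rfl⟩ := exists_ofQplus h
    rw [toDist_ofQplus, toDist_ofQplus, deltaSeries_eq,
      coeff_locProd (oneAbove_rootFactor R hn _) h0]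
    intro α hα hle hne
    rw [hS', Finset.mem_preimage]
    refine hβ _ (ofQplus_nonneg α) (ofQplus_ne_zero hα) (fun i => ?_) fun hm => hne ?_
    · simpa [ofQplus] using hle i
    · rw [rootFactor, hm, pow_zero]
  · rw [toDist, if_neg h, toDist, if_neg h]

/-- `Δ(σ_i x) = -(q x_i)^{-m} Δ(x)`: the reflection permutes the positive roots other
than `α_i`. -/
lemma changeVar_simpleReflection_deltaSeries (hn : 1 ≤ n) (hq : q ≠ 0) (i : Fin r)
    (β : RootLattice r) :
    changeVar q (simpleReflection C i) (toDist (deltaSeries C R n q)) β =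
      -(q : ℂ) ^ (-(mRoot C n (simpleRoot i) : ℤ)) *
        toDist (deltaSeries C R n q) (β + mRoot C n (simpleRoot i) • simpleRoot i) := by
  classical
  set m := mRoot C n (simpleRoot i) with hm
  set σ := simpleReflection C i with hσ
  set β' := β + m • simpleRoot i with hβ'
  have hσσ : ∀ δ, σ (σ δ) = δ := simpleReflection_involutive i
  have hmul : ∀ δ, rootMult R (σ δ) = rootMult R δ := rootMult_simpleReflection R i
  -- the two sides involve the coefficients of `Δ` at `σ β` and `β'`; besides the factor of `α_i`, a
  -- finite product over a set `S₀` stable under `σ` computes both of them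
  set T : Finset (RootLattice r) := (Finset.Icc 0 (σ β ⊔ β')).filter
    (fun δ => δ ≠ 0 ∧ δ ≠ simpleRoot i ∧ rootMult R δ ≠ 0) with hT
  set S₀ := T ∪ T.image σ with hS₀
  have hpos : ∀ δ ∈ S₀, (0 ≤ δ ∧ δ ≠ 0) ∧ δ ≠ simpleRoot i := by
    intro δ hδ
    rcases Finset.mem_union.1 hδ with h | h
    · rw [hT, Finset.mem_filter, Finset.mem_Icc] at h
      exact ⟨⟨h.1.1, h.2.1⟩, h.2.2.1⟩
    · obtain ⟨δ', h', rfl⟩ := Finset.mem_image.1 h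
      rw [hT, Finset.mem_filter, Finset.mem_Icc] at h'
      refine ⟨⟨simpleReflection_nonneg R h'.2.2.2 h'.1.1 h'.2.1 h'.2.2.1, ?_⟩, ?_⟩
      · intro h0
        exact h'.2.1 (by rw [← hσσ δ', h0, map_zero])
      · intro h0
        have h2 : δ' = -simpleRoot i := by
          rw [← hσσ δ', h0, hσ, simpleReflection_simpleRoot]
        have h3 := h'.1.1 i
        rw [h2] at h3
        simp [simpleRoot] at h3
  have hstab : ∀ δ ∈ S₀, σ δ ∈ S₀ := by
    intro δ hδ
    rcases Finset.mem_union.1 hδ with h | h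
    · exact Finset.mem_union_right _ (Finset.mem_image_of_mem _ h)
    · obtain ⟨δ', h', rfl⟩ := Finset.mem_image.1 h
      rw [hσσ]
      exact Finset.mem_union_left _ h'
  have hnot : simpleRoot i ∉ S₀ := fun h => (hpos _ h).2 rfl
  have hS : ∀ δ ∈ insert (simpleRoot i) S₀, 0 ≤ δ ∧ δ ≠ 0 := by
    intro δ hδ
    rcases Finset.mem_insert.1 hδ with rfl | h
    · exact ⟨simpleRoot_nonneg i, simpleRoot_ne_zero i⟩
    · exact (hpos δ h).1
  have hmem : ∀ δ, 0 ≤ δ → δ ≠ 0 → δ ≤ σ β ⊔ β' → rootMult R δ ≠ 0 →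
      δ ∈ insert (simpleRoot i) S₀ := by
    intro δ h h0 hle hmδ
    by_cases hi : δ = simpleRoot i
    · exact hi ▸ Finset.mem_insert_self _ _
    · exact Finset.mem_insert_of_mem (Finset.mem_union_left _
        (Finset.mem_filter.2 ⟨Finset.mem_Icc.2 ⟨h, hle⟩, h0, hi, hmδ⟩))
  set P := ∏ δ ∈ S₀, laurentFactor C n q δ ^ rootMult R δ with hP
  have hprod : ∏ δ ∈ insert (simpleRoot i) S₀, laurentFactor C n q δ ^ rootMult R δ =
      laurentFactor C n q (simpleRoot i) * P := by
    rw [Finset.prod_insert hnot, rootMult_simpleRoot, pow_one]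
  have hPinv : laurentChange q hq σ P = P := by
    rw [hP, map_prod]
    refine Finset.prod_nbij' σ σ hstab hstab (fun δ _ => hσσ δ) (fun δ _ => hσσ δ) fun δ _ => ?_
    rw [map_pow, laurentChange_factor, hmul]
  have hfac : laurentChange q hq σ (laurentFactor C n q (simpleRoot i)) =
      AddMonoidAlgebra.single (-(m • simpleRoot i)) (-(q : ℂ) ^ (-(m : ℤ))) *
        laurentFactor C n q (simpleRoot i) := by
    have hmr : mRoot C n (-simpleRoot i) = m := by
      rw [hm, ← mRoot_simpleReflection n i (simpleRoot i), simpleReflection_simpleRoot]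
    have hd : depth (-simpleRoot i : RootLattice r) = -1 := by
      rw [← neg_one_zsmul, depth_zsmul, depth_simpleRoot]; rfl
    rw [laurentChange_factor, simpleReflection_simpleRoot, laurentFactor, laurentFactor, hmr, ← hm,
      mul_sub, mul_one, AddMonoidAlgebra.single_mul_single, hd, depth_simpleRoot, smul_neg,
      neg_add_cancel, mul_one, neg_mul, ← zpow_add₀ (Nat.cast_ne_zero.2 hq), neg_add_cancel,
      zpow_zero, mul_neg, mul_one, AddMonoidAlgebra.one_def, AddMonoidAlgebra.single_neg,
      AddMonoidAlgebra.single_neg]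
    ring
  have h1 := toDist_deltaSeries (q := q) R hn hS (β := σ β)
    fun δ h h0 hle hmδ => hmem δ h h0 (hle.trans le_sup_left) hmδ
  have h2 := toDist_deltaSeries (q := q) R hn hS (β := β')
    fun δ h h0 hle hmδ => hmem δ h h0 (hle.trans le_sup_right) hmδ
  have h3 := coeff_laurentChange q hq σ (laurentFactor C n q (simpleRoot i) * P) β
  rw [map_mul, hPinv, hfac, mul_assoc, coeff_single_mul_laurent, sub_neg_eq_add, ← hβ', ← hprod,
    ← h2] at h3
  rw [h3, changeVar, changeVar, h1]

/-- `Δ(w x)` is a monomial multiple of `Δ(x)`, with exponent `-∑ m(δ) δ` over the inversions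
of `w`. -/
lemma changeVar_wordProd_deltaSeries (hn : 1 ≤ n) (hq : q ≠ 0) (L : List (Fin r))
    (β : RootLattice r) :
    changeVar q (wordProd C L) (toDist (deltaSeries C R n q)) β =
      (-1) ^ L.length *
        (q : ℂ) ^ (-depth (((invRoots C L).map fun δ => mRoot C n δ • δ).sum)) *
        toDist (deltaSeries C R n q) (β + ((invRoots C L).map fun δ => mRoot C n δ • δ).sum) := by
  have hq' : (q : ℂ) ≠ 0 := Nat.cast_ne_zero.2 hq
  induction L generalizing β with
  | nil => simp [changeVar, invRoots, depth]
  | cons i L ih =>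
    set w := wordProd C L with hw
    set e := ((invRoots C L).map fun δ => mRoot C n δ • δ).sum with he
    set m := mRoot C n (simpleRoot i) with hm
    have hmw : mRoot C n (w⁻¹ (simpleRoot i)) = m := by
      rw [hw, ← wordProd_reverse, mRoot_wordProd]
    have hww : w (w⁻¹ (simpleRoot i)) = simpleRoot i := w.apply_symm_apply _
    have h1 := changeVar_simpleReflection_deltaSeries (q := q) R hn hq i (w β)
    have h2 := ih (β + m • w⁻¹ (simpleRoot i))
    simp only [changeVar, map_add, map_nsmul, hww] at h1 h2
    rw [invRoots, List.map_cons, List.sum_cons, ← he, hmw, List.length_cons, changeVar,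
      wordProd_cons, LinearEquiv.mul_apply, ← hw, ← add_assoc]
    rw [depth_add, depth_add, depth_nsmul, depth_nsmul, depth_simpleRoot] at h2
    rw [depth_add, depth_nsmul]
    set X := toDist (deltaSeries C R n q)
    set d₁ := depth (w⁻¹ (simpleRoot i))
    set σ := simpleReflection C i
    calc X (σ (w β)) * (q : ℂ) ^ (depth β - depth (σ (w β)))
        = X (σ (w β)) * (q : ℂ) ^ (depth (w β) - depth (σ (w β))) *
            (q : ℂ) ^ (depth β - depth (w β)) := by
          rw [mul_assoc, ← zpow_add₀ hq']
          congr 2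
          ring
      _ = -(X (w β + m • simpleRoot i) *
            (q : ℂ) ^ (depth β + m * d₁ - (depth (w β) + m * 1))) *
            (q : ℂ) ^ (-(m * d₁)) := by
          rw [h1, neg_mul, neg_mul, neg_mul, mul_comm ((q : ℂ) ^ (-(m : ℤ))), mul_assoc, mul_assoc,
            ← zpow_add₀ hq', ← zpow_add₀ hq']
          congr 3
          ring
      _ = _ := by
          rw [h2, neg_add, zpow_add₀ hq', pow_succ]
          ring

/-! ### The factors `j(w, x)` -/

lemma toLaurent_coeff (x : HahnSeries (RootLattice r) ℂ) : toLaurent x.coeff = x := by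
  have h : (Function.support x.coeff).IsPWO := x.isPWO_support
  rw [toLaurent, dif_pos h]

/-- Power series as Laurent series. -/
def psToLaurent (r : ℕ) : MvPowerSeries (Fin r) ℂ →+* HahnSeries (RootLattice r) ℂ :=
  (HahnSeries.embDomainRingHom
    (⟨⟨ofQplus, ofQplus_zero⟩, ofQplus_add⟩ : (Fin r →₀ ℕ) →+ RootLattice r) ofQplus_injective
    fun α α' => by
      change (∀ i, ((α i : ℤ)) ≤ α' i) ↔ ∀ i, α i ≤ α' i
      simp only [Nat.cast_le]).comp
    (HahnSeries.toMvPowerSeries (R := ℂ) (σ := Fin r)).symm.toRingHom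

lemma coeff_psToLaurent (f : MvPowerSeries (Fin r) ℂ) : (psToLaurent r f).coeff = toDist f := by
  funext β
  by_cases h : 0 ≤ β
  · obtain ⟨α, rfl⟩ := exists_ofQplus h
    rw [toDist_ofQplus]
    exact HahnSeries.embDomain_coeff
  · rw [toDist, if_neg h]
    refine HahnSeries.embDomain_of_notMem_range ?_
    rintro ⟨α, rfl⟩
    exact h (ofQplus_nonneg α)

lemma isUnit_psToLaurent_deltaSeries (n q : ℕ) :
    IsUnit (psToLaurent r (deltaSeries C R n q)) := by
  refine IsUnit.map _ (IsUnit.of_mul_eq_one (deltaSeries C R n q)⁻¹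
    (MvPowerSeries.mul_inv_cancel _ ?_))
  rw [deltaSeries_eq, constantCoeff_locProd]
  exact one_ne_zero

/-- The factor `j(w, x)` is a monomial, by the functional equation of `Δ`; the quotient of Laurent
series in its definition is an honest one because `Δ(x)` and hence `Δ(w x)` is a unit. -/
lemma jFactor_eq (hn : 1 ≤ n) (hq : q ≠ 0) (w : weylGroup C) :
    jFactor C R n q w = mono
      (((invRoots C (reducedWord C w)).map fun δ => mRoot C n δ • δ).sum)
      ((-1) ^ (reducedWord C w).length *
        (q : ℂ) ^ depth (((invRoots C (reducedWord C w)).map fun δ => mRoot C n δ • δ).sum)) := by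
  set L := reducedWord C w with hL
  set e := ((invRoots C L).map fun δ => mRoot C n δ • δ).sum with he
  set x := psToLaurent r (deltaSeries C R n q) with hx
  have hq' : (q : ℂ) ≠ 0 := Nat.cast_ne_zero.2 hq
  have hxu : IsUnit x := isUnit_psToLaurent_deltaSeries R n q
  have h1 : toLaurent (toDist (deltaSeries C R n q)) = x := by
    rw [← coeff_psToLaurent, toLaurent_coeff]
  set y := HahnSeries.single (-e) ((-1) ^ L.length * (q : ℂ) ^ (-depth e)) with hy
  set z := HahnSeries.single e ((-1) ^ L.length * (q : ℂ) ^ depth e) with hz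
  have hzy : z * y = 1 := by
    rw [hz, hy, HahnSeries.single_mul_single, add_neg_cancel, mul_mul_mul_comm, ← mul_pow,
      ← zpow_add₀ hq', add_neg_cancel]
    simp
  have h2 : toLaurent (changeVar q w (toDist (deltaSeries C R n q))) = y * x := by
    rw [← toLaurent_coeff (y * x)]
    congr 1
    funext β
    rw [HahnSeries.coeff_single_mul, hx, coeff_psToLaurent, sub_neg_eq_add,
      ← wordProd_reducedWord w, changeVar_wordProd_deltaSeries R hn hq]
  have hyu : IsUnit y := IsUnit.of_mul_eq_one z (by rw [mul_comm, hzy])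
  have h3 : x * Ring.inverse (y * x) = z := by
    have h4 := Ring.mul_inverse_cancel (y * x) (hyu.mul hxu)
    calc x * Ring.inverse (y * x) = z * y * (x * Ring.inverse (y * x)) := by rw [hzy, one_mul]
      _ = z * (y * x * Ring.inverse (y * x)) := by ring
      _ = z := by rw [h4, mul_one]
  rw [jFactor, h1, h2, h3, hz]
  funext β
  rw [mono, Pi.single_apply, HahnSeries.coeff_single]
  congr

lemma distNorm_jFactor (hn : 1 ≤ n) (hq : q ≠ 0) (τ : RootLattice r →+ ℝ) (w : weylGroup C) :
    distNorm (qShift q τ) (jFactor C R n q w) =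
      ((invRoots C (reducedWord C w)).map fun δ => expE (-(mRoot C n δ * τ δ))).prod := by
  rw [jFactor_eq R hn hq, distNorm_mono, enorm_mul, enorm_pow, enorm_neg, enorm_one, one_pow,
    one_mul, expE_log_natCast (Nat.pos_of_ne_zero hq), ← expE_add, qShift_apply]
  have h : ∀ l : List (RootLattice r),
      expE (-τ (l.map fun δ => mRoot C n δ • δ).sum) =
        (l.map fun δ => expE (-(mRoot C n δ * τ δ))).prod := by
    intro l
    induction l with
    | nil => simp [expE_zero]
    | cons a l ih =>
      rw [List.map_cons, List.sum_cons, expE_neg_add, ih, List.map_cons, List.prod_cons, map_nsmul,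
        nsmul_eq_mul]
  rw [← h]
  congr 1
  ring

end

section

variable {r : ℕ} {C : CartanDatum r} {𝔥 : Type*} [AddCommGroup 𝔥] [Module ℂ 𝔥]
  (R : Realization C 𝔥) {n q : ℕ} {γ : ℤ → ℂ} {l : Fin r → ℕ} {τ : RootLattice r →+ ℝ}

/-! ### The bound for the local series -/

lemma weight_pos (hτ : ∀ i, 0 < τ (simpleRoot i)) {β : RootLattice r} (h : 0 ≤ β) (h0 : β ≠ 0) :
    0 < τ β := by
  obtain ⟨i, hi⟩ : ∃ i, β i ≠ 0 := by
    by_contra! hh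
    exact h0 (funext hh)
  rw [weight_eq_sum]
  refine Finset.sum_pos' (fun j _ => mul_nonneg (by exact_mod_cast h j) (hτ j).le)
    ⟨i, Finset.mem_univ _, mul_pos ?_ (hτ i)⟩
  have := h i
  simp only [Pi.zero_apply] at this
  exact_mod_cast (by omega : 0 < β i)

/-- The exponent of the monomial `j(w, x)` compensates for the growth `exp((m(δ) - 1) τ(δ))` of the
action and leaves `exp(-τ(δ))` for each inversion `δ`. -/
lemma distNorm_weylTerm_le (hn : 1 ≤ n) (hq : 2 ≤ q) (hγ : ∀ k, ‖γ k‖ ≤ 1)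
    (hτ : ∀ i, 0 < τ (simpleRoot i)) (w : weylGroup C) :
    distNorm (qShift q τ) (Dist.mul (jFactor C R n q w) (weylAct C n q γ l w (mono 0 1))) ≤
      ((invRoots C (reducedWord C w)).map fun δ => 6 * expE (-τ δ)).prod := by
  refine (distNorm_mul_le _ _ _).trans ?_
  rw [distNorm_jFactor R hn (by omega), weylAct]
  have hL := isReduced_reducedWord w
  refine (mul_le_mul' le_rfl (distNorm_foldl_le τ hn hq hγ (reducedWord C w) (fun δ hδ =>
    weight_pos hτ (hL.invRoots_nonneg R hδ) (isRealRoot_of_mem_invRoots hδ).ne_zero) _)).trans ?_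
  rw [distNorm_mono, map_zero, neg_zero, expE_zero, enorm_one, one_mul, mul_one,
    ← List.prod_map_mul]
  refine le_of_eq (congrArg List.prod (List.map_congr_left fun δ _ => ?_))
  rw [mul_left_comm, ← expE_add]
  congr 2
  ring

/-- The sum over the Weyl group is dominated by a sum over finite sets of positive real roots, as
the inversion sets of the elements of the Weyl group are distinct; the latter is a product over the
positive real roots, which have multiplicity `1`. -/
lemma distNorm_weylSum_le (hn : 1 ≤ n) (hq : 2 ≤ q) (hγ : ∀ k, ‖γ k‖ ≤ 1)
    (hτ : ∀ i, 0 < τ (simpleRoot i)) {T : ℝ} (hT : T < 1)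
    (hτT : ∑ i, Real.exp (-τ (simpleRoot i)) ≤ T) :
    distNorm (qShift q τ) (weylSum C R n q γ l) ≤ expE (6 * (1 - T)⁻¹) := by
  classical
  refine (distNorm_tsum_le _ _).trans
    ((ENNReal.tsum_le_tsum fun w => distNorm_weylTerm_le R hn hq hγ hτ w).trans ?_)
  rw [ENNReal.tsum_eq_iSup_sum]
  refine iSup_le fun A => ?_
  let inv : weylGroup C → Finset (RootLattice r) := fun w =>
    (invRoots C (reducedWord C w)).toFinset
  have hinj : Function.Injective inv := fun w w' h =>
    invRoots_injective R fun δ => by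
      rw [← List.mem_toFinset, ← List.mem_toFinset]
      exact Finset.ext_iff.1 h δ
  set U := A.biUnion inv with hU
  have hprod : ∀ w, ((invRoots C (reducedWord C w)).map fun δ => 6 * expE (-τ δ)).prod =
      ∏ δ ∈ inv w, 6 * expE (-τ δ) := fun w =>
    (List.prod_toFinset _ ((isReduced_reducedWord w).nodup_invRoots R)).symm
  have hreal : ∀ δ ∈ U, IsRealRoot C δ ∧ 0 ≤ δ := by
    intro δ hδ
    obtain ⟨w, _, h⟩ := Finset.mem_biUnion.1 hδ
    rw [List.mem_toFinset] at h
    exact ⟨isRealRoot_of_mem_invRoots h, (isReduced_reducedWord w).invRoots_nonneg R h⟩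
  calc ∑ w ∈ A, ((invRoots C (reducedWord C w)).map fun δ => 6 * expE (-τ δ)).prod
      = ∑ V ∈ A.image inv, ∏ δ ∈ V, 6 * expE (-τ δ) := by
        rw [Finset.sum_image hinj.injOn]
        exact Finset.sum_congr rfl fun w _ => hprod w
    _ ≤ ∑ V ∈ U.powerset, ∏ δ ∈ V, 6 * expE (-τ δ) := by
        refine Finset.sum_le_sum_of_subset fun V hV => ?_
        obtain ⟨w, hw, rfl⟩ := Finset.mem_image.1 hV
        exact Finset.mem_powerset.2 (Finset.subset_biUnion_of_mem inv hw)
    _ = ∏ δ ∈ U, (1 + 6 * expE (-τ δ)) := (Finset.prod_one_add _).symm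
    _ ≤ ∏ δ ∈ U, expE (6 * Real.exp (-τ δ)) := by
        refine Finset.prod_le_prod' fun δ _ => ?_
        have h6 : (6 : ENNReal) = ENNReal.ofReal 6 := by simp
        rw [expE, expE, h6, ← ENNReal.ofReal_mul (by norm_num), ← ENNReal.ofReal_one,
          ← ENNReal.ofReal_add zero_le_one (by positivity)]
        refine ENNReal.ofReal_le_ofReal ?_
        linarith [Real.add_one_le_exp (6 * Real.exp (-τ δ))]
    _ = expE (6 * ∑ δ ∈ U, rootMult R δ * Real.exp (-τ δ)) := by
        rw [prod_expE, Finset.mul_sum]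
        congr 1
        refine Finset.sum_congr rfl fun δ hδ => ?_
        rw [rootMult_of_isRealRoot R (hreal δ hδ).1, Nat.cast_one, one_mul]
    _ ≤ _ := by
        have := sum_rootMult_le R hT hτT (S := U) fun δ hδ =>
          ⟨(hreal δ hδ).2, (hreal δ hδ).1.ne_zero⟩
        exact expE_mono (by linarith)

/-- The local series `N(x; λ)` is bounded, uniformly in `q`, `γ` and `λ`, at points with
`q x_i ≤ 1/2` and `∑ q x_i ≤ T < 1`. -/
theorem psNorm_nSeries_le (hn : 1 ≤ n) (hq : 2 ≤ q) (hγ : ∀ k, ‖γ k‖ ≤ 1)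
    (hτ : ∀ i, Real.log 2 ≤ τ (simpleRoot i)) {T : ℝ} (hT : T < 1)
    (hτT : ∑ i, Real.exp (-τ (simpleRoot i)) ≤ T) :
    psNorm (qShift q τ) (nSeries C R n q γ l) ≤ expE (9 * (1 - T)⁻¹) := by
  have hlog : 0 < Real.log 2 := Real.log_pos one_lt_two
  have hpos : ∀ i, 0 < τ (simpleRoot i) := fun i => hlog.trans_le (hτ i)
  -- the constants are `2` for `1 / Δ`, `6` for the sum over the Weyl group, and `1` for `D`
  have h : expE (9 * (1 - T)⁻¹) =
      expE (2 * (1 - T)⁻¹) * expE (6 * (1 - T)⁻¹) * expE (1 - T)⁻¹ := by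
    rw [← expE_add, ← expE_add]
    congr 1
    ring
  rw [h, nSeries, deformedCharacter]
  refine (psNorm_mul_le _ _ _).trans (mul_le_mul' ((psNorm_mul_le _ _ _).trans (mul_le_mul'
    (psNorm_inv_deltaSeries_le R hn hq hT hτT hτ) ((psNorm_toSeries_le _ _).trans ?_)))
    (psNorm_dSeries_le R hn hq hT hτT fun i => (hpos i).le))
  exact distNorm_weylSum_le R hn hq hγ hpos hT hτT

end

section

/-! ### Powers in local fields -/

/-- In a locally compact field of characteristic zero, the `n`-th powers have finite index in
the multiplicative group: they contain a neighbourhood of `1`, and modulo `n`-th powers every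
element lies in a compact annulus. -/
theorem finiteIndex_range_pow (K : Type*) [NontriviallyNormedField K] [ProperSpace K] [CharZero K]
    {n : ℕ} (hn : 1 ≤ n) : (powMonoidHom n : Kˣ →* Kˣ).range.FiniteIndex := by
  set P := (powMonoidHom n : Kˣ →* Kˣ).range with hP
  have hn0 : (n : K) ≠ 0 := Nat.cast_ne_zero.2 (by omega)
  -- the `n`-th powers form a neighbourhood of `1`
  have hnhds : {y : K | ∃ x : Kˣ, ((x ^ n : Kˣ) : K) = y} ∈ nhds (1 : K) := by
    have hd : HasStrictDerivAt (fun x : K => x ^ n) (n : K) 1 := by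
      simpa using hasStrictDerivAt_pow n (1 : K)
    have hmap := hd.map_nhds_eq hn0
    rw [one_pow] at hmap
    rw [← hmap, Filter.mem_map]
    filter_upwards [isOpen_ne.mem_nhds (one_ne_zero : (1 : K) ≠ 0)] with x hx
    exact ⟨Units.mk0 x hx, by simp⟩
  obtain ⟨c, hc⟩ := NormedField.exists_one_lt_norm K
  have hc0 : c ≠ 0 := norm_pos_iff.1 (one_pos.trans hc)
  set A : Set K := Metric.closedBall 0 (‖c‖ ^ n) \ Metric.ball 0 1 with hA
  have hAc : IsCompact A := (isCompact_closedBall (0 : K) (‖c‖ ^ n)).diff Metric.isOpen_ball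
  have hA0 : ∀ a ∈ A, a ≠ 0 := by
    rintro a ha rfl
    exact ha.2 (Metric.mem_ball_self one_pos)
  obtain ⟨t, ht, hcover⟩ := hAc.elim_nhds_subcover
    (fun a => {x : K | ∃ y : Kˣ, x = a * ((y ^ n : Kˣ) : K)}) fun a ha => by
      have h0 := hA0 a ha
      have hcont : Filter.Tendsto (fun x : K => a⁻¹ * x) (nhds a) (nhds 1) := by
        have : Continuous fun x : K => a⁻¹ * x := by fun_prop
        simpa [h0] using this.tendsto a
      filter_upwards [hcont hnhds] with x hx
      obtain ⟨y, hy⟩ := hx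
      exact ⟨y, by rw [hy, mul_inv_cancel_left₀ h0]⟩
  rw [Subgroup.finiteIndex_iff_finite_quotient]
  refine Finite.of_surjective (fun a : t => (QuotientGroup.mk
    (Units.mk0 (a : K) (hA0 _ (ht _ a.2))) : Kˣ ⧸ P)) fun g => ?_
  obtain ⟨x, rfl⟩ := QuotientGroup.mk_surjective g
  obtain ⟨k, hk⟩ := exists_mem_Ico_zpow (x := ‖(x : K)‖) (y := ‖c‖ ^ n)
    (norm_pos_iff.2 x.ne_zero) (one_lt_pow₀ hc (by omega))
  set z : Kˣ := x * (Units.mk0 c hc0 ^ (-k)) ^ n with hz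
  have hcpos : 0 < ‖c‖ ^ n := by positivity
  have hzn : ‖(z : K)‖ = ‖(x : K)‖ / (‖c‖ ^ n) ^ k := by
    rw [hz, Units.val_mul, Units.val_pow_eq_pow_val, Units.val_zpow_eq_zpow_val, Units.val_mk0,
      norm_mul, norm_pow, norm_zpow, zpow_neg, inv_pow, div_eq_mul_inv, ← zpow_natCast,
      ← zpow_natCast, ← zpow_mul, ← zpow_mul, mul_comm k]
  have hzA : (z : K) ∈ A := by
    refine ⟨?_, ?_⟩
    · rw [mem_closedBall_zero_iff, hzn, div_le_iff₀ (zpow_pos hcpos k), ← zpow_one_add₀ hcpos.ne',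
        add_comm]
      exact hk.2.le
    · rw [mem_ball_zero_iff, not_lt, hzn, one_le_div (zpow_pos hcpos k)]
      exact hk.1
  obtain ⟨a, ha, y, hy⟩ := Set.mem_iUnion₂.1 (hcover hzA)
  refine ⟨⟨a, ha⟩, ?_⟩
  rw [QuotientGroup.eq]
  refine ⟨y * (Units.mk0 c hc0 ^ (-k))⁻¹, ?_⟩
  have hxz : x = z * ((Units.mk0 c hc0 ^ (-k)) ^ n)⁻¹ := by rw [hz, mul_inv_cancel_right]
  have hzy : z = Units.mk0 a (hA0 _ (ht _ ha)) * y ^ n := Units.ext (by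
    rw [hy, Units.val_mul, Units.val_mk0])
  rw [powMonoidHom_apply, hxz, hzy, mul_pow, inv_pow, mul_assoc, inv_mul_cancel_left]

open IsDedekindDomain NumberField

variable {F : Type*} [Field F] [NumberField F]

/-- By density of `F` and of `𝓞 F` in the integers of `F` at `v`, the finite ring `𝓞 F / v` maps
onto the residue field of the completion. -/
lemma finite_residueField_adicCompletion (v : HeightOneSpectrum (𝓞 F)) :
    Finite (Valued.ResidueField (v.adicCompletion F)) := by
  have hfin : Finite (𝓞 F ⧸ v.asIdeal) := v.asIdeal.finiteQuotientOfFreeOfNeBot v.ne_bot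
  let φ : 𝓞 F →+* IsLocalRing.ResidueField (v.adicCompletionIntegers F) :=
    (IsLocalRing.residue (v.adicCompletionIntegers F)).comp
      (algebraMap (𝓞 F) (v.adicCompletionIntegers F))
  have hmem : ∀ x : v.adicCompletionIntegers F, IsLocalRing.residue _ x = 0 ↔
      Valued.v (x : v.adicCompletion F) < 1 := fun x => by
    rw [IsLocalRing.residue_eq_zero_iff]
    exact Valuation.mem_maximalIdeal_iff _ _
  have hker : ∀ a ∈ v.asIdeal, φ a = 0 := fun a ha => by
    change IsLocalRing.residue _ _ = 0
    rw [hmem, HeightOneSpectrum.algebraMap_adicCompletionIntegers_apply,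
      HeightOneSpectrum.valuedAdicCompletion_eq_valuation']
    exact (v.valuation_lt_one_iff_mem a).2 ha
  have hsurj : Function.Surjective φ := by
    intro y
    obtain ⟨x, rfl⟩ := IsLocalRing.residue_surjective y
    have hopen : IsOpen {z : v.adicCompletion F | Valued.v (z - x) < 1} := by
      have h1 := Valued.isOpen_ball (v.adicCompletion F) 1
      simp only [Valuation.restrict_lt_one_iff] at h1
      exact h1.preimage (continuous_id.sub continuous_const)
    obtain ⟨k, hk⟩ := (v.denseRange_algebraMap (K := F)).exists_mem_open hopen
      ⟨(x : v.adicCompletion F), by simp⟩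
    have hk' : Valued.v ((k : v.adicCompletion F) - x) < 1 := hk
    have hk1 : v.valuation F k ≤ 1 := by
      rw [← HeightOneSpectrum.valuedAdicCompletion_eq_valuation',
        ← sub_add_cancel (k : v.adicCompletion F) x]
      exact Valuation.map_add_le _ hk'.le x.2
    obtain ⟨a, ha⟩ := v.exists_valuation_sub_lt_of_integer hk1 1
    refine ⟨a, ?_⟩
    rw [← sub_eq_zero]
    change IsLocalRing.residue _ _ - IsLocalRing.residue _ x = 0
    rw [← map_sub, hmem]
    have h2 : Valued.v (((algebraMap (𝓞 F) F a - k : F)) : v.adicCompletion F) < 1 := by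
      rw [HeightOneSpectrum.valuedAdicCompletion_eq_valuation']
      simpa using ha
    have h3 := Valuation.map_add_lt _ h2 hk'
    convert h3 using 2
    rw [show ((algebraMap (𝓞 F) F a - k : F) : v.adicCompletion F) =
      (algebraMap (𝓞 F) F a : v.adicCompletion F) - (k : v.adicCompletion F) from
      map_sub (algebraMap F (v.adicCompletion F)) _ _, sub_add_sub_cancel]
    rfl
  exact Finite.of_surjective (Ideal.Quotient.lift v.asIdeal φ hker)
    (Ideal.Quotient.lift_surjective_of_surjective _ hker hsurj)

lemma finiteIndex_range_pow_adicCompletion (v : HeightOneSpectrum (𝓞 F)) {n : ℕ} (hn : 1 ≤ n) :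
    (powMonoidHom n : (v.adicCompletion F)ˣ →* (v.adicCompletion F)ˣ).range.FiniteIndex := by
  have hres := finite_residueField_adicCompletion v
  have hdvr : IsDiscreteValuationRing (v.adicCompletionIntegers F) := inferInstance
  let _ : NontriviallyNormedField (v.adicCompletion F) :=
    Valued.toNontriviallyNormedField (v.adicCompletion F) (WithZero (Multiplicative ℤ))
  have : ProperSpace (v.adicCompletion F) :=
    Valued.integer.properSpace_iff_completeSpace_and_isDiscreteValuationRing_integer_and_finite_residueField.2
      ⟨inferInstance, hdvr, hres⟩
  have : CharZero (v.adicCompletion F) :=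
    charZero_of_injective_algebraMap (algebraMap F (v.adicCompletion F)).injective
  exact finiteIndex_range_pow (v.adicCompletion F) hn

lemma finiteIndex_range_pow_completion (v : InfinitePlace F) {n : ℕ} (hn : 1 ≤ n) :
    (powMonoidHom n : v.Completionˣ →* v.Completionˣ).range.FiniteIndex := by
  have : CharZero v.Completion :=
    charZero_of_injective_algebraMap (algebraMap F v.Completion).injective
  let _ : NontriviallyNormedField v.Completion :=
    { (inferInstance : NormedField v.Completion) with
      non_trivial := ⟨2, by
        have h := (InfinitePlace.Completion.isometry_extensionEmbedding v).norm_map_of_map_zero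
          (map_zero _) 2
        rw [← h, map_ofNat]
        norm_num⟩ }
  have : ProperSpace v.Completion := ProperSpace.of_locallyCompactSpace v.Completion
  exact finiteIndex_range_pow v.Completion hn

lemma finiteIndex_comap {G G' : Type*} [Group G] [Group G'] (f : G →* G') {H : Subgroup G'}
    (hH : H.FiniteIndex) : (H.comap f).FiniteIndex :=
  ⟨by
    rw [Subgroup.index_comap]
    exact (inferInstance : (H.subgroupOf f.range).FiniteIndex).index_ne_zero⟩

variable {n : ℕ} (𝒟 : ArithDatum F n)

lemma ArithDatum.finiteIndex_range_pow_FSx (hn : 1 ≤ n) :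
    (powMonoidHom n : 𝒟.FSx →* 𝒟.FSx).range.FiniteIndex := by
  let f (v : InfinitePlace F) : 𝒟.FSx →* v.Completionˣ := Units.map
    ((Pi.evalRingHom (fun v : InfinitePlace F => v.Completion) v).comp
      (RingHom.fst _ _)).toMonoidHom
  let g (v : 𝒟.Sfin) : 𝒟.FSx →* (v.1.adicCompletion F)ˣ := Units.map
    ((Pi.evalRingHom (fun v : 𝒟.Sfin => v.1.adicCompletion F) v).comp
      (RingHom.snd _ _)).toMonoidHom
  have hf : (⨅ v, (powMonoidHom n).range.comap (f v)).FiniteIndex :=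
    Subgroup.finiteIndex_iInf fun v =>
      finiteIndex_comap _ (finiteIndex_range_pow_completion v hn)
  have hg : (⨅ v, (powMonoidHom n).range.comap (g v)).FiniteIndex :=
    Subgroup.finiteIndex_iInf fun v =>
      finiteIndex_comap _ (finiteIndex_range_pow_adicCompletion v.1 hn)
  refine Subgroup.finiteIndex_of_le
    (H := (⨅ v, (powMonoidHom n).range.comap (f v)) ⊓ ⨅ v, (powMonoidHom n).range.comap (g v))
    fun x hx => ?_
  have h1 : ∀ v, ∃ y, y ^ n = f v x := fun v => (Subgroup.mem_iInf.1 hx.1 v)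
  have h2 : ∀ v, ∃ y, y ^ n = g v x := fun v => (Subgroup.mem_iInf.1 hx.2 v)
  choose y hy using h1
  choose z hz using h2
  refine ⟨MulEquiv.prodUnits.symm (MulEquiv.piUnits.symm y, MulEquiv.piUnits.symm z), ?_⟩
  refine Units.ext (Prod.ext (funext fun v => ?_) (funext fun v => ?_))
  · exact congrArg Units.val (hy v)
  · exact congrArg Units.val (hz v)

end

section

/-! ### The primes of a subring of a number field -/

section Primes

variable {O F : Type*} [CommRing O] [IsDomain O] [Field F] [NumberField F] [Algebra O F]
  [FaithfulSMul O F]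

/-- If the coefficients of every integral relation between elements of a torsion-free ring are
divisible by `ℓ`, then there are no nontrivial relations, by infinite descent. -/
lemma linearIndependent_of_dvd [CharZero O] {ι : Type*} [Fintype ι] {ℓ : ℕ} (hℓ : 2 ≤ ℓ) {v : ι → O}
    (h : ∀ c : ι → ℤ, ∑ i, c i • v i = 0 → ∀ i, (ℓ : ℤ) ∣ c i) : LinearIndependent ℤ v := by
  rw [Fintype.linearIndependent_iff]
  intro c hc
  have key : ∀ k : ℕ, ∃ c' : ι → ℤ, (∀ i, c i = (ℓ : ℤ) ^ k * c' i) ∧ ∑ i, c' i • v i = 0 := by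
    intro k
    induction k with
    | zero => exact ⟨c, by simp, hc⟩
    | succ k ih =>
      obtain ⟨c', h1, h2⟩ := ih
      choose d hd using h c' h2
      refine ⟨d, fun i => by rw [h1, hd, pow_succ]; ring, ?_⟩
      have h3 : ((ℓ : ℤ) : O) * ∑ i, d i • v i = 0 := by
        rw [← h2, Finset.mul_sum]
        refine Finset.sum_congr rfl fun i _ => ?_
        rw [hd i, zsmul_eq_mul, zsmul_eq_mul, Int.cast_mul, mul_assoc]
      refine (mul_eq_zero.1 h3).resolve_left ?_
      exact_mod_cast (by omega : ℓ ≠ 0)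
  intro i
  obtain ⟨c', h1, -⟩ := key (c i).natAbs
  refine Int.eq_zero_of_abs_lt_dvd (m := (ℓ : ℤ) ^ (c i).natAbs) ⟨c' i, h1 i⟩ ?_
  rw [Int.abs_eq_natAbs]
  exact_mod_cast Nat.lt_pow_self (by omega)

variable (F) in
/-- The number of elements independent modulo `ℓ` is at most `[F : ℚ]`. With lifts of a linearly
independent family of a residue field it bounds the residue degrees, and with lifts of idempotents
the number of primes above `ℓ`. -/
lemma card_le_finrank_of_dvd {ι : Type*} [Fintype ι] {ℓ : ℕ} (hℓ : 2 ≤ ℓ) {v : ι → O}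
    (h : ∀ c : ι → ℤ, ∑ i, c i • v i = 0 → ∀ i, (ℓ : ℤ) ∣ c i) :
    Fintype.card ι ≤ Module.finrank ℚ F := by
  have := (algebraMap O F).charZero
  have h1 := linearIndependent_of_dvd hℓ h
  have h2 := h1.map' (algebraMap O F).toAddMonoidHom.toIntLinearMap
    (LinearMap.ker_eq_bot.2 (FaithfulSMul.algebraMap_injective O F))
  exact ((LinearIndependent.iff_fractionRing ℤ ℚ).1 h2).fintype_card_le_finrank

/-- The residue characteristic of a prime. -/
def resChar (p : NonzeroPrime O) : ℕ := ringChar (O ⧸ p.1)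

omit [IsDomain O] in
lemma resChar_dvd_iff (p : NonzeroPrime O) (k : ℤ) : (resChar p : ℤ) ∣ k ↔ (k : O) ∈ p.1 := by
  rw [resChar, ← CharP.intCast_eq_zero_iff (O ⧸ p.1) (ringChar (O ⧸ p.1)),
    ← Ideal.Quotient.eq_zero_iff_mem, map_intCast]

variable (F) in
include F in
lemma prime_resChar (p : NonzeroPrime O) : (resChar p).Prime := by
  have := p.2.1
  refine (CharP.char_is_prime_or_zero (O ⧸ p.1) (resChar p)).resolve_right fun h0 => ?_
  obtain ⟨c, hc, hc0⟩ := Submodule.exists_mem_ne_zero_of_ne_bot p.2.2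
  have halg : IsAlgebraic ℤ c := by
    rw [← isAlgebraic_algebraMap_iff (A := F) (FaithfulSMul.algebraMap_injective O F),
      IsFractionRing.isAlgebraic_iff ℤ ℚ F]
    exact Algebra.IsAlgebraic.isAlgebraic _
  refine Ideal.comap_ne_bot_of_algebraic_mem hc0 hc halg ((Submodule.eq_bot_iff _).2 fun k hk => ?_)
  have h1 := (resChar_dvd_iff p k).2 hk
  rwa [h0, Nat.cast_zero, zero_dvd_iff] at h1

variable (F) in
include F in
lemma finite_quotient_prime (p : NonzeroPrime O) : Finite (O ⧸ p.1) := by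
  have hp := p.2.1
  set ℓ := resChar p with hℓ
  have : CharP (O ⧸ p.1) ℓ := inferInstanceAs (CharP _ (ringChar (O ⧸ p.1)))
  have : Fact ℓ.Prime := ⟨prime_resChar F p⟩
  let _ : Algebra (ZMod ℓ) (O ⧸ p.1) := ZMod.algebra _ ℓ
  have hrank : Module.rank (ZMod ℓ) (O ⧸ p.1) ≤ (Module.finrank ℚ F : Cardinal) := by
    refine rank_le fun s hs => ?_
    have h1 := card_le_finrank_of_dvd F (O := O) (prime_resChar F p).two_le
      (v := fun x : s => Quotient.out (x : O ⧸ p.1)) fun c hc i => ?_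
    · rwa [Fintype.card_coe] at h1
    · have h2 := congrArg (Ideal.Quotient.mk p.1) hc
      rw [map_sum, map_zero] at h2
      have h3 : ∑ x : s, ((c x : ℤ) : ZMod ℓ) • (x : O ⧸ p.1) = 0 := by
        rw [← h2]
        refine Finset.sum_congr rfl fun x _ => ?_
        rw [map_zsmul, Ideal.Quotient.mk_out, Int.cast_smul_eq_zsmul]
      have h4 := Fintype.linearIndependent_iff.1 hs _ h3 i
      exact (CharP.intCast_eq_zero_iff (ZMod ℓ) ℓ _).1 h4
  have : Module.Finite (ZMod ℓ) (O ⧸ p.1) :=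
    Module.rank_lt_aleph0_iff.1 (hrank.trans_lt (Cardinal.natCast_lt_aleph0))
  exact Module.finite_of_finite (ZMod ℓ)

variable (F) in
include F in
lemma resChar_le_primeNorm (p : NonzeroPrime O) : resChar p ≤ primeNorm p := by
  have := finite_quotient_prime F p
  have : CharP (O ⧸ p.1) (resChar p) := inferInstanceAs (CharP _ (ringChar (O ⧸ p.1)))
  have h := Nat.card_le_card_of_injective (ZMod.castHom (dvd_refl (resChar p)) (O ⧸ p.1))
    (ZMod.castHom_injective _)
  rwa [Nat.card_zmod] at h

variable (F) in
include F in
lemma two_le_primeNorm (p : NonzeroPrime O) : 2 ≤ primeNorm p :=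
  (prime_resChar F p).two_le.trans (resChar_le_primeNorm F p)

variable (F) in
/-- There are at most `[F : ℚ]` primes of residue characteristic `ℓ`. -/
lemma card_primes_le [IsPrincipalIdealRing O] (A : Finset (NonzeroPrime O)) {ℓ : ℕ} (hℓ : 2 ≤ ℓ)
    (hA : ∀ p ∈ A, resChar p = ℓ) : A.card ≤ Module.finrank ℚ F := by
  classical
  have hmax : ∀ p : NonzeroPrime O, p.1.IsMaximal := fun p => p.2.1.isMaximal p.2.2
  have hcop : Pairwise (Function.onFun IsCoprime fun p : A => p.1.1) := fun p p' hne => by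
    have h1 := hmax p.1
    have h2 := hmax p'.1
    exact Ideal.isCoprime_of_isMaximal fun h => hne (Subtype.ext (Subtype.ext h))
  choose e he using fun j : A => Ideal.exists_forall_sub_mem_ideal hcop
    fun i => if i = j then (1 : O) else 0
  have h1 := card_le_finrank_of_dvd F hℓ (v := e) fun c hc i => ?_
  · rwa [Fintype.card_coe] at h1
  · rw [← hA i i.2, resChar_dvd_iff, ← Ideal.Quotient.eq_zero_iff_mem]
    have h2 := congrArg (Ideal.Quotient.mk i.1.1) hc
    rw [map_sum, map_zero] at h2
    rw [← h2, Finset.sum_eq_single i]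
    · have h3 := Ideal.Quotient.eq.2 (he i i)
      rw [if_pos rfl] at h3
      rw [map_zsmul, h3, map_one, zsmul_one, map_intCast]
    · intro j _ hj
      have h3 := Ideal.Quotient.eq.2 (he j i)
      rw [if_neg hj.symm, map_zero] at h3
      rw [map_zsmul, h3, smul_zero]
    · intro h
      exact absurd (Finset.mem_univ i) h

variable (F) in
include F in
/-- The sum `∑ |p|^{-x}` over the primes converges for `x > 1`. -/
lemma tsum_primeNorm_ne_top [IsPrincipalIdealRing O] {x : ℝ} (hx : 1 < x) :
    ∑' p : NonzeroPrime O, ENNReal.ofReal ((primeNorm p : ℝ) ^ (-x)) ≠ ⊤ := by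
  have h1 : ∑' p : NonzeroPrime O, ENNReal.ofReal ((primeNorm p : ℝ) ^ (-x)) ≤
      ∑' ℓ : ℕ, (Module.finrank ℚ F : ENNReal) * ENNReal.ofReal (((ℓ : ℝ) ^ x)⁻¹) := by
    rw [← (Equiv.sigmaFiberEquiv (resChar (O := O))).tsum_eq, ENNReal.tsum_sigma']
    refine ENNReal.tsum_le_tsum fun ℓ => ?_
    rw [ENNReal.tsum_eq_iSup_sum]
    refine iSup_le fun A => ?_
    have hb : ∀ p : {p : NonzeroPrime O // resChar p = ℓ},
        ENNReal.ofReal ((primeNorm (Equiv.sigmaFiberEquiv resChar ⟨ℓ, p⟩) : ℝ) ^ (-x)) ≤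
          ENNReal.ofReal (((ℓ : ℝ) ^ x)⁻¹) := fun p => by
      have h2 := (prime_resChar F p.1).pos
      have h3 := resChar_le_primeNorm F p.1
      rw [p.2] at h2 h3
      rw [Equiv.sigmaFiberEquiv_apply, ← Real.rpow_neg (Nat.cast_nonneg _)]
      exact ENNReal.ofReal_le_ofReal (Real.rpow_le_rpow_of_nonpos (by exact_mod_cast h2)
        (by exact_mod_cast h3) (by linarith))
    refine (Finset.sum_le_card_nsmul A _ _ fun p _ => hb p).trans ?_
    rw [nsmul_eq_mul]
    refine mul_le_mul_left ?_ _
    rcases A.eq_empty_or_nonempty with rfl | ⟨p₀, -⟩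
    · simp
    · have hℓ : 2 ≤ ℓ := p₀.2 ▸ (prime_resChar F p₀.1).two_le
      have h4 := card_primes_le F (A.map (Function.Embedding.subtype _)) hℓ fun p hp => by
        obtain ⟨p', -, rfl⟩ := Finset.mem_map.1 hp
        exact p'.2
      rw [Finset.card_map] at h4
      exact_mod_cast h4
  refine ne_top_of_le_ne_top ?_ h1
  rw [ENNReal.tsum_mul_left]
  refine ENNReal.mul_ne_top (ENNReal.natCast_ne_top _) ?_
  rw [← ENNReal.ofReal_tsum_of_nonneg (fun ℓ => by positivity) (Real.summable_nat_rpow_inv.2 hx)]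
  exact ENNReal.ofReal_ne_top

/-! ### Norms and orders -/

lemma ord_ne_zero_iff [IsPrincipalIdealRing O] (p : NonzeroPrime O) {c : O} :
    ord p c ≠ 0 ↔ c ∈ p.1 := by
  rw [ord, Ne, multiplicity_eq_zero, not_not, Ideal.dvd_span_singleton]

/-- The nonzero primes as points of the spectrum. -/
def primeEquiv (O : Type*) [CommRing O] :
    NonzeroPrime O ≃ IsDedekindDomain.HeightOneSpectrum O where
  toFun p := ⟨p.1, p.2.1, p.2.2⟩
  invFun v := ⟨v.asIdeal, v.isPrime, v.ne_bot⟩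
  left_inv _ := rfl
  right_inv _ := rfl

lemma finite_setOf_mem [IsPrincipalIdealRing O] {c : O} (hc : c ≠ 0) :
    {p : NonzeroPrime O | c ∈ p.1}.Finite := by
  have h := Ideal.finite_factors (I := Ideal.span {c})
    (by rwa [Ne, Ideal.zero_eq_bot, Ideal.span_singleton_eq_bot])
  refine (h.preimage (primeEquiv O).injective.injOn).subset fun p hp => ?_
  exact Ideal.dvd_span_singleton.2 hp

lemma span_eq_prod [IsPrincipalIdealRing O] {c : O} (hc : c ≠ 0) {U : Finset (NonzeroPrime O)}
    (hU : ∀ p : NonzeroPrime O, c ∈ p.1 → p ∈ U) :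
    Ideal.span {c} = ∏ p ∈ U, p.1 ^ ord p c := by
  have h0 : Ideal.span {c} ≠ ⊥ := by rwa [Ne, Ideal.span_singleton_eq_bot]
  rw [← finprod_eq_prod_of_mulSupport_subset (f := fun p : NonzeroPrime O => p.1 ^ ord p c)]
  · rw [← finprod_comp_equiv (primeEquiv O).symm]
    exact (Ideal.finprod_heightOneSpectrum_pow_multiplicity h0).symm
  · intro p hp
    refine hU p ((ord_ne_zero_iff p).1 fun h => hp ?_)
    simp only [h, pow_zero]

lemma elemNorm_eq_prod [CharZero O] [IsPrincipalIdealRing O] {c : O} (hc : c ≠ 0)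
    {U : Finset (NonzeroPrime O)}
    (hU : ∀ p : NonzeroPrime O, c ∈ p.1 → p ∈ U) :
    elemNorm c = ∏ p ∈ U, primeNorm p ^ ord p c := by
  have : Infinite O := Infinite.of_injective (Nat.cast : ℕ → O) Nat.cast_injective
  have hmul : ∀ I J : Ideal O, Submodule.cardQuot (I * J) =
      Submodule.cardQuot I * Submodule.cardQuot J := fun I J =>
    UniqueFactorizationMonoid.multiplicative_of_coprime Submodule.cardQuot I J
      (Submodule.cardQuot_bot _ _)
      (fun {I J} hI => by simp [Ideal.isUnit_iff.mp hI, Ideal.mul_top])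
      (fun {I} i hI =>
        have : Ideal.IsPrime I := Ideal.isPrime_of_prime hI
        cardQuot_pow_of_prime hI.ne_zero)
      fun {I J} hIJ => cardQuot_mul_of_coprime <| Ideal.isCoprime_iff_sup_eq.mpr
        (Ideal.isUnit_iff.mp
          (hIJ (Ideal.dvd_iff_le.mpr le_sup_left) (Ideal.dvd_iff_le.mpr le_sup_right)))
  let N : Ideal O →* ℕ :=
    ⟨⟨Submodule.cardQuot, by rw [Ideal.one_eq_top, Submodule.cardQuot_top]⟩, hmul⟩
  have h1 : elemNorm c = N (Ideal.span {c}) := rfl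
  rw [h1, span_eq_prod hc hU, map_prod]
  exact Finset.prod_congr rfl fun p _ => map_pow N _ _

end Primes

end

section

/-! ### Euler products -/

/-- A sum over finitely supported functions is bounded by the Euler product. -/
lemma sum_finsupp_prod_le {ι κ : Type*} [Zero κ] [DecidableEq ι] [DecidableEq κ]
    (w : ι → κ → ENNReal) (A : Finset (ι →₀ κ)) :
    ∃ U : Finset ι, ∑ k ∈ A, ∏ p ∈ k.support, w p (k p) ≤
      ∏ p ∈ U, (1 + ∑' x : {x : κ // x ≠ 0}, w p x) := by
  set U : Finset ι := A.biUnion Finsupp.support with hU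
  set V : Finset κ := insert 0 (A.biUnion fun k => U.image k) with hV
  let w' : ι → κ → ENNReal := fun p x => if x = 0 then 1 else w p x
  refine ⟨U, ?_⟩
  have hsub : ∀ k ∈ A, k.support ⊆ U := fun k hk => Finset.subset_biUnion_of_mem _ hk
  have h1 : ∀ k ∈ A, ∏ p ∈ k.support, w p (k p) = ∏ p ∈ U.attach, w' p.1 (k p.1) := by
    intro k hk
    rw [Finset.prod_attach U fun p => w' p (k p)]
    rw [← Finset.prod_subset (hsub k hk) fun p _ hp => ?_]
    · exact Finset.prod_congr rfl fun p hp => (if_neg (Finsupp.mem_support_iff.1 hp)).symm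
    · exact if_pos (Finsupp.notMem_support_iff.1 hp)
  have hinj : Set.InjOn (fun (k : ι →₀ κ) (p : ι) (_ : p ∈ U) => k p) A := by
    intro k hk k' hk' h
    ext p
    by_cases hp : p ∈ U
    · exact congrFun (congrFun h p) hp
    · rw [Finsupp.notMem_support_iff.1 fun h => hp (hsub k hk h),
        Finsupp.notMem_support_iff.1 fun h => hp (hsub k' hk' h)]
  calc ∑ k ∈ A, ∏ p ∈ k.support, w p (k p)
      = ∑ k ∈ A, ∏ p ∈ U.attach, w' p.1 (k p.1) := Finset.sum_congr rfl h1
    _ = ∑ g ∈ A.image (fun (k : ι →₀ κ) (p : ι) (_ : p ∈ U) => k p),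
          ∏ p ∈ U.attach, w' p.1 (g p.1 p.2) :=
          (Finset.sum_image (f := fun g : ∀ p ∈ U, κ => ∏ p ∈ U.attach, w' p.1 (g p.1 p.2))
            hinj).symm
    _ ≤ ∑ g ∈ U.pi fun _ => V, ∏ p ∈ U.attach, w' p.1 (g p.1 p.2) := by
        refine Finset.sum_le_sum_of_subset fun g hg => ?_
        obtain ⟨k, hk, rfl⟩ := Finset.mem_image.1 hg
        rw [Finset.mem_pi]
        exact fun p hp => Finset.mem_insert_of_mem
          (Finset.mem_biUnion.2 ⟨k, hk, Finset.mem_image_of_mem _ hp⟩)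
    _ = ∏ p ∈ U, ∑ x ∈ V, w' p x := (Finset.prod_sum U (fun _ => V) w').symm
    _ ≤ _ := by
        refine Finset.prod_le_prod' fun p _ => ?_
        rw [← Finset.add_sum_erase V _ (Finset.mem_insert_self 0 _)]
        refine add_le_add (if_pos rfl).le ?_
        rw [Finset.sum_congr rfl fun x hx => if_neg (Finset.ne_of_mem_erase hx),
          ← Finset.sum_subtype_of_mem (p := fun x => x ≠ 0) (w p)
            fun x hx => Finset.ne_of_mem_erase hx]
        exact ENNReal.sum_le_tsum (f := fun x : {x : κ // x ≠ 0} => w p x) _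

/-- Absolute convergence of Euler products: `k ↦ w p k` is the local weight at `p`, taken to be `1`
at `k = 0`. -/
lemma tsum_finsupp_prod_ne_top {ι κ : Type*} [Zero κ] (w : ι → κ → ENNReal)
    (hw : ∑' p, ∑' x : {x : κ // x ≠ 0}, w p x ≠ ⊤) :
    ∑' k : ι →₀ κ, ∏ p ∈ k.support, w p (k p) ≠ ⊤ := by
  classical
  set W : ι → ENNReal := fun p => ∑' x : {x : κ // x ≠ 0}, w p x with hW
  have hWp : ∀ p, W p ≠ ⊤ := ENNReal.ne_top_of_tsum_ne_top hw
  refine ne_top_of_le_ne_top (expE_ne_top (∑' p, W p).toReal) ?_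
  rw [ENNReal.tsum_eq_iSup_sum]
  refine iSup_le fun A => ?_
  obtain ⟨U, hU⟩ := sum_finsupp_prod_le w A
  refine hU.trans ?_
  have h1 : ∀ S : Finset ι, ∏ p ∈ S, (1 + W p) ≤ expE (∑ p ∈ S, (W p).toReal) := by
    intro S
    induction S using Finset.induction_on with
    | empty => simp [expE_zero]
    | insert a s ha ih =>
      rw [Finset.prod_insert ha, Finset.sum_insert ha, expE_add]
      refine mul_le_mul' ?_ ih
      rw [expE, ← ENNReal.ofReal_toReal (hWp a), ENNReal.toReal_ofReal ENNReal.toReal_nonneg,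
        ← ENNReal.ofReal_one, ← ENNReal.ofReal_add zero_le_one ENNReal.toReal_nonneg]
      exact ENNReal.ofReal_le_ofReal (by linarith [Real.add_one_le_exp (W a).toReal])
  refine (h1 U).trans (expE_mono ?_)
  rw [← ENNReal.toReal_sum fun p _ => hWp p]
  exact ENNReal.toReal_mono hw (ENNReal.sum_le_tsum U)

/-! ### The local factors -/

section LocalFactor

variable {r : ℕ} {C : CartanDatum r} {𝔥 : Type*} [AddCommGroup 𝔥] [Module ℂ 𝔥]
  (R : Realization C 𝔥) {n q : ℕ} {γ : ℤ → ℂ} {l : Fin r → ℕ}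

/-- The weight on the root lattice with given values at the simple roots. -/
def weightHom (t : Fin r → ℝ) : RootLattice r →+ ℝ where
  toFun β := ∑ i, β i * t i
  map_zero' := by simp
  map_add' β γ := by simp [add_mul, Finset.sum_add_distrib]

lemma weightHom_simpleRoot (t : Fin r → ℝ) (i : Fin r) : weightHom t (simpleRoot i) = t i := by
  simp [weightHom, simpleRoot, Pi.single_apply]

/-- The nonconstant terms of the local series contribute `O((q/2)^{1-σ₀})`: each of them is at
least by this factor smaller than at the point `q x_i = 2^{1-σ_i}`, where the local series is bounded
uniformly in `q`. -/
lemma tsum_nSeries_le (hn : 1 ≤ n) (hq : 2 ≤ q) (hγ : ∀ k, ‖γ k‖ ≤ 1) {σ : Fin r → ℝ} {σ₀ T : ℝ}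
    (hσ₀ : 2 ≤ σ₀) (hσ : ∀ i, σ₀ ≤ σ i) (hT : T < 1) (hσT : ∑ i, (2 : ℝ) ^ (1 - σ i) ≤ T) :
    ∑' k : {k : Fin r → ℕ // k ≠ 0},
      ‖MvPowerSeries.coeff (Finsupp.equivFunOnFinite.symm k.1) (nSeries C R n q γ l)‖ₑ *
        expE (-(Real.log q * ∑ i, k.1 i * σ i)) ≤
      expE ((1 - σ₀) * (Real.log q - Real.log 2)) * expE (9 * (1 - T)⁻¹) := by
  set τ := weightHom fun i => (σ i - 1) * Real.log 2 with hτ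
  have hlog : 0 < Real.log 2 := Real.log_pos one_lt_two
  have hlogq : Real.log 2 ≤ Real.log q := Real.log_le_log two_pos (by exact_mod_cast hq)
  have h1 : psNorm (qShift q τ) (nSeries C R n q γ l) ≤ expE (9 * (1 - T)⁻¹) := by
    refine psNorm_nSeries_le R hn hq hγ (fun i => ?_) hT (le_trans (le_of_eq ?_) hσT)
    · rw [hτ, weightHom_simpleRoot]
      nlinarith [hσ i]
    · refine Finset.sum_congr rfl fun i _ => ?_
      rw [hτ, weightHom_simpleRoot, Real.rpow_def_of_pos two_pos]
      congr 1
      ring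
  refine le_trans ?_ (mul_le_mul' le_rfl h1)
  rw [psNorm, ← ENNReal.tsum_mul_left]
  refine le_trans (ENNReal.tsum_le_tsum fun k => ?_) (ENNReal.tsum_comp_le_tsum_of_injective
    (f := fun k : {k : Fin r → ℕ // k ≠ 0} => Finsupp.equivFunOnFinite.symm k.1)
    (Finsupp.equivFunOnFinite.symm.injective.comp Subtype.val_injective) _)
  rw [mul_left_comm, ← expE_add]
  refine mul_le_mul' le_rfl (expE_mono ?_)
  obtain ⟨i, hi⟩ : ∃ i, k.1 i ≠ 0 := by
    by_contra! h
    exact k.2 (funext h)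
  have h2 : σ₀ - 1 ≤ ∑ i, (k.1 i : ℝ) * (σ i - 1) := by
    refine le_trans ?_ (Finset.single_le_sum (f := fun i => (k.1 i : ℝ) * (σ i - 1))
      (fun j _ => mul_nonneg (Nat.cast_nonneg _) (by linarith [hσ j])) (Finset.mem_univ i))
    have : (1 : ℝ) ≤ k.1 i := by exact_mod_cast Nat.one_le_iff_ne_zero.2 hi
    nlinarith [hσ i]
  have h3 : ∑ i, (k.1 i : ℝ) * (σ i - 1) = ∑ i, (k.1 i : ℝ) * σ i - ∑ i, (k.1 i : ℝ) := by
    rw [← Finset.sum_sub_distrib]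
    exact Finset.sum_congr rfl fun i _ => by ring
  have h4 : qShift q τ (ofQplus (Finsupp.equivFunOnFinite.symm k.1)) =
      (∑ i, (k.1 i : ℝ) * (σ i - 1)) * Real.log 2 + (∑ i, (k.1 i : ℝ)) * Real.log q := by
    rw [qShift_apply, hτ]
    simp [weightHom, depth, ofQplus, Finset.sum_mul, mul_assoc]
  rw [h4]
  nlinarith [mul_le_mul_of_nonneg_right h2 (sub_nonneg.2 hlogq)]

end LocalFactor

end

section

variable {F : Type*} [Field F] [NumberField F] {n : ℕ} (𝒟 : ArithDatum F n)

/-! ### Symbols and Gauss sums -/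

lemma norm_rootsOfUnity (hn : 1 ≤ n) (ζ : rootsOfUnity n ℂ) : ‖((ζ : ℂˣ) : ℂ)‖ = 1 := by
  have h : ((ζ : ℂˣ) : ℂ) ^ n = 1 := by
    rw [← Units.val_pow_eq_pow_val, (mem_rootsOfUnity n _).1 ζ.2, Units.val_one]
  exact Complex.norm_eq_one_of_pow_eq_one h (by omega)

namespace ArithDatum

lemma norm_resSymbol (hn : 1 ≤ n) (c d : 𝒟.O) : ‖𝒟.resSymbol c d‖ = 1 := by
  refine finprod_induction (fun z : ℂ => ‖z‖ = 1) norm_one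
    (fun x y hx hy => by rw [norm_mul, hx, hy, one_mul]) fun p => ?_
  rw [norm_pow, norm_rootsOfUnity hn, one_pow]

lemma norm_hilbertS (hn : 1 ≤ n) (x y : 𝒟.FSx) : ‖𝒟.hilbertS x y‖ = 1 := by
  rw [hilbertS, norm_prod]
  exact Finset.prod_eq_one fun v _ => norm_rootsOfUnity hn _

variable {r : ℕ} (C : CartanDatum r)

lemma norm_hilbertB (hn : 1 ≤ n) (x y : Fin r → 𝒟.FSx) : ‖𝒟.hilbertB C x y‖ = 1 := by
  rw [hilbertB, norm_prod]
  refine Finset.prod_eq_one fun i _ => ?_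
  rw [norm_mul, norm_zpow, 𝒟.norm_hilbertS hn, one_zpow, one_mul, norm_prod]
  exact Finset.prod_eq_one fun j _ => by rw [norm_zpow, 𝒟.norm_hilbertS hn, one_zpow]

lemma norm_gaussSum_le (hn : 1 ≤ n) (p : NonzeroPrime 𝒟.O) (t : ℤ) :
    ‖𝒟.gaussSum 1 (𝒟.ϖ p) t‖ ≤ primeNorm p := by
  classical
  have hfin : Finite (𝒟.O ⧸ Ideal.span {𝒟.ϖ p}) := by
    rw [𝒟.ϖ_span]
    exact finite_quotient_prime F p
  have := Fintype.ofFinite (𝒟.O ⧸ Ideal.span {𝒟.ϖ p})ˣ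
  rw [gaussSum, finsum_eq_sum_of_fintype]
  refine (norm_sum_le _ _).trans
    ((Finset.sum_le_sum (g := fun _ => (1 : ℝ)) fun u _ => ?_).trans ?_)
  · rw [norm_mul, norm_zpow, 𝒟.norm_resSymbol hn, one_zpow, one_mul, Circle.norm_coe]
  · rw [Finset.sum_const, nsmul_eq_mul, mul_one, Finset.card_univ, ← Nat.card_eq_fintype_card]
    have h := Nat.card_le_card_of_injective (Units.val : (𝒟.O ⧸ Ideal.span {𝒟.ϖ p})ˣ → _)
      Units.val_injective
    rw [primeNorm, ← 𝒟.ϖ_span p]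
    exact_mod_cast h

lemma norm_gammaFun_le (hn : 1 ≤ n) (p : NonzeroPrime 𝒟.O) (i : ℤ) : ‖𝒟.gammaFun p i‖ ≤ 1 := by
  rw [gammaFun]
  split_ifs
  · simp
  · rw [norm_div, Complex.norm_natCast]
    exact div_le_one_of_le₀ (𝒟.norm_gaussSum_le hn p i) (Nat.cast_nonneg _)

variable {C} {𝔥 : Type*} [AddCommGroup 𝔥] [Module ℂ 𝔥] (R : Realization C 𝔥)

/-! ### Boundedness of the functions in `𝔐_B(Ω)` -/

/-- Modulo norm one factors, functions in `ℳ_B(Ω)` are functions on a finite quotient. -/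
lemma exists_norm_le_of_mem_calM (hn : 1 ≤ n) {Φ : (Fin r → 𝒟.FSx) → ℂ} (hΦ : Φ ∈ 𝒟.calM C) :
    ∃ M : ℝ, ∀ c, ‖Φ c‖ ≤ M := by
  set P := (powMonoidHom n : 𝒟.FSx →* 𝒟.FSx).range with hP
  have : P.FiniteIndex := 𝒟.finiteIndex_range_pow_FSx hn
  have hfin : Finite (𝒟.FSx ⧸ P) := inferInstance
  obtain ⟨M, hM⟩ := (Set.finite_range fun g : Fin r → 𝒟.FSx ⧸ P =>
    ‖Φ fun i => Quotient.out (g i)‖).bddAbove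
  refine ⟨M, fun c => ?_⟩
  set c' : Fin r → 𝒟.FSx := fun i => Quotient.out (c i : 𝒟.FSx ⧸ P) with hc'
  have hmem : ∀ i, (c * c'⁻¹) i ∈ 𝒟.Ω := by
    intro i
    refine Subgroup.mem_sup_right ?_
    have h1 : (c' i)⁻¹ * c i ∈ P := QuotientGroup.eq.1 (QuotientGroup.out_eq' _)
    rwa [mul_comm] at h1
  have h2 := hΦ (c * c'⁻¹) c' hmem
  rw [inv_mul_cancel_right] at h2
  rw [h2, norm_mul, 𝒟.norm_hilbertB C hn, one_mul]
  exact hM ⟨fun i => (c i : 𝒟.FSx ⧸ P), rfl⟩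

lemma exists_norm_le_of_mem_frakM (hn : 1 ≤ n) {Ψ : 𝔥 → (Fin r → 𝒟.FSx) → ℂ}
    (hΨ : Ψ ∈ 𝒟.frakM R) (s : 𝔥) : ∃ M : ℝ, ∀ c, ‖Ψ s c‖ ≤ M := by
  induction hΨ using Submodule.span_induction with
  | mem Ψ h =>
    obtain ⟨k, Φ, hΦ, rfl⟩ := h
    obtain ⟨M, hM⟩ := 𝒟.exists_norm_le_of_mem_calM hn hΦ
    refine ⟨‖∏ v : 𝒟.Sfin, ∏ i,
      ((Ideal.absNorm v.1.asIdeal : ℂ) ^ (-(R.α i s))) ^ k v i‖ * M, fun c => ?_⟩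
    rw [norm_mul]
    exact mul_le_mul_of_nonneg_left (hM c) (norm_nonneg _)
  | zero => exact ⟨0, fun c => by simp⟩
  | add x y _ _ hx hy =>
    obtain ⟨M, hM⟩ := hx
    obtain ⟨M', hM'⟩ := hy
    exact ⟨M + M', fun c => (norm_add_le _ _).trans (add_le_add (hM c) (hM' c))⟩
  | smul a x _ hx =>
    obtain ⟨M, hM⟩ := hx
    refine ⟨‖a‖ * M, fun c => ?_⟩
    change ‖a * x s c‖ ≤ _
    rw [norm_mul]
    exact mul_le_mul_of_nonneg_left (hM c) (norm_nonneg _)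

/-! ### The coefficients -/

instance : IsPrincipalIdealRing 𝒟.O := 𝒟.pid

/-- The exponents of the primes in a tuple. -/
def ordTuple (c : Fin r → {c : 𝒟.O // c ≠ 0}) : NonzeroPrime 𝒟.O →₀ (Fin r → ℕ) :=
  Finsupp.ofSupportFinite (fun p i => ord p (c i).1)
    ((Set.finite_iUnion fun i => finite_setOf_mem (c i).2).subset fun p hp => by
      rw [Function.mem_support] at hp
      by_contra h
      simp only [Set.mem_iUnion, Set.mem_ofPred_eq, not_exists] at h
      exact hp (funext fun i => by_contra fun h' => h i ((ord_ne_zero_iff p).1 h')))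

lemma ordTuple_apply (c : Fin r → {c : 𝒟.O // c ≠ 0}) (p : NonzeroPrime 𝒟.O) :
    𝒟.ordTuple c p = fun i => ord p (c i).1 := rfl

lemma mem_support_ordTuple {c : Fin r → {c : 𝒟.O // c ≠ 0}} {p : NonzeroPrime 𝒟.O} :
    p ∈ (𝒟.ordTuple c).support ↔ ∃ i, (c i).1 ∈ p.1 := by
  rw [Finsupp.mem_support_iff, ordTuple_apply, Function.ne_iff]
  exact exists_congr fun i => ord_ne_zero_iff p

/-- The absolute values of the coefficients are multiplicative, as the power residue symbols by
which `H` fails to be multiplicative have absolute value `1`. -/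
lemma enorm_coeffH (hn : 1 ≤ n) (c : Fin r → {c : 𝒟.O // c ≠ 0}) (m : Fin r → 𝒟.O) :
    ‖𝒟.coeffH R (fun i => (c i).1) m‖ₑ = ∏ p ∈ (𝒟.ordTuple c).support,
      ‖𝒟.localH R p (𝒟.ordTuple c p) fun i => ord p (m i)‖ₑ := by
  have hS : {p : NonzeroPrime 𝒟.O | ∃ i, (c i).1 ∈ p.1} = ((𝒟.ordTuple c).support : Set _) := by
    ext p
    exact 𝒟.mem_support_ordTuple.symm
  have hres : ∀ a b : 𝒟.O, ‖𝒟.resSymbol a b‖ₑ = 1 := fun a b => by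
    rw [← ofReal_norm, 𝒟.norm_resSymbol hn, ENNReal.ofReal_one]
  have hz : ∀ (a b : 𝒟.O) (k : ℤ), ‖𝒟.resSymbol a b ^ k‖ₑ = 1 := fun a b k => by
    rw [← ofReal_norm, norm_zpow, 𝒟.norm_resSymbol hn, one_zpow, ENNReal.ofReal_one]
  have hprod : ∀ (s : Finset (Fin r)) (f : Fin r → ℂ), (∀ i, ‖f i‖ₑ = 1) → ‖∏ i ∈ s, f i‖ₑ = 1 :=
    fun s f hf => by
      refine Finset.prod_induction f (fun z => ‖z‖ₑ = 1) (fun a b ha hb => ?_) (by simp)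
        fun i _ => hf i
      rw [enorm_mul, ha, hb, one_mul]
  have hen : ∀ (s : Finset (NonzeroPrime 𝒟.O)) (f : NonzeroPrime 𝒟.O → ℂ),
      ‖∏ p ∈ s, f p‖ₑ = ∏ p ∈ s, ‖f p‖ₑ := by
    classical
    intro s f
    induction s using Finset.induction_on with
    | empty => simp
    | insert a s ha ih => rw [Finset.prod_insert ha, Finset.prod_insert ha, enorm_mul, ih]
  rw [coeffH, hS, finprod_mem_coe_finset, hen]
  refine Finset.prod_congr rfl fun p _ => ?_
  rw [enorm_mul, enorm_mul, hprod _ _ fun i => ?_, hprod _ _ fun i => hz _ _ _, one_mul, one_mul,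
    ordTuple_apply]
  rw [enorm_mul, hz, hprod _ _ fun j => hz _ _ _, one_mul]

lemma charZero_O : CharZero 𝒟.O := (algebraMap 𝒟.O F).charZero

lemma enorm_absQ (c : Fin r → {c : 𝒟.O // c ≠ 0}) (s : 𝔥) :
    ‖𝒟.absQ R c (-s)‖ₑ = ∏ p ∈ (𝒟.ordTuple c).support,
      expE (-(Real.log (primeNorm p) * ∑ i, 𝒟.ordTuple c p i * (R.α i s).re)) := by
  have := 𝒟.charZero_O
  set U := (𝒟.ordTuple c).support with hU
  have hpos : ∀ p : NonzeroPrime 𝒟.O, (0 : ℝ) < primeNorm p := fun p => by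
    exact_mod_cast (Nat.zero_lt_two.trans_le (two_le_primeNorm F p))
  have hN : ∀ i, elemNorm (c i).1 = ∏ p ∈ U, primeNorm p ^ ord p (c i).1 := fun i =>
    elemNorm_eq_prod (c i).2 fun p hp => 𝒟.mem_support_ordTuple.2 ⟨i, hp⟩
  have hNpos : ∀ i, 0 < elemNorm (c i).1 := fun i => by
    rw [hN]
    exact Finset.prod_pos fun p _ => pow_pos (by exact_mod_cast hpos p) _
  rw [prod_expE, ← ofReal_norm, absQ, norm_prod, expE]
  congr 1
  have h1 : ∀ i, ‖(elemNorm (c i).1 : ℂ) ^ (R.α i (-s))‖ =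
      Real.exp (∑ p ∈ U, -(Real.log (primeNorm p) * (ord p (c i).1 * (R.α i s).re))) := by
    intro i
    rw [Complex.norm_natCast_cpow_of_pos (hNpos i), map_neg, Complex.neg_re,
      Real.rpow_def_of_pos (by exact_mod_cast hNpos i), hN i, Nat.cast_prod,
      Real.log_prod fun p _ => by
        rw [Nat.cast_pow]; exact (pow_pos (hpos p) _).ne', Finset.sum_mul]
    congr 1
    refine Finset.sum_congr rfl fun p _ => ?_
    rw [Nat.cast_pow, Real.log_pow]
    ring
  rw [Finset.prod_congr rfl fun i _ => h1 i, ← Real.exp_sum, Finset.sum_comm]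
  congr 1
  refine Finset.sum_congr rfl fun p _ => ?_
  rw [Finset.sum_neg_distrib, ← Finset.mul_sum]
  rfl

/-- A tuple of classes modulo units is determined by its exponents at the primes. -/
lemma ordTuple_rep_injective
    {rep : (Fin r → {a : Associates 𝒟.O // a ≠ 0}) → Fin r → {c : 𝒟.O // c ≠ 0}}
    (hrep : ∀ a i, Associates.mk (rep a i).1 = (a i).1) :
    Function.Injective fun a => 𝒟.ordTuple (rep a) := by
  intro a b h
  have h' : 𝒟.ordTuple (rep a) = 𝒟.ordTuple (rep b) := h
  funext i
  refine Subtype.ext ?_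
  rw [← hrep, ← hrep, Associates.mk_eq_mk_iff_associated, ← Ideal.span_singleton_eq_span_singleton,
    span_eq_prod (rep a i).2 (U := (𝒟.ordTuple (rep a)).support)
      fun p hp => 𝒟.mem_support_ordTuple.2 ⟨i, hp⟩,
    span_eq_prod (rep b i).2 (U := (𝒟.ordTuple (rep a)).support)
      fun p hp => h' ▸ 𝒟.mem_support_ordTuple.2 ⟨i, hp⟩]
  refine Finset.prod_congr rfl fun p _ => ?_
  rw [show ord p (rep a i).1 = ord p (rep b i).1 from congrFun (DFunLike.congr_fun h' p) i]

/-! ### Convergence -/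

/-- The conditions `Re s_i > 2` and `Re s_i > 1 + log₂ r` in the form in which they are used: the
first makes the sum over the primes converge, the second gives `∑ 2^{1 - Re s_i} < 1`. -/
lemma exists_exponents {s : 𝔥} (hs : ∀ i, max (1 + Real.logb 2 r) 2 < (R.α i s).re) :
    ∃ σ₀ T : ℝ, 2 < σ₀ ∧ (∀ i, σ₀ ≤ (R.α i s).re) ∧ T < 1 ∧
      ∑ i, (2 : ℝ) ^ (1 - (R.α i s).re) ≤ T := by
  obtain ⟨σ₀, h1, h2⟩ : ∃ σ₀ : ℝ, (∀ i, σ₀ ≤ (R.α i s).re) ∧ 2 < σ₀ := by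
    have h : ∀ᶠ x in nhdsWithin (2 : ℝ) (Set.Ioi 2), ∀ i, x ≤ (R.α i s).re :=
      Filter.eventually_all.2 fun i =>
        mem_nhdsWithin_of_mem_nhds (Iic_mem_nhds ((le_max_right _ _).trans_lt (hs i)))
    exact (h.and self_mem_nhdsWithin).exists
  refine ⟨σ₀, ∑ i, (2 : ℝ) ^ (1 - (R.α i s).re), h2, h1, ?_, le_rfl⟩
  rcases Nat.eq_zero_or_pos r with rfl | hr
  · simp
  · have hr' : (0 : ℝ) < r := by exact_mod_cast hr
    have : Nonempty (Fin r) := ⟨⟨0, hr⟩⟩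
    calc ∑ i, (2 : ℝ) ^ (1 - (R.α i s).re) < ∑ _i : Fin r, (r : ℝ)⁻¹ := by
          refine Finset.sum_lt_sum_of_nonempty Finset.univ_nonempty fun i _ => ?_
          calc (2 : ℝ) ^ (1 - (R.α i s).re) < 2 ^ (-Real.logb 2 r) :=
                Real.rpow_lt_rpow_of_exponent_lt one_lt_two
                  (by linarith [(le_max_left _ _).trans_lt (hs i)])
            _ = (r : ℝ)⁻¹ := by
                rw [Real.rpow_neg two_pos.le, Real.rpow_logb two_pos (by norm_num) hr']
      _ = 1 := by
          rw [Finset.sum_const, Finset.card_univ, Fintype.card_fin, nsmul_eq_mul,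
            mul_inv_cancel₀ hr'.ne']

/-- The series `Z(s; m, Ψ)` is dominated by the Euler product of the local series of the absolute
values of the coefficients. -/
theorem summable_zTerm (hn : 1 ≤ n) (m : Fin r → {c : 𝒟.O // c ≠ 0})
    {Ψ : 𝔥 → (Fin r → 𝒟.FSx) → ℂ} (hΨ : Ψ ∈ 𝒟.frakM R)
    {rep : (Fin r → {a : Associates 𝒟.O // a ≠ 0}) → Fin r → {c : 𝒟.O // c ≠ 0}}
    (hrep : ∀ a i, Associates.mk (rep a i).1 = (a i).1)
    {s : 𝔥} (hs : ∀ i, max (1 + Real.logb 2 r) 2 < (R.α i s).re) :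
    Summable fun a => ‖𝒟.zTerm R s m Ψ (rep a)‖ := by
  obtain ⟨σ₀, T, hσ₀, hσ, hT, hσT⟩ := exists_exponents R hs
  obtain ⟨M, hM⟩ := 𝒟.exists_norm_le_of_mem_frakM R hn hΨ s
  set w : NonzeroPrime 𝒟.O → (Fin r → ℕ) → ENNReal := fun p k =>
    ‖𝒟.localH R p k fun i => ord p (m i).1‖ₑ *
      expE (-(Real.log (primeNorm p) * ∑ i, k i * (R.α i s).re)) with hw
  have hterm : ∀ a, ‖𝒟.zTerm R s m Ψ (rep a)‖ₑ ≤ ENNReal.ofReal M * ‖𝒟.absP R m s‖ₑ *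
      ∏ p ∈ (𝒟.ordTuple (rep a)).support, w p (𝒟.ordTuple (rep a) p) := by
    intro a
    rw [zTerm, enorm_mul, enorm_mul, enorm_mul, 𝒟.enorm_coeffH R hn, enorm_absQ, hw,
      Finset.prod_mul_distrib, ← ofReal_norm (Ψ s _)]
    calc _ ≤ _ * ENNReal.ofReal M * _ * _ :=
          mul_le_mul' (mul_le_mul' (mul_le_mul' le_rfl
            (ENNReal.ofReal_le_ofReal (hM _))) le_rfl) le_rfl
      _ = _ := by ring
  have hlocal : ∀ p, ∑' k : {k : Fin r → ℕ // k ≠ 0}, w p k ≤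
      ENNReal.ofReal ((primeNorm p : ℝ) ^ (-(σ₀ - 1))) *
        (expE ((σ₀ - 1) * Real.log 2) * expE (9 * (1 - T)⁻¹)) := by
    intro p
    have hq := two_le_primeNorm F p
    refine (tsum_nSeries_le R hn hq (𝒟.norm_gammaFun_le hn p) hσ₀.le hσ hT hσT).trans
      (le_of_eq ?_)
    have h : expE ((1 - σ₀) * (Real.log (primeNorm p) - Real.log 2)) =
        ENNReal.ofReal ((primeNorm p : ℝ) ^ (-(σ₀ - 1))) * expE ((σ₀ - 1) * Real.log 2) := by
      rw [Real.rpow_def_of_pos (by exact_mod_cast (by omega : 0 < primeNorm p)), ← expE,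
        ← expE_add]
      congr 1
      ring
    rw [h, mul_assoc]
  have hsum : ∑' p, ∑' k : {k : Fin r → ℕ // k ≠ 0}, w p k ≠ ⊤ := by
    refine ne_top_of_le_ne_top ?_ (ENNReal.tsum_le_tsum hlocal)
    rw [ENNReal.tsum_mul_right]
    exact ENNReal.mul_ne_top (tsum_primeNorm_ne_top F (by linarith))
      (ENNReal.mul_ne_top (expE_ne_top _) (expE_ne_top _))
  have htotal : ∑' a, ‖𝒟.zTerm R s m Ψ (rep a)‖ₑ ≠ ⊤ := by
    refine ne_top_of_le_ne_top ?_ (ENNReal.tsum_le_tsum hterm)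
    rw [ENNReal.tsum_mul_left]
    refine ENNReal.mul_ne_top (ENNReal.mul_ne_top ENNReal.ofReal_ne_top enorm_ne_top) ?_
    exact ne_top_of_le_ne_top (tsum_finsupp_prod_ne_top w hsum)
      (ENNReal.tsum_comp_le_tsum_of_injective (𝒟.ordTuple_rep_injective hrep) fun k =>
        ∏ p ∈ k.support, w p (k p))
  exact (ENNReal.summable_toReal htotal).congr fun a => toReal_enorm _

end ArithDatum

end

end KMDirichlet

end

/-- The series `Z(s; m, Ψ)` runs over the tuples `c` of classes `0 ≠ c_i ∈ 𝔬_S / 𝔬_S^×`; `rep` is an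
arbitrary choice of representatives of these tuples. -/
theorem theorem5p2 {r : ℕ} (C : CartanDatum r) {𝔥 : Type*} [AddCommGroup 𝔥] [Module ℂ 𝔥]
    (R : Realization C 𝔥) {F : Type*} [Field F] [NumberField F] {n : ℕ} (hn : 1 ≤ n)
    (𝒟 : ArithDatum F n) (m : Fin r → {c : 𝒟.O // c ≠ 0})
    (Ψ : 𝔥 → (Fin r → 𝒟.FSx) → ℂ) (hΨ : Ψ ∈ 𝒟.frakM R)
    (rep : (Fin r → {a : Associates 𝒟.O // a ≠ 0}) → Fin r → {c : 𝒟.O // c ≠ 0})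
    (hrep : ∀ a i, Associates.mk (rep a i).1 = (a i).1)
    (s : 𝔥) (hs : ∀ i, max (1 + Real.logb 2 r) 2 < (R.α i s).re) :
    Summable fun a => ‖𝒟.zTerm R s m Ψ (rep a)‖ := by
  exact 𝒟.summable_zTerm R hn m hΨ hrep hs
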